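/- Let $p$ be a prime. Let $X_0$ be the set of isomorphism classes of finite abelian $p$-groups, equivalently of finite $\mathbb{Z}_p$-modules, and $X_1$ the set of isomorphism classes of finitely generated $\mathbb{Z}_p$-modules of $\mathbb{Q}_p$-rank $1$. Put $c_0=\prod_{i\ge 1}(1-p^{-i})$ and $\mu_0(G)=c_0/\#\mathrm{Aut}(G)$ for $G\in X_0$. Let $L^2(X_0,\mu_0)^*$ be the space of all real (signed) measures $\nu$ on $X_0$, given by their values $\nu(G)$, with $\sum_{G}\nu(G)^2/\mu_0(G)<\infty$, equipped with the inner product $\langle\nu,\eta\rangle=\sum_{G\in X_0}\nu(G)\eta(G)/\mu_0(G)$. For $G\in X_0$ let $d^*(G)\in X_1$ be the random module $H$ in the extension $0\to\mathbb{Z}_p\to H\to G\to 0$ corresponding to a uniformly random element of $\mathrm{Ext}^1_{\mathbb{Z}_p}(G,\mathbb{Z}_p)$. For $H\in X_1$ let $d(H)$ be the quotient of $H$ by the submodule generated by a Haar-random element of $H$. Let $$P(G\to G')=\sum_{H\in X_1}\mathbb{P}(d^*(G)\cong H)\,\mathbb{P}(d(H)\cong G')\qquad(G,G'\in X_0)$$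 be the transition probabilities of $\Delta_0=d\,d^*$, which acts on measures by $(\Delta_0\nu)(G')=\sum_{G\in X_0}\nu(G)\,P(G\to G')$. Then these sums converge for all $\nu\in L^2(X_0,\mu_0)^*$ and define a bounded linear operator $\Delta_0$ on $L^2(X_0,\mu_0)^*$. There is a unique continuous linear operator $\mathfrak{F}$ on $L^2(X_0,\mu_0)^*$ that takes, for every $F\in X_0$, the measure $\#\mathrm{Sur}(F,\cdot)/\#\mathrm{Aut}(\cdot)$ to the measure $\sqrt{c_0}\,\#\mathrm{Sur}(\cdot,F)/\#\mathrm{Aut}(\cdot)$, where $\#\mathrm{Sur}(A,B)$ is the number of surjective homomorphisms $A\to B$. The operator $\mathfrak{F}$ preserves norms, and $$\mathrm{im}(\mathfrak{F})^{\perp}=\ker(\Delta_0),\qquad \mathrm{im}(\mathfrak{F})=\ker(\Delta_0)^{\perp},\qquad \mathrm{im}(\Delta_0)\subseteq\mathrm{im}(\mathfrak{F}),$$ where kernels, images and orthogonal complements are taken in $L^2(X_0,\mu_0)^*$. -/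

import Mathlib

open CategoryTheory MeasureTheory

namespace CohenLenstra

/-- A finite `ℤ_[p]`-module. This is the same thing as a finite abelian `p`-group: such a group has
exactly one `ℤ_[p]`-module structure, and its group homomorphisms are the `ℤ_[p]`-linear maps. -/
structure FinMod (p : ℕ) [Fact p.Prime] : Type 1 where
  carrier : Type
  [addCommGroup : AddCommGroup carrier]
  [module : Module ℤ_[p] carrier]
  [finite : Finite carrier]

attribute [instance] FinMod.addCommGroup FinMod.module FinMod.finite

/-- A finitely generated `ℤ_[p]`-module of `ℚ_[p]`-rank one. -/
structure RankOneMod (p : ℕ) [Fact p.Prime] : Type 1 where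
  carrier : Type
  [addCommGroup : AddCommGroup carrier]
  [module : Module ℤ_[p] carrier]
  [finite : Module.Finite ℤ_[p] carrier]
  finrank_eq : Module.finrank ℤ_[p] carrier = 1

attribute [instance] RankOneMod.addCommGroup RankOneMod.module RankOneMod.finite

/-- The isomorphism relation on finite `ℤ_[p]`-modules. -/
instance FinMod.setoid (p : ℕ) [Fact p.Prime] : Setoid (FinMod p) where
  r A B := Nonempty (A.carrier ≃ₗ[ℤ_[p]] B.carrier)
  iseqv := ⟨fun _ => ⟨LinearEquiv.refl _ _⟩, fun ⟨e⟩ => ⟨e.symm⟩, fun ⟨e⟩ ⟨f⟩ => ⟨e.trans f⟩⟩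

/-- The isomorphism relation on finitely generated `ℤ_[p]`-modules of rank one. -/
instance RankOneMod.setoid (p : ℕ) [Fact p.Prime] : Setoid (RankOneMod p) where
  r A B := Nonempty (A.carrier ≃ₗ[ℤ_[p]] B.carrier)
  iseqv := ⟨fun _ => ⟨LinearEquiv.refl _ _⟩, fun ⟨e⟩ => ⟨e.symm⟩, fun ⟨e⟩ ⟨f⟩ => ⟨e.trans f⟩⟩

/-- `X₀`: the set of isomorphism classes of finite abelian `p`-groups. -/
abbrev X0 (p : ℕ) [Fact p.Prime] : Type 1 := Quotient (FinMod.setoid p)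

/-- `X₁`: the set of isomorphism classes of finitely generated `ℤ_[p]`-modules of rank one. -/
abbrev X1 (p : ℕ) [Fact p.Prime] : Type 1 := Quotient (RankOneMod.setoid p)

section Counting

variable {p : ℕ} [Fact p.Prime]

/-- A chosen group in the isomorphism class `G`. -/
noncomputable abbrev X0.grp (G : X0 p) : Type := (Quotient.out G).carrier

/-- A chosen module in the isomorphism class `H`. -/
noncomputable abbrev X1.mod (H : X1 p) : Type := (Quotient.out H).carrier

/-- `#Aut(G)`. -/
noncomputable def cardAut (G : X0 p) : ℕ := Nat.card (G.grp ≃ₗ[ℤ_[p]] G.grp)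

/-- `#Sur(F, G)`, the number of surjective homomorphisms from `F` to `G`. -/
noncomputable def cardSur (F G : X0 p) : ℕ :=
  Nat.card {f : F.grp →ₗ[ℤ_[p]] G.grp // Function.Surjective f}

end Counting

/-! ### The random operators `d`, `d*` and `Δ₀ = d d*`, through their transition probabilities -/

section Operators

variable {p : ℕ} [Fact p.Prime]

/-- The probability that `d*` takes `G` to `H`: the proportion of classes `e` in `Ext¹(G, ℤ_p)` that
are the class of a short exact sequence `0 → ℤ_p → H → G → 0`. -/
noncomputable def dStarProb (G : X0 p) (H : X1 p) : ℝ :=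
  (Nat.card {e : Abelian.Ext (ModuleCat.of ℤ_[p] G.grp) (ModuleCat.of ℤ_[p] ℤ_[p]) 1 //
      ∃ (f : ModuleCat.of ℤ_[p] ℤ_[p] ⟶ ModuleCat.of ℤ_[p] H.mod)
        (g : ModuleCat.of ℤ_[p] H.mod ⟶ ModuleCat.of ℤ_[p] G.grp) (w : f ≫ g = 0)
        (h : (ShortComplex.mk f g w).ShortExact), h.extClass = e} : ℝ) /
    (Nat.card (Abelian.Ext (ModuleCat.of ℤ_[p] G.grp) (ModuleCat.of ℤ_[p] ℤ_[p]) 1) : ℝ)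

theorem compactSpace_moduleTopology (M : Type) [AddCommGroup M] [Module ℤ_[p] M]
    [Module.Finite ℤ_[p] M] : @CompactSpace M (moduleTopology ℤ_[p] M) := by
  let _ : TopologicalSpace M := moduleTopology ℤ_[p] M
  have _ : IsModuleTopology ℤ_[p] M := ⟨rfl⟩
  have _ : ContinuousAdd M := IsModuleTopology.toContinuousAdd ℤ_[p] M
  obtain ⟨n, f, hf⟩ := Module.Finite.exists_fin' ℤ_[p] M
  have hc : Continuous f := IsModuleTopology.continuous_of_linearMap f
  rw [← isCompact_univ_iff, ← hf.range_eq]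
  exact isCompact_range hc

/-- The probability that a Haar-random element of the finitely generated `ℤ_[p]`-module `M` lies in
`A`: the value on `A` of the Haar measure of total mass one on `M`. The topology of `M` is the module
topology, i.e. the `p`-adic one, in which `M` is a compact group. -/
noncomputable def haarProb (M : Type) [AddCommGroup M] [Module ℤ_[p] M] [Module.Finite ℤ_[p] M]
    (A : Set M) : ℝ :=
  letI : TopologicalSpace M := moduleTopology ℤ_[p] M
  haveI : IsModuleTopology ℤ_[p] M := ⟨rfl⟩
  haveI : IsTopologicalAddGroup M := IsModuleTopology.topologicalAddGroup ℤ_[p] M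
  haveI : CompactSpace M := compactSpace_moduleTopology M
  letI : MeasurableSpace M := borel M
  haveI : BorelSpace M := ⟨rfl⟩
  (Measure.addHaarMeasure (⊤ : TopologicalSpace.PositiveCompacts M) A).toReal

/-- The probability that `d` takes `H` to `G`: the probability that the quotient of `H` by the
submodule generated by a Haar-random element of `H` is isomorphic to `G`. -/
noncomputable def dProb (H : X1 p) (G : X0 p) : ℝ :=
  haarProb (p := p) H.mod
    {h | Nonempty ((H.mod ⧸ Submodule.span ℤ_[p] {h}) ≃ₗ[ℤ_[p]] G.grp)}

/-- The probability that `Δ₀ = d d*` takes `G` to `G'`. -/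
noncomputable def deltaProb (G G' : X0 p) : ℝ := ∑' H : X1 p, dStarProb G H * dProb H G'

end Operators

/-! ### The Cohen-Lenstra measure and the Hilbert space `L²(X₀, μ₀)*` -/

/-- The constant `c₀ = ∏_{i ≥ 1} (1 - 1 / p ^ i)`. -/
noncomputable def c0 (p : ℕ) : ℝ := ∏' i : ℕ, (1 - 1 / (p : ℝ) ^ (i + 1))

theorem c0_pos (p : ℕ) [hp : Fact p.Prime] : 0 < c0 p := by
  have h1 : (1 : ℝ) < p := by exact_mod_cast hp.out.one_lt
  have hs : Summable (fun i : ℕ => -(1 / (p : ℝ) ^ (i + 1))) := by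
    have := (summable_geometric_of_lt_one (r := 1 / (p : ℝ)) (by positivity)
      (by rw [div_lt_one (by linarith)]; exact h1))
    have h2 := (summable_nat_add_iff 1).2 this
    simpa [one_div, inv_pow] using h2.neg
  have hpos : ∀ i : ℕ, 0 < 1 + -(1 / (p : ℝ) ^ (i + 1)) := by
    intro i
    have : 1 / (p : ℝ) ^ (i + 1) < 1 := by
      rw [div_lt_one (by positivity)]
      exact one_lt_pow₀ h1 (by omega)
    linarith
  have := Real.rexp_tsum_eq_tprod hpos (Real.summable_log_one_add_of_summable hs)
  unfold c0
  simp only [sub_eq_add_neg]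
  rw [← this]
  exact Real.exp_pos _

section Space

variable {p : ℕ} [Fact p.Prime]

/-- The Cohen-Lenstra measure `μ₀(G) = c₀ / #Aut(G)`. -/
noncomputable def mu0 (G : X0 p) : ℝ := c0 p / cardAut G

theorem cardAut_pos (G : X0 p) : 0 < cardAut G := by
  have _ : Finite (G.grp ≃ₗ[ℤ_[p]] G.grp) :=
    Finite.of_injective (fun e => (e : G.grp → G.grp)) DFunLike.coe_injective
  exact Nat.card_pos

theorem mu0_pos (G : X0 p) : 0 < mu0 G :=
  div_pos (c0_pos p) (by exact_mod_cast cardAut_pos G)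

theorem summable_mul_div {ν η : X0 p → ℝ} (hν : Summable fun G => ν G ^ 2 / mu0 G)
    (hη : Summable fun G => η G ^ 2 / mu0 G) : Summable fun G => ν G * η G / mu0 G := by
  refine Summable.of_norm_bounded (hν.add hη) fun G => ?_
  have hm := mu0_pos G
  rw [Real.norm_eq_abs, abs_div, abs_of_pos hm, ← add_div, abs_mul]
  gcongr
  rw [← sq_abs (ν G), ← sq_abs (η G)]
  nlinarith [sq_nonneg (|ν G| - |η G|), abs_nonneg (ν G), abs_nonneg (η G),
    mul_nonneg (abs_nonneg (ν G)) (abs_nonneg (η G))]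

end Space

/-- The square-summable measures on `X₀`, as a subspace of all (signed) measures; a measure on the
discrete set `X₀` is given by its values `ν G`. -/
def squareSummable (p : ℕ) [Fact p.Prime] : Submodule ℝ (X0 p → ℝ) where
  carrier := {ν | Summable fun G => ν G ^ 2 / mu0 G}
  zero_mem' := by simp
  add_mem' := by
    intro ν η hν hη
    refine ((hν.add hη).add ((summable_mul_div hν hη).mul_left 2)).congr fun G => ?_
    simp only [Pi.add_apply]
    ring
  smul_mem' := by
    intro c ν hν
    refine (hν.mul_left (c ^ 2)).congr fun G => ?_
    simp only [Pi.smul_apply, smul_eq_mul]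
    ring

/-- The space `L²(X₀, μ₀)*` of square-summable measures on `X₀`. -/
def L2 (p : ℕ) [Fact p.Prime] : Type 1 := squareSummable p

section Hilbert

variable {p : ℕ} [Fact p.Prime]

noncomputable instance : AddCommGroup (L2 p) := inferInstanceAs (AddCommGroup (squareSummable p))

noncomputable instance : Module ℝ (L2 p) := inferInstanceAs (Module ℝ (squareSummable p))

/-- `ν G` is the mass that the measure `ν` gives to `G`. -/
instance : CoeFun (L2 p) (fun _ => X0 p → ℝ) := ⟨fun ν => ν.1⟩

/-- The inner product `⟨ν, η⟩ = ∑_G ν(G) η(G) / μ₀(G)`. -/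
@[reducible]
noncomputable def L2.core : InnerProductSpace.Core ℝ (L2 p) where
  inner ν η := ∑' G : X0 p, ν G * η G / mu0 G
  conj_inner_symm ν η := by
    simp only [conj_trivial]
    exact tsum_congr fun G => by ring
  re_inner_nonneg ν := by
    simp only [RCLike.re_to_real]
    exact tsum_nonneg fun G => div_nonneg (mul_self_nonneg _) (mu0_pos G).le
  add_left ν η ξ := by
    rw [← (summable_mul_div ν.2 ξ.2).tsum_add (summable_mul_div η.2 ξ.2)]
    refine tsum_congr fun G => ?_
    change (ν G + η G) * ξ G / mu0 G = _
    ring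
  smul_left ν η c := by
    simp only [conj_trivial]
    rw [← tsum_mul_left]
    refine tsum_congr fun G => ?_
    change (c * ν G) * η G / mu0 G = _
    ring
  definite ν h := by
    have hnn : ∀ G : X0 p, 0 ≤ ν G * ν G / mu0 G := fun G =>
      div_nonneg (mul_self_nonneg _) (mu0_pos G).le
    have h0 := (hasSum_zero_iff_of_nonneg hnn).1 (h ▸ (summable_mul_div ν.2 ν.2).hasSum)
    apply Subtype.ext
    funext G
    have := congrFun h0 G
    change ν G = 0
    simpa [(mu0_pos G).ne'] using this

noncomputable instance : NormedAddCommGroup (L2 p) := L2.core.toNormedAddCommGroup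

noncomputable instance : InnerProductSpace ℝ (L2 p) := InnerProductSpace.ofCore L2.core.toCore

end Hilbert

/-! ### The operators on `L²(X₀, μ₀)*` -/

section Fourier

variable {p : ℕ} [Fact p.Prime]

theorem finite_cardSur_ne_zero (F : X0 p) : {G : X0 p | cardSur F G ≠ 0}.Finite := by
  have _ : Finite (Submodule ℤ_[p] F.grp) :=
    Finite.of_injective (fun N => (N : Set F.grp)) SetLike.coe_injective
  refine (Set.finite_range fun N : Submodule ℤ_[p] F.grp =>
    (Quotient.mk (FinMod.setoid p)
      { carrier := F.grp ⧸ N, finite := Finite.of_surjective _ N.mkQ_surjective } : X0 p)).subset fun G hG => ?_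
  obtain ⟨⟨f, hf⟩⟩ := (Nat.card_ne_zero.1 hG).1
  refine ⟨LinearMap.ker f, Eq.trans (Quotient.sound ?_) (Quotient.out_eq G)⟩
  exact ⟨f.quotKerEquivOfSurjective hf⟩

/-- The finitely supported measure `#Sur(F, ·) / #Aut(·)`. -/
noncomputable def surFrom (F : X0 p) : L2 p :=
  ⟨fun G => (cardSur F G : ℝ) / cardAut G,
    summable_of_hasFiniteSupport ((finite_cardSur_ne_zero F).subset fun G hG => by
      rw [Function.mem_support] at hG
      intro h
      simp [h] at hG)⟩

/-- `Δ` is the Cohen-Lenstra operator `Δ₀` on `L²(X₀, μ₀)*`: it sends a measure `ν` to its image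
`G' ↦ ∑_G ν(G) P(G → G')` under the random operator `Δ₀`. -/
def IsDelta0 (Δ : L2 p →L[ℝ] L2 p) : Prop :=
  ∀ (ν : L2 p) (G' : X0 p), HasSum (fun G : X0 p => ν G * deltaProb G G') (Δ ν G')

/-- `T` takes the measure `#Sur(F, ·) / #Aut(·)` to the measure `√c₀ #Sur(·, F) / #Aut(·)`,
for every `F`. -/
def IsFourier (T : L2 p →L[ℝ] L2 p) : Prop :=
  ∀ F G : X0 p, T (surFrom F) G = √(c0 p) * ((cardSur G F : ℝ) / cardAut G)

end Fourier

end CohenLenstra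

/-!
The Fourier operator `𝔉` turns out to be unitary and `Δ₀` to be injective, so that all three
relations between kernels and images become equalities between `⊤` and `⊥`. Both facts are read off
from surjection moments `∑ G, ν G * #Sur(G, F)`.

*Isometry of `𝔉`.* The measures `#Sur(F, ·) / #Aut(·)` are unitriangular with respect to the order
of the groups, hence total, so `𝔉` is determined by its values on them. It exists and preserves
norms because the Gram matrices of the two families agree (`inner_surTo_eq_inner_surFrom`). By
Goursat's lemma, both count subdirect products of `F` and `F'` (`tsum_wt_mul_numSur_from`,
`tsum_wt_mul_numSur_mul_numSur`). For the second family this uses that every surjection moment of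
the weights `1 / #Aut` equals their total mass `1 / c₀` (`tsum_wt_mul_numSur`, `tsum_wt`), which in
turn comes from counting the extensions of `Q` by `K` of a given isomorphism type by means of
`Ext¹(Q, K)` and `Hom(Q, K)`, two groups of the same order (`tsum_wt_mul_card_extensions`).

*Surjectivity of `𝔉`.* The inner product of `ν` with `√c₀ #Sur(·, F) / #Aut(·)` is a constant times
the `F`-moment of `ν`. Surjectivity therefore means that a square-summable measure all of whose
moments vanish is zero (`eq_zero_of_tsum_mul_cardSur`). Square-summability bounds the contribution
of the groups of rank `s` to the moment of a group of rank `r` by about `p ^ (r s - s ^ 2 / 2)`.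
Moments of `F × (ℤ/p)^i` show that these contributions are orthogonal to all powers of `p ^ s`, and
the decay is just fast enough to test them against the polynomials `∏ (1 - X / p ^ i)` and to
conclude that each of them vanishes (`eq_zero_of_hasSum_pow`, `VanishingMoments.tsum_rank_eq`). The
groups of a single rank are then separated by their reductions modulo powers of `p`
(`VanishingMoments.eq_zero`).

*The operator `Δ₀`.* Passing from `H` to `d H` divides the `F`-moment `#Sur(H, F)` by `#F`, as a
surjection survives exactly if the random element lies in its kernel
(`tsum_measure_quotientSet_mul`). The expected number of homomorphisms from `d* G` to `F` is the sum
of `#Hom(G, F / x)` over `x ∈ F`, where `x` is the image of the generator of `ℤ_p`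
(`sum_card_hom_middle`, `sum_dStarMoment`). Applied to `μ₀`, these formulas show that `μ₀` is
stationary, by uniqueness of moments (`HasMoments.unique`, `hasSum_mu0_mul_deltaProb`). Jensen's
inequality then makes `Δ₀` a contraction. If `Δ₀ ν = 0`, the `F`-moments of `d* ν` vanish for
all `F`, so the sum over `x ∈ F` of the homomorphism moments of `ν` for `F / x` is zero. The term
`x = 0` belongs to `F` itself and the others to smaller groups, so all moments of `ν` vanish by
induction on `#F` (`tsum_mul_cardSur_eq_zero`), and `ν = 0` (`delta_injective`).
-/

namespace CohenLenstra

open scoped ENNReal InnerProductSpace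
open Filter Topology

/-! ### Extensions of modules and `Ext¹` -/

section Extensions

variable {R : Type} [CommRing R]
  {K H H' Q C F : Type} [AddCommGroup K] [Module R K] [AddCommGroup H] [Module R H]
  [AddCommGroup H'] [Module R H'] [AddCommGroup Q] [Module R Q] [AddCommGroup C] [Module R C]
  [AddCommGroup F] [Module R F]

/-- `0 → K → H → Q → 0` is a short exact sequence of modules. -/
structure IsExtension (i : K →ₗ[R] H) (π : H →ₗ[R] Q) : Prop where
  inj : Function.Injective i
  exact : Function.Exact i π
  surj : Function.Surjective π

/-- The group `Ext¹(Q, K)`. -/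
abbrev ExtOne (R Q K : Type) [CommRing R] [AddCommGroup Q] [Module R Q] [AddCommGroup K]
    [Module R K] : Type := Abelian.Ext (ModuleCat.of R Q) (ModuleCat.of R K) 1

variable (Q) in
/-- The map `Ext¹(Q, K) → Ext¹(Q, F)` induced by a linear map `K → F`. -/
noncomputable abbrev ExtOne.map (x : K →ₗ[R] F) : ExtOne R Q K →+ ExtOne R Q F :=
  (Abelian.Ext.mk₀ (ModuleCat.ofHom x)).postcomp (ModuleCat.of R Q) (add_zero 1)

namespace IsExtension

variable {i : K →ₗ[R] H} {π : H →ₗ[R] Q} {i' : K →ₗ[R] H'} {π' : H' →ₗ[R] Q}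

theorem comp_eq_zero (h : IsExtension i π) : π ∘ₗ i = 0 :=
  LinearMap.ext fun k => h.exact.apply_apply_eq_zero k

theorem ofHom_comp (h : IsExtension i π) : ModuleCat.ofHom i ≫ ModuleCat.ofHom π = 0 := by
  rw [← ModuleCat.ofHom_comp, h.comp_eq_zero, ModuleCat.ofHom_zero]

theorem shortExact (h : IsExtension i π) :
    (ShortComplex.mk (ModuleCat.ofHom i) (ModuleCat.ofHom π) h.ofHom_comp).ShortExact :=
  ModuleCat.shortComplex_shortExact _ h.exact h.inj h.surj

/-- The class in `Ext¹(Q, K)` of an extension of `Q` by `K`. -/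
noncomputable def extClass (h : IsExtension i π) : ExtOne R Q K := h.shortExact.extClass

/-- The kernel of a surjection, as an extension. -/
theorem of_surjective {π : H →ₗ[R] Q} (hπ : Function.Surjective π) :
    IsExtension (LinearMap.ker π).subtype π :=
  ⟨Subtype.val_injective, LinearMap.exact_subtype_ker_map π, hπ⟩

theorem ker_eq_range (h : IsExtension i π) : LinearMap.ker π = LinearMap.range i :=
  h.exact.linearMap_ker_eq

/-- A linear map that vanishes on the submodule factors through the quotient. -/
theorem exists_descend (h : IsExtension i π) (f : H →ₗ[R] F) (hf : f ∘ₗ i = 0) :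
    ∃ g : Q →ₗ[R] F, g ∘ₗ π = f := by
  have hk : LinearMap.ker π ≤ LinearMap.ker f := by
    rw [h.ker_eq_range]
    rintro _ ⟨k, rfl⟩
    exact LinearMap.congr_fun hf k
  refine ⟨(LinearMap.ker π).liftQ f hk ∘ₗ (π.quotKerEquivOfSurjective h.surj).symm.toLinearMap, ?_⟩
  ext x
  have : (π.quotKerEquivOfSurjective h.surj).symm (π x) = (LinearMap.ker π).mkQ x := by
    rw [LinearEquiv.symm_apply_eq]; rfl
  simp [this]

/-- A linear map `x` on the submodule extends to the middle term exactly if it kills the class. -/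
theorem exists_extend_iff (h : IsExtension i π) (x : K →ₗ[R] F) :
    (∃ f : H →ₗ[R] F, f ∘ₗ i = x) ↔ ExtOne.map Q x h.extClass = 0 := by
  constructor
  · rintro ⟨f, rfl⟩
    change h.extClass.comp (Abelian.Ext.mk₀ (ModuleCat.ofHom (f ∘ₗ i))) (add_zero 1) = 0
    rw [ModuleCat.ofHom_comp, ← Abelian.Ext.mk₀_comp_mk₀]
    exact h.shortExact.extClass_comp_assoc _
  · intro hx
    obtain ⟨y, hy⟩ := Abelian.Ext.contravariant_sequence_exact₁ h.shortExact (ModuleCat.of R F)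
      (Abelian.Ext.mk₀ (ModuleCat.ofHom x)) (add_zero 1) hx
    obtain ⟨f, rfl⟩ := (Abelian.Ext.mk₀_bijective _ _).2 y
    rw [Abelian.Ext.mk₀_comp_mk₀] at hy
    have := (Abelian.Ext.mk₀_bijective _ _).1 hy
    refine ⟨f.hom, ?_⟩
    have := congrArg ModuleCat.Hom.hom this
    simpa using this

/-- A morphism of extensions with identical outer terms is an isomorphism. -/
theorem bijective_of_comp_eq (h : IsExtension i π) (h' : IsExtension i' π') (f : H →ₗ[R] H')
    (hi : f ∘ₗ i = i') (hπ : π' ∘ₗ f = π) : Function.Bijective f := by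
  have hi' : ∀ k, f (i k) = i' k := LinearMap.congr_fun hi
  have hπ' : ∀ x, π' (f x) = π x := LinearMap.congr_fun hπ
  constructor
  · rw [injective_iff_map_eq_zero]
    intro x hx
    obtain ⟨k, rfl⟩ := (h.exact x).1 (by rw [← hπ', hx, map_zero])
    rw [hi'] at hx
    rw [h'.inj (hx.trans (map_zero i').symm), map_zero]
  · intro y
    obtain ⟨x, hx⟩ := h.surj (π' y)
    obtain ⟨k, hk⟩ := (h'.exact (y - f x)).1 (by rw [map_sub, hπ', hx, sub_self])
    exact ⟨i k + x, by rw [map_add, hi', hk, sub_add_cancel]⟩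

theorem extClass_map_eq (h : IsExtension i π) (a : K →ₗ[R] C) {j : C →ₗ[R] H'}
    (h' : IsExtension j π') (f : H →ₗ[R] H') (hi : f ∘ₗ i = j ∘ₗ a) (hπ : π' ∘ₗ f = π) :
    ExtOne.map Q a h.extClass = h'.extClass := by
  have := ShortComplex.ShortExact.extClass_naturality h.shortExact h'.shortExact
    { τ₁ := ModuleCat.ofHom a, τ₂ := ModuleCat.ofHom f, τ₃ := 𝟙 _
      comm₁₂ := by
        change ModuleCat.ofHom a ≫ ModuleCat.ofHom j = ModuleCat.ofHom i ≫ ModuleCat.ofHom f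
        rw [← ModuleCat.ofHom_comp, ← ModuleCat.ofHom_comp, hi]
      comm₂₃ := by
        change ModuleCat.ofHom f ≫ ModuleCat.ofHom π' = ModuleCat.ofHom π ≫ 𝟙 _
        rw [← ModuleCat.ofHom_comp, hπ, Category.comp_id] }
  refine this.trans ?_
  exact Abelian.Ext.mk₀_id_comp _

theorem extClass_eq_of_comp_eq (h : IsExtension i π) (h' : IsExtension i' π') (f : H →ₗ[R] H')
    (hi : f ∘ₗ i = i') (hπ : π' ∘ₗ f = π) : h.extClass = h'.extClass := by
  rw [← h.extClass_map_eq LinearMap.id h' f (by simpa using hi) hπ]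
  exact (Abelian.Ext.comp_mk₀_id _).symm

/-- Two extensions with the same class are isomorphic, by an isomorphism that is compatible with the
outer terms. -/
theorem exists_equiv_of_extClass_eq (h : IsExtension i π) (h' : IsExtension i' π')
    (he : h.extClass = h'.extClass) :
    ∃ f : H ≃ₗ[R] H', f.toLinearMap ∘ₗ i = i' ∧ π' ∘ₗ f.toLinearMap = π := by
  obtain ⟨f, hf⟩ := (h.exists_extend_iff i').2 (by
    rw [he]; exact (h'.exists_extend_iff i').1 ⟨LinearMap.id, rfl⟩)
  obtain ⟨g, hg⟩ := h.exists_descend (π' ∘ₗ f) (by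
    rw [LinearMap.comp_assoc, hf, h'.comp_eq_zero])
  -- `f` induces an endomorphism `g` of `Q` that fixes the class, so `g - 1` lifts to `H'`
  have hnat := ShortComplex.ShortExact.extClass_naturality h.shortExact h'.shortExact
    { τ₁ := 𝟙 _, τ₂ := ModuleCat.ofHom f, τ₃ := ModuleCat.ofHom g
      comm₁₂ := by
        change 𝟙 _ ≫ ModuleCat.ofHom i' = ModuleCat.ofHom i ≫ ModuleCat.ofHom f
        rw [← ModuleCat.ofHom_comp, hf, Category.id_comp]
      comm₂₃ := by
        change ModuleCat.ofHom f ≫ ModuleCat.ofHom π' = ModuleCat.ofHom π ≫ ModuleCat.ofHom g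
        rw [← ModuleCat.ofHom_comp, ← ModuleCat.ofHom_comp, hg] }
  have h1 : h'.extClass = (Abelian.Ext.mk₀ (ModuleCat.ofHom g)).comp h'.extClass (zero_add 1) := by
    rw [← he]
    refine ((Abelian.Ext.comp_mk₀_id h.extClass).symm.trans hnat).trans ?_
    rw [he]; rfl
  have h2 : (Abelian.Ext.mk₀ (ModuleCat.ofHom (LinearMap.id - g))).comp
      h'.shortExact.extClass (zero_add 1) = 0 := by
    have : ModuleCat.ofHom (LinearMap.id - g : Q →ₗ[R] Q) = 𝟙 _ + -ModuleCat.ofHom g := by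
      ext x; simp [sub_eq_add_neg]
    rw [this, Abelian.Ext.mk₀_add, Abelian.Ext.mk₀_neg, Abelian.Ext.add_comp, Abelian.Ext.neg_comp]
    refine (add_neg_eq_zero).2 ?_
    exact (Abelian.Ext.mk₀_id_comp _).trans h1
  obtain ⟨y, hy⟩ := Abelian.Ext.covariant_sequence_exact₃ (ModuleCat.of R Q) h'.shortExact _
    (zero_add 1) h2
  obtain ⟨k, rfl⟩ := (Abelian.Ext.mk₀_bijective _ _).2 y
  rw [Abelian.Ext.mk₀_comp_mk₀] at hy
  have hk : π' ∘ₗ k.hom = LinearMap.id - g := by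
    have := congrArg ModuleCat.Hom.hom ((Abelian.Ext.mk₀_bijective _ _).1 hy)
    simpa using this
  have c1 : (f + k.hom ∘ₗ π) ∘ₗ i = i' := by
    rw [LinearMap.add_comp, LinearMap.comp_assoc, h.comp_eq_zero, LinearMap.comp_zero, add_zero, hf]
  have c2 : π' ∘ₗ (f + k.hom ∘ₗ π) = π := by
    rw [LinearMap.comp_add, ← LinearMap.comp_assoc, hk, ← hg, LinearMap.sub_comp, LinearMap.id_comp]
    abel
  exact ⟨LinearEquiv.ofBijective _ (h.bijective_of_comp_eq h' _ c1 c2), c1, c2⟩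

end IsExtension

instance projective_of_free (L : Type) [AddCommGroup L] [Module R L] [Module.Free R L] :
    Projective (ModuleCat.of R L) := inferInstance

/-- The connecting map `Hom(N, K) → Ext¹(Q, K)` is onto if the middle term is free. -/
theorem IsExtension.exists_map_extClass {L N : Type} [AddCommGroup L] [Module R L]
    [AddCommGroup N] [Module R N] [Module.Free R L] {i : N →ₗ[R] L} {π : L →ₗ[R] Q}
    (h : IsExtension i π) (e : ExtOne R Q K) : ∃ a : N →ₗ[R] K, ExtOne.map Q a h.extClass = e := by
  have : Projective (ModuleCat.of R L) := projective_of_free L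
  obtain ⟨y, hy⟩ := Abelian.Ext.contravariant_sequence_exact₃ h.shortExact (ModuleCat.of R K) e
    (Abelian.Ext.eq_zero_of_projective (P := ModuleCat.of R L) _) (add_zero 1)
  obtain ⟨a, rfl⟩ := (Abelian.Ext.mk₀_bijective _ _).2 y
  exact ⟨a.hom, hy⟩

/-- Every class in `Ext¹(Q, K)` is the class of an extension. -/
theorem exists_extension (e : ExtOne R Q K) :
    ∃ (H : Type) (_ : AddCommGroup H) (_ : Module R H) (i : K →ₗ[R] H) (π : H →ₗ[R] Q)
      (h : IsExtension i π), h.extClass = e := by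
  let q : (Q →₀ R) →ₗ[R] Q := Finsupp.linearCombination R id
  have hq : Function.Surjective q := Finsupp.linearCombination_id_surjective R Q
  have hS := IsExtension.of_surjective hq
  obtain ⟨a, ha⟩ := hS.exists_map_extClass e
  -- the extension is the pushout of the free presentation along `a`
  let D : Submodule R (K × (Q →₀ R)) := LinearMap.range (a.prod (-(LinearMap.ker q).subtype))
  let i : K →ₗ[R] (K × (Q →₀ R)) ⧸ D := D.mkQ ∘ₗ LinearMap.inl R K _
  let π : ((K × (Q →₀ R)) ⧸ D) →ₗ[R] Q := D.liftQ (q ∘ₗ LinearMap.snd R K _) (by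
    rintro _ ⟨n, rfl⟩
    simp)
  have hi : ∀ k, i k = D.mkQ (k, 0) := fun k => rfl
  have hπ : ∀ k l, π (D.mkQ (k, l)) = q l := fun k l => rfl
  have hE : IsExtension i π := by
    refine ⟨?_, ?_, ?_⟩
    · rw [injective_iff_map_eq_zero]
      intro k hk
      rw [hi, Submodule.mkQ_apply, Submodule.Quotient.mk_eq_zero] at hk
      obtain ⟨n, hn⟩ := hk
      have h2 := congrArg Prod.snd hn
      have h1 := congrArg Prod.fst hn
      have h3 : n = 0 := Subtype.ext (neg_eq_zero.1 h2)
      rw [h3, map_zero] at h1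
      exact h1.symm
    · intro y
      obtain ⟨⟨k, l⟩, rfl⟩ := D.mkQ_surjective y
      rw [hπ]
      constructor
      · intro hl
        refine ⟨k + a ⟨l, hl⟩, ?_⟩
        rw [hi, ← sub_eq_zero, ← map_sub, Submodule.mkQ_apply, Submodule.Quotient.mk_eq_zero]
        exact ⟨⟨l, hl⟩, by simp⟩
      · rintro ⟨k', hk'⟩
        have := congrArg π hk'
        rw [hi, hπ, hπ, map_zero] at this
        exact this.symm
    · intro x
      obtain ⟨l, rfl⟩ := hq x
      exact ⟨D.mkQ (0, l), rfl⟩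
  refine ⟨_, _, _, i, π, hE, ?_⟩
  rw [← ha]
  refine (hS.extClass_map_eq a hE (D.mkQ ∘ₗ LinearMap.inr R K _) ?_ ?_).symm
  · ext n
    change D.mkQ (0, (n : Q →₀ R)) = D.mkQ (a n, 0)
    rw [← sub_eq_zero, ← map_sub, Submodule.mkQ_apply, Submodule.Quotient.mk_eq_zero]
    exact ⟨-n, Prod.ext (by simp [map_neg a]) (by simp)⟩
  · rfl

/-- The connecting homomorphism `Hom(P, Q) → Ext¹(P, K)` of an extension of `Q` by `K`. -/
noncomputable def IsExtension.pullback {P : Type} [AddCommGroup P] [Module R P] {i : K →ₗ[R] H}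
    {π : H →ₗ[R] Q} (h : IsExtension i π) : (P →ₗ[R] Q) →+ ExtOne R P K where
  toFun f := (Abelian.Ext.mk₀ (ModuleCat.ofHom f)).comp h.extClass (zero_add 1)
  map_zero' := by rw [ModuleCat.ofHom_zero, Abelian.Ext.mk₀_zero, Abelian.Ext.zero_comp]
  map_add' f g := by rw [ModuleCat.ofHom_add, Abelian.Ext.mk₀_add, Abelian.Ext.add_comp]

/-- The connecting homomorphism `Hom(K, F) → Ext¹(Q, F)` of an extension of `Q` by `K`. -/
noncomputable def IsExtension.pushout {i : K →ₗ[R] H} {π : H →ₗ[R] Q} (h : IsExtension i π) :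
    (K →ₗ[R] F) →+ ExtOne R Q F where
  toFun f := h.extClass.comp (Abelian.Ext.mk₀ (ModuleCat.ofHom f)) (add_zero 1)
  map_zero' := by rw [ModuleCat.ofHom_zero, Abelian.Ext.mk₀_zero, Abelian.Ext.comp_zero]
  map_add' f g := by rw [ModuleCat.ofHom_add, Abelian.Ext.mk₀_add, Abelian.Ext.comp_add]

/-- The long exact sequence at `Hom(P, Q)`: a map lifts to the middle term of an extension exactly if
it pulls its class back to zero. -/
theorem IsExtension.exists_lift_iff {P : Type} [AddCommGroup P] [Module R P] {i : K →ₗ[R] H}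
    {π : H →ₗ[R] Q} (h : IsExtension i π) (f : P →ₗ[R] Q) :
    (∃ g : P →ₗ[R] H, π ∘ₗ g = f) ↔ h.pullback f = 0 := by
  constructor
  · rintro ⟨g, rfl⟩
    change (Abelian.Ext.mk₀ (ModuleCat.ofHom (π ∘ₗ g))).comp h.extClass (zero_add 1) = 0
    have hz : (Abelian.Ext.mk₀ (ModuleCat.ofHom π)).comp h.extClass (zero_add 1) = 0 :=
      h.shortExact.comp_extClass
    rw [ModuleCat.ofHom_comp, ← Abelian.Ext.mk₀_comp_mk₀,
      Abelian.Ext.comp_assoc_of_second_deg_zero, hz, Abelian.Ext.comp_zero]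
  · intro he
    obtain ⟨y, hy⟩ := Abelian.Ext.covariant_sequence_exact₃ (ModuleCat.of R P) h.shortExact
      (Abelian.Ext.mk₀ (ModuleCat.ofHom f)) (zero_add 1) he
    obtain ⟨k, rfl⟩ := (Abelian.Ext.mk₀_bijective _ _).2 y
    rw [Abelian.Ext.mk₀_comp_mk₀] at hy
    have := congrArg ModuleCat.Hom.hom ((Abelian.Ext.mk₀_bijective _ _).1 hy)
    exact ⟨k.hom, by simpa using this⟩

/-- The long exact sequence at `Ext¹(P, K)`. -/
theorem IsExtension.exists_pullback_iff {P : Type} [AddCommGroup P] [Module R P] {i : K →ₗ[R] H}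
    {π : H →ₗ[R] Q} (h : IsExtension i π) (e : ExtOne R P K) :
    (∃ f : P →ₗ[R] Q, h.pullback f = e) ↔ ExtOne.map P i e = 0 := by
  constructor
  · rintro ⟨f, rfl⟩
    change ((Abelian.Ext.mk₀ (ModuleCat.ofHom f)).comp h.extClass (zero_add 1)).comp
      (Abelian.Ext.mk₀ (ModuleCat.ofHom i)) (add_zero 1) = 0
    have hz : h.extClass.comp (Abelian.Ext.mk₀ (ModuleCat.ofHom i)) (add_zero 1) = 0 :=
      h.shortExact.extClass_comp
    rw [Abelian.Ext.comp_assoc_of_third_deg_zero, hz, Abelian.Ext.comp_zero]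
  · intro he
    obtain ⟨y, hy⟩ := Abelian.Ext.covariant_sequence_exact₁ (ModuleCat.of R P) h.shortExact e
      he (zero_add 1)
    obtain ⟨k, rfl⟩ := (Abelian.Ext.mk₀_bijective _ _).2 y
    exact ⟨k.hom, hy⟩

theorem card_eq_card_ker_mul_card_range {A B : Type*} [AddGroup A] [AddGroup B] (f : A →+ B) :
    Nat.card A = Nat.card f.ker * Nat.card f.range := by
  rw [← f.ker.card_mul_index, AddSubgroup.index_ker]

variable (R) in
theorem finite_linearMap (A B : Type) [AddCommGroup A] [Module R A] [Module.Finite R A]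
    [AddCommGroup B] [Module R B] [Finite B] : Finite (A →ₗ[R] B) := by
  obtain ⟨n, q, hq⟩ := Module.Finite.exists_fin' R A
  have h1 : Finite ((Fin n → R) →ₗ[R] B) :=
    Finite.of_equiv _ ((Module.piEquiv (Fin n) R B).toEquiv)
  exact Finite.of_injective (fun f : A →ₗ[R] B => f ∘ₗ q) fun f g h => by
    ext x
    obtain ⟨y, rfl⟩ := hq x
    exact LinearMap.congr_fun h y

/-- The kernel of `Ext¹(Q, C) → Ext¹(Q, F)` for a submodule `C` of `F`, by the long exact
sequence. -/
theorem ExtOne.card_ker_map_subtype [Finite F] (C : Submodule R F) :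
    Nat.card (Q →ₗ[R] F) * Nat.card (ExtOne.map Q C.subtype).ker =
      Nat.card (Q →ₗ[R] F ⧸ C) * Nat.card (Q →ₗ[R] C) := by
  have hE : IsExtension C.subtype C.mkQ :=
    ⟨Subtype.val_injective, LinearMap.exact_subtype_mkQ C, C.mkQ_surjective⟩
  let δ : (Q →ₗ[R] F ⧸ C) →+ ExtOne R Q C := hE.pullback
  let r : (Q →ₗ[R] F) →+ (Q →ₗ[R] F ⧸ C) :=
    { toFun := fun f => C.mkQ ∘ₗ f
      map_zero' := LinearMap.comp_zero _
      map_add' := fun _ _ => LinearMap.comp_add _ _ _ }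
  have h1 : δ.range = (ExtOne.map Q C.subtype).ker := by
    ext e
    exact hE.exists_pullback_iff e
  have h2 : r.range = δ.ker := by
    ext f
    exact hE.exists_lift_iff f
  have h3 : Nat.card r.ker = Nat.card (Q →ₗ[R] C) := by
    refine (Nat.card_congr (Equiv.ofBijective
      (fun g : Q →ₗ[R] C => (⟨C.subtype ∘ₗ g, ?_⟩ : r.ker)) ⟨fun g g' h => ?_, fun f => ?_⟩)).symm
    · change C.mkQ ∘ₗ (C.subtype ∘ₗ g) = 0
      rw [← LinearMap.comp_assoc, hE.comp_eq_zero, LinearMap.zero_comp]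
    · exact LinearMap.cancel_left C.injective_subtype |>.1 (congrArg Subtype.val h)
    · have hf : ∀ x, f.1 x ∈ C := fun x => by
        have := LinearMap.congr_fun (show C.mkQ ∘ₗ f.1 = 0 from f.2) x
        simpa using this
      exact ⟨f.1.codRestrict C hf, Subtype.ext rfl⟩
  have e1 := card_eq_card_ker_mul_card_range δ
  have e2 := card_eq_card_ker_mul_card_range r
  rw [h1, ← h2] at e1
  rw [h3] at e2
  rw [e1, e2]
  ring

/-- `Ext¹(Q, R)` is finite if `Q` is killed by some `m` with finite `R / m`: multiplication by `m`
vanishes on it, so it is a quotient of `Hom(Q, R / m)`. -/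
theorem ExtOne.finite_self [IsDomain R] [Module.Finite R Q] {m : R} (hm : m ≠ 0) (hQ : ∀ x : Q, m • x = 0)
    (hR : Finite (R ⧸ Ideal.span {m})) : Finite (ExtOne R Q R) := by
  have hE : IsExtension (LinearMap.lsmul R R m) (Ideal.span {m}).mkQ := by
    refine ⟨fun x y h => mul_left_cancel₀ hm h, ?_, Submodule.mkQ_surjective _⟩
    intro x
    rw [Submodule.mkQ_apply, Submodule.Quotient.mk_eq_zero, Ideal.mem_span_singleton']
    exact ⟨fun ⟨a, ha⟩ => ⟨a, by simpa [mul_comm] using ha⟩,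
      fun ⟨a, ha⟩ => ⟨a, by simpa [mul_comm] using ha⟩⟩
  have hz : ∀ e : ExtOne R Q R, ExtOne.map Q (LinearMap.lsmul R R m) e = 0 := by
    intro e
    obtain ⟨H, _, _, i, π, h, rfl⟩ := exists_extension e
    -- `m` maps the middle term `H` into the image of `R`, which extends multiplication by `m`
    rw [← h.exists_extend_iff]
    have hmem : ∀ x : H, (LinearMap.lsmul R H m) x ∈ LinearMap.range i := by
      intro x
      rw [← h.ker_eq_range, LinearMap.mem_ker]
      simp [hQ]
    refine ⟨(LinearEquiv.ofInjective i h.inj).symm.toLinearMap ∘ₗ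
      (LinearMap.lsmul R H m).codRestrict _ hmem, ?_⟩
    refine LinearMap.ext fun x => ?_
    apply (LinearEquiv.ofInjective i h.inj).injective
    apply Subtype.ext
    simp [← map_smul]
  have := finite_linearMap R Q (R ⧸ Ideal.span {m})
  refine Finite.of_surjective (fun f : Q →ₗ[R] R ⧸ Ideal.span {m} =>
    (Abelian.Ext.mk₀ (ModuleCat.ofHom f)).comp hE.extClass (zero_add 1)) fun e => ?_
  obtain ⟨y, hy⟩ := Abelian.Ext.covariant_sequence_exact₁ (ModuleCat.of R Q) hE.shortExact e
    (hz e) (zero_add 1)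
  obtain ⟨k, rfl⟩ := (Abelian.Ext.mk₀_bijective _ _).2 y
  exact ⟨k.hom, hy⟩

section PrincipalIdealDomain

variable [IsDomain R] [IsPrincipalIdealRing R] [Module.Finite R Q]

/-- Over a principal ideal domain `Ext²` vanishes, so `Ext¹(Q, -)` preserves surjections. -/
theorem ExtOne.map_surjective {x : K →ₗ[R] F} (hx : Function.Surjective x) :
    Function.Surjective (ExtOne.map Q x) := by
  have hS := IsExtension.of_surjective hx
  obtain ⟨n, q, hq⟩ := Module.Finite.exists_fin' R Q
  have hP := IsExtension.of_surjective hq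
  have : Projective (ModuleCat.of R (Fin n → R)) := projective_of_free _
  have : Projective (ModuleCat.of R (LinearMap.ker q)) := projective_of_free _
  intro e
  refine Abelian.Ext.covariant_sequence_exact₃ (ModuleCat.of R Q) hS.shortExact e
    (one_add_one_eq_two) ?_
  obtain ⟨y, hy⟩ := Abelian.Ext.contravariant_sequence_exact₃ hP.shortExact _
    (e.comp hS.shortExact.extClass one_add_one_eq_two)
    (Abelian.Ext.eq_zero_of_projective (P := ModuleCat.of R (Fin n → R)) _) one_add_one_eq_two
  rw [← hy, Abelian.Ext.eq_zero_of_projective (P := ModuleCat.of R (LinearMap.ker q)) y,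
    Abelian.Ext.comp_zero]

/-- For a torsion module `Q`, in particular for a finite one, the groups `Hom(Q, C)` and
`Ext¹(Q, C)` have the same size: `Q` has a presentation with as many relations as generators. -/
theorem ExtOne.card_eq [Finite C] (hQ : Module.finrank R Q = 0) :
    Finite (ExtOne R Q C) ∧ Nat.card (ExtOne R Q C) = Nat.card (Q →ₗ[R] C) := by
  obtain ⟨n, q, hq⟩ := Module.Finite.exists_fin' R Q
  have hP := IsExtension.of_surjective hq
  let N := LinearMap.ker q
  have hN : Module.finrank R N = n := by
    have h1 := N.finrank_quotient_add_finrank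
    have h2 := (q.quotKerEquivOfSurjective hq).finrank_eq
    rw [Module.finrank_fin_fun] at h1
    change Module.finrank R (_ ⧸ N) = _ at h2
    omega
  have := finite_linearMap R (Fin n → R) C
  have := finite_linearMap R N C
  have := finite_linearMap R Q C
  have hcard : Nat.card (N →ₗ[R] C) = Nat.card ((Fin n → R) →ₗ[R] C) := by
    have e : N ≃ₗ[R] (Fin n → R) :=
      LinearEquiv.ofFinrankEq _ _ (by rw [hN, Module.finrank_fin_fun])
    exact Nat.card_congr (LinearEquiv.congrLeft C R e).toEquiv
  let δ : (N →ₗ[R] C) →+ ExtOne R Q C := hP.pushout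
  have hδ : Function.Surjective δ := fun e => hP.exists_map_extClass e
  let r : ((Fin n → R) →ₗ[R] C) →+ (N →ₗ[R] C) :=
    { toFun := fun f => f ∘ₗ N.subtype
      map_zero' := rfl
      map_add' := fun _ _ => rfl }
  have hr : r.range = δ.ker := by
    ext a
    exact hP.exists_extend_iff a
  have hk : Nat.card r.ker = Nat.card (Q →ₗ[R] C) := by
    refine (Nat.card_congr (Equiv.ofBijective
      (fun g : Q →ₗ[R] C => (⟨g ∘ₗ q, ?_⟩ : r.ker)) ⟨fun g g' h => ?_, fun f => ?_⟩)).symm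
    · change (g ∘ₗ q) ∘ₗ N.subtype = 0
      rw [LinearMap.comp_assoc, hP.comp_eq_zero, LinearMap.comp_zero]
    · exact LinearMap.cancel_right hq |>.1 (congrArg Subtype.val h)
    · obtain ⟨g, hg⟩ := hP.exists_descend f.1 f.2
      exact ⟨g, Subtype.ext hg⟩
  have h1 := card_eq_card_ker_mul_card_range δ
  have h2 := card_eq_card_ker_mul_card_range r
  rw [AddMonoidHom.range_eq_top.2 hδ, AddSubgroup.card_top, ← hr, hcard] at h1
  rw [hk] at h2
  refine ⟨Finite.of_surjective δ hδ, ?_⟩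
  have hpos : 0 < Nat.card r.range := Nat.card_pos
  exact Nat.eq_of_mul_eq_mul_left hpos (h1.symm.trans (h2.trans (mul_comm _ _)))

/-- For a fixed element `x` of a finite module `F`, the number of classes in `Ext¹(Q, R)` that are
killed by `R → F, 1 ↦ x`. -/
theorem ExtOne.card_ker_map_toSpanSingleton [Finite F] (hQ : Module.finrank R Q = 0) (x : F) :
    Nat.card (Q →ₗ[R] F) * Nat.card (ExtOne.map Q (LinearMap.toSpanSingleton R F x)).ker =
      Nat.card (Q →ₗ[R] F ⧸ Submodule.span R {x}) * Nat.card (ExtOne R Q R) := by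
  let C := Submodule.span R {x}
  have hx : ∀ a : R, LinearMap.toSpanSingleton R F x a ∈ C := fun a =>
    Submodule.smul_mem _ _ (Submodule.mem_span_singleton_self x)
  let y : R →ₗ[R] C := (LinearMap.toSpanSingleton R F x).codRestrict C hx
  have hy : Function.Surjective y := by
    rintro ⟨z, hz⟩
    obtain ⟨a, rfl⟩ := Submodule.mem_span_singleton.1 hz
    exact ⟨a, Subtype.ext rfl⟩
  have hsurj := ExtOne.map_surjective (Q := Q) hy
  obtain ⟨hC, hcard⟩ := ExtOne.card_eq (C := C) hQ
  have hcomp : ∀ e, ExtOne.map Q (LinearMap.toSpanSingleton R F x) e =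
      ExtOne.map Q C.subtype (ExtOne.map Q y e) := by
    intro e
    change _ = (e.comp (Abelian.Ext.mk₀ (ModuleCat.ofHom y)) (add_zero 1)).comp
      (Abelian.Ext.mk₀ (ModuleCat.ofHom C.subtype)) (add_zero 1)
    rw [Abelian.Ext.comp_assoc_of_third_deg_zero, Abelian.Ext.mk₀_comp_mk₀, ← ModuleCat.ofHom_comp]
    rfl
  -- the kernel of the composite is an extension of the kernel of the second map by that of the first
  have h1 : Nat.card (ExtOne.map Q (LinearMap.toSpanSingleton R F x)).ker =
      Nat.card (ExtOne.map Q y).ker * Nat.card (ExtOne.map Q C.subtype).ker := by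
    let r : (ExtOne.map Q (LinearMap.toSpanSingleton R F x)).ker →+ (ExtOne.map Q C.subtype).ker :=
      ((ExtOne.map Q y).comp (AddSubgroup.subtype _)).codRestrict _ fun e => by
        have := e.2
        rw [AddMonoidHom.mem_ker, hcomp] at this
        exact this
    have hr : Function.Surjective r := by
      rintro ⟨z, hz⟩
      obtain ⟨e, rfl⟩ := hsurj z
      exact ⟨⟨e, (hcomp e).trans hz⟩, rfl⟩
    have hk : Nat.card r.ker = Nat.card (ExtOne.map Q y).ker :=
      Nat.card_congr
        { toFun := fun e => ⟨e.1.1, congrArg Subtype.val e.2⟩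
          invFun := fun e => ⟨⟨e.1, by
            have h0 : ExtOne.map Q y e.1 = 0 := e.2
            rw [AddMonoidHom.mem_ker, hcomp, h0, map_zero]⟩, Subtype.ext e.2⟩
          left_inv := fun _ => rfl
          right_inv := fun _ => rfl }
    rw [card_eq_card_ker_mul_card_range r, AddMonoidHom.range_eq_top.2 hr, AddSubgroup.card_top, hk]
  have h2 := card_eq_card_ker_mul_card_range (ExtOne.map Q y)
  rw [AddMonoidHom.range_eq_top.2 hsurj, AddSubgroup.card_top, hcard] at h2
  have h3 := ExtOne.card_ker_map_subtype (Q := Q) C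
  rw [h1, h2]
  calc _ = Nat.card (ExtOne.map Q y).ker *
        (Nat.card (Q →ₗ[R] F) * Nat.card (ExtOne.map Q C.subtype).ker) := by ring
    _ = _ := by rw [h3]; ring

end PrincipalIdealDomain

end Extensions

/-! ### Isomorphism classes of finite modules -/

section IsoClass

variable {p : ℕ} [Fact p.Prime]

variable (p) in
/-- The isomorphism class of a finite `ℤ_[p]`-module. -/
def isoClass (M : Type) [AddCommGroup M] [Module ℤ_[p] M] [Finite M] : X0 p :=
  Quotient.mk (FinMod.setoid p) { carrier := M }

variable {M N M' N' : Type} [AddCommGroup M] [Module ℤ_[p] M] [Finite M]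
  [AddCommGroup N] [Module ℤ_[p] N] [Finite N] [AddCommGroup M'] [Module ℤ_[p] M'] [Finite M']
  [AddCommGroup N'] [Module ℤ_[p] N'] [Finite N']

theorem isoClass_eq_iff : isoClass p M = isoClass p N ↔ Nonempty (M ≃ₗ[ℤ_[p]] N) :=
  Quotient.eq (r := FinMod.setoid p)

@[simp]
theorem isoClass_grp (G : X0 p) : isoClass p G.grp = G := Quotient.out_eq G

theorem nonempty_isoClass_grp_equiv (M : Type) [AddCommGroup M] [Module ℤ_[p] M] [Finite M] :
    Nonempty ((isoClass p M).grp ≃ₗ[ℤ_[p]] M) :=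
  isoClass_eq_iff.1 (isoClass_grp _)

variable (p) in
/-- The number of surjective linear maps. -/
noncomputable def numSur (M N : Type) [AddCommGroup M] [Module ℤ_[p] M]
    [AddCommGroup N] [Module ℤ_[p] N] : ℕ :=
  Nat.card {f : M →ₗ[ℤ_[p]] N // Function.Surjective f}

theorem numSur_congr {M N M' N' : Type} [AddCommGroup M] [Module ℤ_[p] M]
    [AddCommGroup N] [Module ℤ_[p] N] [AddCommGroup M'] [Module ℤ_[p] M']
    [AddCommGroup N'] [Module ℤ_[p] N'] (e : M ≃ₗ[ℤ_[p]] M') (e' : N ≃ₗ[ℤ_[p]] N') :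
    numSur p M N = numSur p M' N' :=
  Nat.card_congr ((LinearEquiv.arrowCongr e e').toEquiv.subtypeEquiv fun f => by
    change _ ↔ Function.Surjective (e' ∘ f ∘ e.symm)
    exact ((e'.toEquiv.comp_surjective _).trans (e.symm.toEquiv.surjective_comp f)).symm)

theorem cardSur_eq (F G : X0 p) : cardSur F G = numSur p F.grp G.grp := rfl

theorem cardSur_isoClass (M N : Type) [AddCommGroup M] [Module ℤ_[p] M] [Finite M]
    [AddCommGroup N] [Module ℤ_[p] N] [Finite N] :
    cardSur (isoClass p M) (isoClass p N) = numSur p M N := by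
  obtain ⟨e⟩ := nonempty_isoClass_grp_equiv (p := p) M
  obtain ⟨e'⟩ := nonempty_isoClass_grp_equiv (p := p) N
  exact numSur_congr e e'

theorem card_homs_congr {M N M' N' : Type} [AddCommGroup M] [Module ℤ_[p] M]
    [AddCommGroup N] [Module ℤ_[p] N] [AddCommGroup M'] [Module ℤ_[p] M']
    [AddCommGroup N'] [Module ℤ_[p] N'] (e : M ≃ₗ[ℤ_[p]] M') (e' : N ≃ₗ[ℤ_[p]] N') :
    Nat.card (M →ₗ[ℤ_[p]] N) = Nat.card (M' →ₗ[ℤ_[p]] N') :=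
  Nat.card_congr (LinearEquiv.arrowCongr e e').toEquiv

theorem card_equiv_congr {M M' N N' : Type} [AddCommGroup M] [Module ℤ_[p] M]
    [AddCommGroup N] [Module ℤ_[p] N] [AddCommGroup M'] [Module ℤ_[p] M']
    [AddCommGroup N'] [Module ℤ_[p] N'] (e : M ≃ₗ[ℤ_[p]] M') (e' : N ≃ₗ[ℤ_[p]] N') :
    Nat.card (M ≃ₗ[ℤ_[p]] N) = Nat.card (M' ≃ₗ[ℤ_[p]] N') :=
  Nat.card_congr
    { toFun := fun f => e.symm.trans (f.trans e')
      invFun := fun f => e.trans (f.trans e'.symm)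
      left_inv := fun f => by ext; simp
      right_inv := fun f => by ext; simp }

theorem cardAut_isoClass (M : Type) [AddCommGroup M] [Module ℤ_[p] M] [Finite M] :
    cardAut (isoClass p M) = Nat.card (M ≃ₗ[ℤ_[p]] M) := by
  obtain ⟨e⟩ := nonempty_isoClass_grp_equiv (p := p) M
  exact card_equiv_congr e e

instance finite_linearMap_of_finite (M N : Type) [AddCommGroup M] [Module ℤ_[p] M] [Finite M]
    [AddCommGroup N] [Module ℤ_[p] N] [Finite N] : Finite (M →ₗ[ℤ_[p]] N) :=
  Finite.of_injective _ DFunLike.coe_injective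

instance finite_linearEquiv_of_finite (M N : Type) [AddCommGroup M] [Module ℤ_[p] M] [Finite M]
    [AddCommGroup N] [Module ℤ_[p] N] : Finite (M ≃ₗ[ℤ_[p]] N) := by
  by_cases h : Nonempty (M ≃ₗ[ℤ_[p]] N)
  · obtain ⟨e⟩ := h
    have : Finite N := Finite.of_equiv _ e.toEquiv
    exact Finite.of_injective (fun e => (e : M → N)) DFunLike.coe_injective
  · have : IsEmpty (M ≃ₗ[ℤ_[p]] N) := not_nonempty_iff.1 h
    infer_instance

instance finite_quotient (N : Submodule ℤ_[p] M) : Finite (M ⧸ N) :=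
  Finite.of_surjective _ N.mkQ_surjective

instance finite_submodule : Finite (Submodule ℤ_[p] M) :=
  Finite.of_injective (fun N => (N : Set M)) SetLike.coe_injective

theorem natCard_smul_eq_zero {M : Type} [AddCommGroup M] [Module ℤ_[p] M] (x : M) : (Nat.card M : ℤ_[p]) • x = 0 := by
  rw [Nat.cast_smul_eq_nsmul]
  exact card_nsmul_eq_zero'

theorem finrank_eq_zero_of_finite (M : Type) [AddCommGroup M] [Module ℤ_[p] M] [Finite M] :
    Module.finrank ℤ_[p] M = 0 := by
  rw [Module.finrank_eq_zero_iff]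
  intro x
  exact ⟨(Nat.card M : ℤ_[p]), Nat.cast_ne_zero.2 Nat.card_pos.ne', natCard_smul_eq_zero x⟩

/-- The ideal of `ℤ_[p]` generated by `p ^ n`. -/
noncomputable abbrev powIdeal (p : ℕ) [Fact p.Prime] (n : ℕ) : Ideal ℤ_[p] := Ideal.span {(p : ℤ_[p]) ^ n}

/-- `ℤ_[p] / p ^ n` is `ZMod (p ^ n)`. -/
noncomputable def powIdealQuotEquiv (n : ℕ) : (ℤ_[p] ⧸ powIdeal p n) ≃+* ZMod (p ^ n) :=
  (Ideal.quotEquivOfEq (PadicInt.ker_toZModPow n).symm).trans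
    (RingHom.quotientKerEquivOfSurjective (ZMod.ringHom_surjective (PadicInt.toZModPow n)))

theorem card_quot_powIdeal (n : ℕ) : Nat.card (ℤ_[p] ⧸ powIdeal p n) = p ^ n := by
  rw [Nat.card_congr (powIdealQuotEquiv n).toEquiv, Nat.card_zmod]

instance finite_quot_powIdeal (n : ℕ) : Finite (ℤ_[p] ⧸ powIdeal p n) :=
  Nat.finite_of_card_ne_zero (by
    rw [card_quot_powIdeal]
    exact pow_ne_zero _ (Fact.out : p.Prime).ne_zero)

/-- The submodule generated by an element of a finite module is `ℤ_[p] / p ^ n` for some `n`. -/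
theorem exists_ker_toSpanSingleton_eq (x : M) :
    ∃ n, LinearMap.ker (LinearMap.toSpanSingleton ℤ_[p] M x) = powIdeal p n := by
  refine PadicInt.ideal_eq_span_pow_p fun h => ?_
  have : (Nat.card M : ℤ_[p]) ∈ LinearMap.ker (LinearMap.toSpanSingleton ℤ_[p] M x) :=
    natCard_smul_eq_zero x
  rw [h] at this
  exact Nat.cast_ne_zero.2 Nat.card_pos.ne' this

theorem card_span_of_ker_eq {M : Type} [AddCommGroup M] [Module ℤ_[p] M] {x : M} {n : ℕ}
    (h : LinearMap.ker (LinearMap.toSpanSingleton ℤ_[p] M x) = powIdeal p n) :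
    Nat.card (Submodule.span ℤ_[p] {x}) = p ^ n := by
  rw [← LinearMap.range_toSpanSingleton, ← card_quot_powIdeal, ← h]
  exact (Nat.card_congr (LinearMap.quotKerEquivRange _).toEquiv).symm

theorem exists_card_span_eq (x : M) : ∃ n, Nat.card (Submodule.span ℤ_[p] {x}) = p ^ n :=
  (exists_ker_toSpanSingleton_eq x).imp fun _ h => card_span_of_ker_eq h

theorem ker_eq_of_card_span {x : M} {n : ℕ} (h : Nat.card (Submodule.span ℤ_[p] {x}) = p ^ n) :
    LinearMap.ker (LinearMap.toSpanSingleton ℤ_[p] M x) = powIdeal p n := by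
  obtain ⟨m, hm⟩ := exists_ker_toSpanSingleton_eq (p := p) x
  have := Nat.pow_right_injective (Fact.out : p.Prime).two_le ((card_span_of_ker_eq hm).symm.trans h)
  rw [hm, this]

/-- `Ext¹(G, ℤ_[p])` is finite for finite `G`. -/
instance finite_extOne_padicInt : Finite (ExtOne ℤ_[p] M ℤ_[p]) := by
  have h0 : (Nat.card M : ℤ_[p]) ≠ 0 := Nat.cast_ne_zero.2 Nat.card_pos.ne'
  obtain ⟨n, hn⟩ := PadicInt.ideal_eq_span_pow_p (s := Ideal.span {(Nat.card M : ℤ_[p])})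
    (by rwa [Ne, Ideal.span_singleton_eq_bot])
  refine ExtOne.finite_self (Q := M) h0 natCard_smul_eq_zero ?_
  rw [hn]
  exact finite_quot_powIdeal n

end IsoClass

/-! ### Weighted counting of extensions -/

section Counting

theorem card_eq_mul_of_card_fiber {A B : Type*} [Finite A] (f : A → B) {c : ℕ}
    (h : ∀ b, Nat.card {a // f a = b} = c) : Nat.card A = Nat.card B * c := by
  have e : ∀ b, {a // f a = b} ≃ Fin c := fun b => Finite.equivFinOfCardEq (h b)
  rw [Nat.card_congr ((Equiv.sigmaFiberEquiv f).symm.trans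
    ((Equiv.sigmaCongrRight e).trans (Equiv.sigmaEquivProd _ _))), Nat.card_prod, Nat.card_fin]

/-- Counting a finite set by the fibres of a map. -/
theorem natCard_eq_tsum_fiber {A : Type*} {X : Type*} [Finite A] (f : A → X) :
    (Nat.card A : ℝ≥0∞) = ∑' x, (Nat.card {a // f a = x} : ℝ≥0∞) := by
  classical
  have := Fintype.ofFinite A
  have h1 : ∀ x, (Nat.card {a // f a = x} : ℝ≥0∞) = ∑' a : A, if x = f a then 1 else 0 := by
    intro x
    rw [tsum_fintype, Finset.sum_boole, Nat.card_eq_fintype_card, Fintype.card_subtype]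
    simp only [eq_comm]
  simp_rw [h1]
  rw [ENNReal.tsum_comm]
  simp_rw [tsum_ite_eq]
  rw [tsum_fintype, Finset.sum_const, Finset.card_univ, Nat.card_eq_fintype_card, nsmul_eq_mul,
    mul_one]

variable {p : ℕ} [Fact p.Prime] {K Q H : Type} [AddCommGroup K] [Module ℤ_[p] K] [Finite K]
  [AddCommGroup Q] [Module ℤ_[p] Q] [Finite Q] [AddCommGroup H] [Module ℤ_[p] H] [Finite H]

instance finite_extOne : Finite (ExtOne ℤ_[p] Q K) :=
  (ExtOne.card_eq (finrank_eq_zero_of_finite Q)).1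

theorem card_extOne : Nat.card (ExtOne ℤ_[p] Q K) = Nat.card (Q →ₗ[ℤ_[p]] K) :=
  (ExtOne.card_eq (finrank_eq_zero_of_finite Q)).2

theorem IsExtension.exists_factor {R : Type} [CommRing R] {K H Q P : Type}
    [AddCommGroup K] [Module R K] [AddCommGroup H] [Module R H] [AddCommGroup Q] [Module R Q]
    [AddCommGroup P] [Module R P] {i : K →ₗ[R] H} {π : H →ₗ[R] Q}
    (h : IsExtension i π) (g : P →ₗ[R] H) (hg : π ∘ₗ g = 0) : ∃ k : P →ₗ[R] K, i ∘ₗ k = g := by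
  have hmem : ∀ x, g x ∈ LinearMap.range i := fun x => by
    rw [← h.ker_eq_range]; exact LinearMap.congr_fun hg x
  refine ⟨(LinearEquiv.ofInjective i h.inj).symm.toLinearMap ∘ₗ g.codRestrict _ hmem, ?_⟩
  refine LinearMap.ext fun x => ?_
  have := congrArg Subtype.val ((LinearEquiv.ofInjective i h.inj).apply_symm_apply ⟨g x, hmem x⟩)
  exact this

/-- The extensions of `Q` by `K` with middle term `H`. -/
abbrev Extensions (p : ℕ) [Fact p.Prime] (K H Q : Type) [AddCommGroup K] [Module ℤ_[p] K]
    [AddCommGroup H] [Module ℤ_[p] H] [AddCommGroup Q] [Module ℤ_[p] Q] : Type :=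
  {x : (K →ₗ[ℤ_[p]] H) × (H →ₗ[ℤ_[p]] Q) // IsExtension x.1 x.2}

omit [Finite K] [Finite Q] in
/-- `Aut(H)` acts transitively on the extensions in a given class with middle term `H`, with
stabilizers isomorphic to `Hom(Q, K)`. -/
theorem card_equiv_eq_card_extensions_mul (e : ExtOne ℤ_[p] Q K)
    (hne : ∃ x : Extensions p K H Q, x.2.extClass = e) :
    Nat.card (H ≃ₗ[ℤ_[p]] H) =
      Nat.card {x : Extensions p K H Q // x.2.extClass = e} * Nat.card (Q →ₗ[ℤ_[p]] K) := by
  obtain ⟨⟨⟨i, π⟩, h⟩, hx⟩ := hne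
  have hE : ∀ f : H ≃ₗ[ℤ_[p]] H,
      IsExtension (f.toLinearMap ∘ₗ i) (π ∘ₗ f.symm.toLinearMap) := fun f =>
    ⟨f.injective.comp h.inj, fun x => by
      constructor
      · intro hx
        obtain ⟨k, hk⟩ := (h.exact _).1 hx
        exact ⟨k, by simp [hk]⟩
      · rintro ⟨k, rfl⟩
        simpa using h.exact.apply_apply_eq_zero k, h.surj.comp f.symm.surjective⟩
  refine card_eq_mul_of_card_fiber
    (fun f : H ≃ₗ[ℤ_[p]] H => (⟨⟨(f.toLinearMap ∘ₗ i, π ∘ₗ f.symm.toLinearMap), hE f⟩, ?_⟩ :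
      {x : Extensions p K H Q // x.2.extClass = e})) ?_
  · refine Eq.trans ?_ hx
    refine (h.extClass_eq_of_comp_eq (hE f) f.toLinearMap rfl ?_).symm
    ext x; simp
  rintro ⟨⟨⟨i', π'⟩, h'⟩, hx'⟩
  obtain ⟨f₁, hf₁, hf₁'⟩ := h.exists_equiv_of_extClass_eq h' (hx.trans hx'.symm)
  have hmem : ∀ k : Q →ₗ[ℤ_[p]] K, (f₁.toLinearMap + i' ∘ₗ k ∘ₗ π) ∘ₗ i = i' ∧
      π' ∘ₗ (f₁.toLinearMap + i' ∘ₗ k ∘ₗ π) = π := fun k => by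
    rw [LinearMap.add_comp, LinearMap.comp_assoc, LinearMap.comp_assoc, h.comp_eq_zero,
      LinearMap.comp_add, ← LinearMap.comp_assoc (f := k ∘ₗ π), h'.comp_eq_zero]
    simp [hf₁, hf₁']
  let F : (Q →ₗ[ℤ_[p]] K) → (H ≃ₗ[ℤ_[p]] H) := fun k =>
    LinearEquiv.ofBijective _ (h.bijective_of_comp_eq h' _ (hmem k).1 (hmem k).2)
  have hF : ∀ k, (F k).toLinearMap = f₁.toLinearMap + i' ∘ₗ k ∘ₗ π := fun k => rfl
  have hiff : ∀ f : H ≃ₗ[ℤ_[p]] H, (f.toLinearMap ∘ₗ i = i' ∧ π ∘ₗ f.symm.toLinearMap = π') ↔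
      (f.toLinearMap ∘ₗ i = i' ∧ π' ∘ₗ f.toLinearMap = π) := by
    intro f
    refine and_congr_right fun _ => ⟨fun h => ?_, fun h => ?_⟩
    · rw [← h]; ext x; simp
    · rw [← h]; ext x; simp
  have hFmem := fun k => (hiff (F k)).2 (by rw [hF]; exact hmem k)
  refine (Nat.card_congr (Equiv.ofBijective
    (fun k => ⟨F k, Subtype.ext (Subtype.ext (Prod.ext (hFmem k).1 (hFmem k).2))⟩) ⟨?_, ?_⟩)).symm
  · intro k k' hk
    have h1 := congrArg (fun f => LinearEquiv.toLinearMap (Subtype.val f)) hk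
    simp only [hF] at h1
    have h2 := (LinearMap.cancel_left h'.inj).1 (add_left_cancel h1)
    exact (LinearMap.cancel_right h.surj).1 h2
  · rintro ⟨f, hf⟩
    have h1 := congrArg (fun x => Subtype.val (Subtype.val x)) hf
    obtain ⟨ha, hb⟩ := (hiff f).1 ⟨congrArg Prod.fst h1, congrArg Prod.snd h1⟩
    obtain ⟨g, hg⟩ := h.exists_descend (f.toLinearMap - f₁.toLinearMap) (by
      rw [LinearMap.sub_comp, ha, hf₁, sub_self])
    obtain ⟨k, hk⟩ := h'.exists_factor g (by
      rw [← LinearMap.cancel_right h.surj, LinearMap.comp_assoc, hg, LinearMap.comp_sub, hb, hf₁',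
        sub_self, LinearMap.zero_comp])
    refine ⟨k, Subtype.ext (LinearEquiv.toLinearMap_injective ?_)⟩
    rw [hF, ← LinearMap.comp_assoc, hk, hg]
    abel

/-- The weight `1 / #Aut(G)`, as an extended nonnegative real. -/
noncomputable def wt (G : X0 p) : ℝ≥0∞ := (cardAut G : ℝ≥0∞)⁻¹

theorem wt_ne_zero (G : X0 p) : wt G ≠ 0 := ENNReal.inv_ne_zero.2 (ENNReal.natCast_ne_top _)

theorem wt_ne_top (G : X0 p) : wt G ≠ ∞ :=
  ENNReal.inv_ne_top.2 (Nat.cast_ne_zero.2 (cardAut_pos G).ne')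

theorem wt_mul_cardAut (G : X0 p) : wt G * cardAut G = 1 :=
  ENNReal.inv_mul_cancel (Nat.cast_ne_zero.2 (cardAut_pos G).ne') (ENNReal.natCast_ne_top _)

variable (p K Q) in
/-- Extensions of `Q` by `K`, counted with weight `1 / #Aut` of the middle term, have total mass
one: every class of `Ext¹(Q, K)` contributes `1 / #Hom(Q, K)`. -/
theorem tsum_wt_mul_card_extensions :
    ∑' G : X0 p, wt G * (Nat.card (Extensions p K G.grp Q) : ℝ≥0∞) = 1 := by
  classical
  have hmid : ∀ e : ExtOne ℤ_[p] Q K, ∃ G : X0 p, ∀ G' : X0 p,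
      (∃ x : Extensions p K G'.grp Q, x.2.extClass = e) ↔ G' = G := by
    intro e
    obtain ⟨H, _, _, i, π, h, rfl⟩ := exists_extension e
    have : Finite H := by
      have : Finite (LinearMap.ker π) := by rw [h.ker_eq_range]; exact Set.finite_range i
      have : Finite (H ⧸ (LinearMap.ker π).toAddSubgroup) :=
        Finite.of_equiv _ (π.quotKerEquivOfSurjective h.surj).symm.toEquiv
      exact Finite.of_addSubgroup_quotient (LinearMap.ker π).toAddSubgroup
    refine ⟨isoClass p H, fun G' => ⟨?_, ?_⟩⟩
    · rintro ⟨x, hx⟩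
      obtain ⟨f, -⟩ := x.2.exists_equiv_of_extClass_eq h hx
      rw [← isoClass_grp G', isoClass_eq_iff]
      exact ⟨f⟩
    · rintro rfl
      obtain ⟨f⟩ := nonempty_isoClass_grp_equiv (p := p) H
      have hE : IsExtension (f.symm.toLinearMap ∘ₗ i) (π ∘ₗ f.toLinearMap) :=
        ⟨f.symm.injective.comp h.inj, fun x => by
          constructor
          · intro hx
            obtain ⟨k, hk⟩ := (h.exact _).1 hx
            exact ⟨k, by simp [hk]⟩
          · rintro ⟨k, rfl⟩
            simpa using h.exact.apply_apply_eq_zero k, h.surj.comp f.surjective⟩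
      refine ⟨⟨(f.symm.toLinearMap ∘ₗ i, π ∘ₗ f.toLinearMap), hE⟩, ?_⟩
      exact (h.extClass_eq_of_comp_eq hE f.symm.toLinearMap rfl (by ext x; simp)).symm
  choose mid hmid using hmid
  have hpos : (Nat.card (Q →ₗ[ℤ_[p]] K) : ℝ≥0∞) ≠ 0 := Nat.cast_ne_zero.2 Nat.card_pos.ne'
  have h1 : ∀ (G : X0 p) (e : ExtOne ℤ_[p] Q K),
      wt G * (Nat.card {x : Extensions p K G.grp Q // x.2.extClass = e} : ℝ≥0∞) =
        if G = mid e then (Nat.card (Q →ₗ[ℤ_[p]] K) : ℝ≥0∞)⁻¹ else 0 := by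
    intro G e
    split_ifs with hG
    · have := card_equiv_eq_card_extensions_mul e ((hmid e G).2 hG)
      have h2 : (cardAut G : ℝ≥0∞) =
          Nat.card {x : Extensions p K G.grp Q // x.2.extClass = e} *
            Nat.card (Q →ₗ[ℤ_[p]] K) := by
        rw [← Nat.cast_mul, ← this]; rfl
      refine ENNReal.eq_inv_of_mul_eq_one_left ?_
      rw [mul_assoc, ← h2, wt_mul_cardAut]
    · have : IsEmpty {x : Extensions p K G.grp Q // x.2.extClass = e} :=
        ⟨fun x => hG ((hmid e G).1 ⟨x.1, x.2⟩)⟩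
      rw [Nat.card_of_isEmpty, Nat.cast_zero, mul_zero]
  calc ∑' G : X0 p, wt G * (Nat.card (Extensions p K G.grp Q) : ℝ≥0∞)
      = ∑' (G : X0 p) (e : ExtOne ℤ_[p] Q K),
          wt G * (Nat.card {x : Extensions p K G.grp Q // x.2.extClass = e} : ℝ≥0∞) := by
        refine tsum_congr fun G => ?_
        rw [natCard_eq_tsum_fiber (fun x : Extensions p K G.grp Q => x.2.extClass),
          ENNReal.tsum_mul_left]
    _ = ∑' (e : ExtOne ℤ_[p] Q K), (Nat.card (Q →ₗ[ℤ_[p]] K) : ℝ≥0∞)⁻¹ := by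
        simp_rw [h1]
        rw [ENNReal.tsum_comm]
        simp_rw [tsum_ite_eq]
    _ = 1 := by
        have := Fintype.ofFinite (ExtOne ℤ_[p] Q K)
        rw [tsum_fintype, Finset.sum_const, Finset.card_univ, ← Nat.card_eq_fintype_card,
          card_extOne, nsmul_eq_mul, ENNReal.mul_inv_cancel hpos (ENNReal.natCast_ne_top _)]

variable (p Q) in
/-- For a random `G` weighted by `1 / #Aut(G)` and a surjection `G → Q`, the kernel is again
weighted by `1 / #Aut`. -/
theorem tsum_wt_mul_card_ker_eq (K : X0 p) :
    ∑' G : X0 p, wt G * (Nat.card {π : G.grp →ₗ[ℤ_[p]] Q //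
      Function.Surjective π ∧ isoClass p (LinearMap.ker π) = K} : ℝ≥0∞) = wt K := by
  have h : ∀ G : X0 p, Nat.card (Extensions p K.grp G.grp Q) =
      Nat.card {π : G.grp →ₗ[ℤ_[p]] Q //
        Function.Surjective π ∧ isoClass p (LinearMap.ker π) = K} * cardAut K := by
    intro G
    have hker : ∀ x : Extensions p K.grp G.grp Q, isoClass p (LinearMap.ker x.1.2) = K := by
      intro x
      refine (isoClass_eq_iff.2 ?_).trans (isoClass_grp K)
      exact ⟨((LinearEquiv.ofInjective _ x.2.inj).trans
        (LinearEquiv.ofEq _ _ x.2.ker_eq_range.symm)).symm⟩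
    refine card_eq_mul_of_card_fiber (fun x => ⟨x.1.2, x.2.surj, hker x⟩) ?_
    · rintro ⟨π, hπ, hK⟩
      have hK' := hK
      rw [← isoClass_grp K, isoClass_eq_iff] at hK'
      obtain ⟨e⟩ := hK'
      have hE : ∀ f : K.grp ≃ₗ[ℤ_[p]] LinearMap.ker π,
          IsExtension ((LinearMap.ker π).subtype ∘ₗ f.toLinearMap) π := fun f =>
        ⟨Subtype.val_injective.comp f.injective, fun x => by
          constructor
          · intro hx
            exact ⟨f.symm ⟨x, hx⟩, by simp⟩
          · rintro ⟨k, rfl⟩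
            exact (f k).2, hπ⟩
      rw [show cardAut K = Nat.card (K.grp ≃ₗ[ℤ_[p]] LinearMap.ker π) from
        card_equiv_congr (LinearEquiv.refl _ _) e.symm]
      refine (Nat.card_congr (Equiv.ofBijective
        (fun f => ⟨⟨((LinearMap.ker π).subtype ∘ₗ f.toLinearMap, π), hE f⟩, rfl⟩) ⟨?_, ?_⟩)).symm
      · intro f g hfg
        have h1 := congrArg (fun x => x.1.1.1) hfg
        exact LinearEquiv.toLinearMap_injective
          ((LinearMap.cancel_left (LinearMap.ker π).injective_subtype).1 h1)
      · rintro ⟨⟨⟨i, π'⟩, h⟩, hx⟩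
        obtain rfl : π' = π := congrArg Subtype.val hx
        have hmem : ∀ k, i k ∈ LinearMap.ker π' := fun k => h.exact.apply_apply_eq_zero k
        refine ⟨LinearEquiv.ofBijective (i.codRestrict _ hmem) ⟨?_, ?_⟩,
          Subtype.ext (Subtype.ext rfl)⟩
        · exact fun a b hab => h.inj (congrArg Subtype.val hab)
        · rintro ⟨x, hx⟩
          obtain ⟨k, hk⟩ := (h.exact x).1 hx
          exact ⟨k, Subtype.ext hk⟩
  have h2 := tsum_wt_mul_card_extensions p K.grp Q
  simp_rw [h, Nat.cast_mul, ← mul_assoc] at h2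
  rw [ENNReal.tsum_mul_right] at h2
  exact ENNReal.eq_inv_of_mul_eq_one_left h2

end Counting

/-! ### The total mass of the Cohen-Lenstra weights and the moments -/

section Mass

/-- Summing a function over a finite set by the fibres of a map. -/
theorem tsum_comp_eq_tsum_card_fiber_mul {A : Type*} {X : Type*} [Finite A] (f : A → X)
    (h : X → ℝ≥0∞) : ∑' a, h (f a) = ∑' x, (Nat.card {a // f a = x} : ℝ≥0∞) * h x := by
  classical
  have := Fintype.ofFinite A
  have h1 : ∀ x, (Nat.card {a // f a = x} : ℝ≥0∞) * h x =
      ∑' a : A, if x = f a then h x else 0 := by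
    intro x
    rw [tsum_fintype, ← Finset.sum_filter, Finset.sum_const, nsmul_eq_mul,
      Nat.card_eq_fintype_card, Fintype.card_subtype]
    simp only [eq_comm]
  simp_rw [h1]
  rw [ENNReal.tsum_comm]
  simp_rw [tsum_ite_eq]

variable {p : ℕ} [Fact p.Prime]

theorem card_eq_card_quotient_mul_card {M : Type} [AddCommGroup M] [Module ℤ_[p] M]
    (N : Submodule ℤ_[p] M) : Nat.card M = Nat.card (M ⧸ N) * Nat.card N := by
  rw [mul_comm]
  exact (N.toAddSubgroup.card_eq_card_quotient_mul_card_addSubgroup).trans (mul_comm _ _)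

/-- In a random `G` weighted by `1 / #Aut(G)`, the elements that generate a subgroup of a given
order contribute weight `1 / #Aut(Q)` to each possible quotient `Q`. -/
theorem tsum_wt_mul_card_elements (m : ℕ) (Q : X0 p) :
    ∑' G : X0 p, wt G * (Nat.card {x : G.grp // Nat.card (Submodule.span ℤ_[p] {x}) = p ^ m ∧
      isoClass p (G.grp ⧸ Submodule.span ℤ_[p] {x}) = Q} : ℝ≥0∞) = wt Q := by
  have h : ∀ G : X0 p, Nat.card (Extensions p (ℤ_[p] ⧸ powIdeal p m) G.grp Q.grp) =
      Nat.card {x : G.grp // Nat.card (Submodule.span ℤ_[p] {x}) = p ^ m ∧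
        isoClass p (G.grp ⧸ Submodule.span ℤ_[p] {x}) = Q} * cardAut Q := by
    intro G
    have hspan : ∀ i : (ℤ_[p] ⧸ powIdeal p m) →ₗ[ℤ_[p]] G.grp,
        LinearMap.range i = Submodule.span ℤ_[p] {i ((powIdeal p m).mkQ 1)} := by
      intro i
      apply le_antisymm
      · rintro _ ⟨a, rfl⟩
        obtain ⟨a, rfl⟩ := (powIdeal p m).mkQ_surjective a
        rw [Submodule.mem_span_singleton]
        exact ⟨a, by rw [← map_smul, ← map_smul, smul_eq_mul, mul_one]⟩
      · rw [Submodule.span_singleton_le_iff_mem]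
        exact ⟨_, rfl⟩
    have hx : ∀ x : Extensions p (ℤ_[p] ⧸ powIdeal p m) G.grp Q.grp,
        Nat.card (Submodule.span ℤ_[p] {x.1.1 ((powIdeal p m).mkQ 1)}) = p ^ m ∧
          isoClass p (G.grp ⧸ Submodule.span ℤ_[p] {x.1.1 ((powIdeal p m).mkQ 1)}) = Q := by
      intro x
      constructor
      · rw [← hspan, ← card_quot_powIdeal]
        exact (Nat.card_congr (LinearEquiv.ofInjective _ x.2.inj).toEquiv).symm
      · refine (isoClass_eq_iff.2 ?_).trans (isoClass_grp Q)
        exact ⟨(Submodule.quotEquivOfEq _ _ (by rw [← hspan, x.2.ker_eq_range])).trans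
          (x.1.2.quotKerEquivOfSurjective x.2.surj)⟩
    refine card_eq_mul_of_card_fiber (fun x => ⟨x.1.1 ((powIdeal p m).mkQ 1), hx x⟩) ?_
    rintro ⟨y, hy, hQ⟩
    rw [← isoClass_grp Q, isoClass_eq_iff] at hQ
    obtain ⟨e⟩ := hQ
    have hk := ker_eq_of_card_span hy
    let i : (ℤ_[p] ⧸ powIdeal p m) →ₗ[ℤ_[p]] G.grp :=
      (powIdeal p m).liftQ (LinearMap.toSpanSingleton ℤ_[p] _ y) hk.ge
    have hi1 : i ((powIdeal p m).mkQ 1) = y := one_smul _ y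
    have hiinj : Function.Injective i := by
      rw [← LinearMap.ker_eq_bot]
      exact Submodule.ker_liftQ_eq_bot _ _ _ hk.le
    have hir : LinearMap.range i = Submodule.span ℤ_[p] {y} := by rw [hspan, hi1]
    have hE : ∀ f : (G.grp ⧸ Submodule.span ℤ_[p] {y}) ≃ₗ[ℤ_[p]] Q.grp,
        IsExtension i (f.toLinearMap ∘ₗ (Submodule.span ℤ_[p] {y}).mkQ) := fun f =>
      ⟨hiinj, fun x => by
        change _ ↔ x ∈ LinearMap.range i
        rw [hir]
        simp, f.surjective.comp (Submodule.mkQ_surjective _)⟩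
    rw [show cardAut Q = Nat.card ((G.grp ⧸ Submodule.span ℤ_[p] {y}) ≃ₗ[ℤ_[p]] Q.grp) from
      card_equiv_congr e.symm (LinearEquiv.refl _ _)]
    refine (Nat.card_congr (Equiv.ofBijective
      (fun f => ⟨⟨(i, f.toLinearMap ∘ₗ (Submodule.span ℤ_[p] {y}).mkQ), hE f⟩,
        Subtype.ext hi1⟩) ⟨?_, ?_⟩)).symm
    · intro f g hfg
      have h1 := congrArg (fun x => x.1.1.2) hfg
      exact LinearEquiv.toLinearMap_injective
        ((LinearMap.cancel_right (Submodule.mkQ_surjective _)).1 h1)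
    · rintro ⟨⟨⟨i', π⟩, h⟩, hx⟩
      have hi' : i' ((powIdeal p m).mkQ 1) = y := congrArg Subtype.val hx
      obtain rfl : i = i' := by
        refine LinearMap.ext fun a => ?_
        obtain ⟨a, rfl⟩ := (powIdeal p m).mkQ_surjective a
        have : (powIdeal p m).mkQ a = a • (powIdeal p m).mkQ 1 := by
          rw [← map_smul, smul_eq_mul, mul_one]
        rw [this, map_smul, map_smul, hi1, hi']
      refine ⟨(Submodule.quotEquivOfEq _ _ (by rw [← hir, h.ker_eq_range])).trans
          (π.quotKerEquivOfSurjective h.surj), Subtype.ext (Subtype.ext (Prod.ext rfl ?_))⟩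
      refine LinearMap.ext fun x => ?_
      rfl
  have h2 := tsum_wt_mul_card_extensions p (ℤ_[p] ⧸ powIdeal p m) Q.grp
  simp_rw [h, Nat.cast_mul, ← mul_assoc] at h2
  rw [ENNReal.tsum_mul_right] at h2
  exact ENNReal.eq_inv_of_mul_eq_one_left h2

/-- The probability that `n` uniformly random elements generate `G`, computed recursively by passing
to the quotient by the first of them. -/
noncomputable def genProb : ℕ → X0 p → ℝ≥0∞
  | 0, G => if Nat.card G.grp = 1 then 1 else 0
  | n + 1, G => (Nat.card G.grp : ℝ≥0∞)⁻¹ *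
      ∑' x : G.grp, genProb n (isoClass p (G.grp ⧸ Submodule.span ℤ_[p] {x}))

theorem card_isoClass_grp (M : Type) [AddCommGroup M] [Module ℤ_[p] M] [Finite M] :
    Nat.card (isoClass p M).grp = Nat.card M := by
  obtain ⟨e⟩ := nonempty_isoClass_grp_equiv (p := p) M
  exact Nat.card_congr e.toEquiv

theorem genProb_mono_succ (n : ℕ) (G : X0 p) : genProb n G ≤ genProb (n + 1) G := by
  induction n generalizing G with
  | zero =>
    rw [genProb, genProb]
    split_ifs with h
    · have h0 : genProb 0 (isoClass p (G.grp ⧸ Submodule.span ℤ_[p] {(0 : G.grp)})) = 1 := by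
        rw [genProb, if_pos]
        rw [card_isoClass_grp]
        exact Nat.dvd_one.1 (h ▸ Dvd.intro _ (card_eq_card_quotient_mul_card _).symm)
      rw [h, Nat.cast_one, inv_one, one_mul, ← h0]
      exact ENNReal.le_tsum (f := fun x : G.grp =>
        genProb 0 (isoClass p (G.grp ⧸ Submodule.span ℤ_[p] {x}))) 0
    · exact zero_le
  | succ n ih =>
    rw [genProb, genProb]
    gcongr
    exact ih _

theorem genProb_mono (G : X0 p) : Monotone fun n => genProb n G :=
  monotone_nat_of_le_succ fun n => genProb_mono_succ n G

theorem genProb_le_one (n : ℕ) (G : X0 p) : genProb n G ≤ 1 := by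
  induction n generalizing G with
  | zero => rw [genProb]; split_ifs <;> simp
  | succ n ih =>
    rw [genProb]
    have := Fintype.ofFinite G.grp
    calc _ ≤ (Nat.card G.grp : ℝ≥0∞)⁻¹ * ∑' _ : G.grp, 1 := by gcongr; exact ih _
      _ = 1 := by
        rw [tsum_fintype, Finset.sum_const, Finset.card_univ, nsmul_one, Nat.card_eq_fintype_card,
          ENNReal.inv_mul_cancel]
        · exact Nat.cast_ne_zero.2 Fintype.card_ne_zero
        · exact ENNReal.natCast_ne_top _

theorem iSup_genProb (G : X0 p) : ⨆ n, genProb n G = 1 := by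
  induction hN : Nat.card G.grp using Nat.strong_induction_on generalizing G with
  | _ N ih =>
  have := Fintype.ofFinite G.grp
  have hle : ⨆ n, genProb n G ≤ 1 := iSup_le fun n => genProb_le_one n G
  rcases eq_or_ne N 1 with rfl | hN1
  · refine le_antisymm hle (le_trans ?_ (le_iSup _ 0))
    rw [genProb, if_pos hN]
  have htend : ∀ G : X0 p, Tendsto (fun n => genProb n G) atTop (𝓝 (⨆ n, genProb n G)) := fun G =>
    tendsto_atTop_iSup (genProb_mono G)
  have hNt : (N : ℝ≥0∞)⁻¹ ≠ ∞ :=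
    ENNReal.inv_ne_top.2 (by rw [← hN]; exact Nat.cast_ne_zero.2 Nat.card_pos.ne')
  have h1 : Tendsto (fun n => genProb (n + 1) G) atTop (𝓝 ((N : ℝ≥0∞)⁻¹ * ∑ x : G.grp,
      ⨆ n, genProb n (isoClass p (G.grp ⧸ Submodule.span ℤ_[p] {x})))) := by
    simp only [genProb, hN, tsum_fintype]
    exact ENNReal.Tendsto.const_mul (tendsto_finsetSum _ fun x _ => htend _) (Or.inr hNt)
  have h2 := tendsto_nhds_unique ((tendsto_add_atTop_iff_nat 1).2 (htend G)) h1
  have hx : ∀ x : G.grp, x ≠ 0 →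
      ⨆ n, genProb n (isoClass p (G.grp ⧸ Submodule.span ℤ_[p] {x})) = 1 := by
    intro x hx
    refine ih _ ?_ _ rfl
    rw [card_isoClass_grp, ← hN, card_eq_card_quotient_mul_card (Submodule.span ℤ_[p] {x})]
    refine lt_mul_of_one_lt_right Nat.card_pos ?_
    have : Nontrivial (Submodule.span ℤ_[p] {x}) := by
      rw [Submodule.nontrivial_iff_ne_bot, Ne, Submodule.span_singleton_eq_bot]
      exact hx
    exact Finite.one_lt_card
  have h0 : isoClass p (G.grp ⧸ Submodule.span ℤ_[p] {(0 : G.grp)}) = G := by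
    refine (isoClass_eq_iff.2 ⟨Submodule.quotEquivOfEqBot _ ?_⟩).trans (isoClass_grp G)
    simp
  classical
  rw [← Finset.add_sum_erase _ _ (Finset.mem_univ (0 : G.grp)), h0,
    Finset.sum_congr rfl fun x hx' => hx x (Finset.ne_of_mem_erase hx'), Finset.sum_const,
    Finset.card_erase_of_mem (Finset.mem_univ _), Finset.card_univ, nsmul_one,
    ← Nat.card_eq_fintype_card, hN] at h2
  have hNpos : 1 ≤ N := by rw [← hN]; exact Nat.card_pos
  set L := ⨆ n, genProb n G
  have hLt : L ≠ ∞ := (hle.trans_lt ENNReal.one_lt_top).ne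
  obtain ⟨k, rfl⟩ : ∃ k, N = k + 1 := ⟨N - 1, by omega⟩
  have h3 : ((k + 1 : ℕ) : ℝ≥0∞) * L = L + k := by
    conv_lhs => rw [h2]
    rw [← mul_assoc, ENNReal.mul_inv_cancel (by simp) (ENNReal.natCast_ne_top _), one_mul,
      Nat.add_sub_cancel]
  rw [Nat.cast_add, Nat.cast_one, add_mul, one_mul, add_comm, ENNReal.add_right_inj hLt] at h3
  have hk : (k : ℝ≥0∞) ≠ 0 := Nat.cast_ne_zero.2 (by omega)
  exact ((ENNReal.mul_eq_left hk (ENNReal.natCast_ne_top _)).1 h3)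

/-- The sum of the weights `genProb n G / (#Aut(G) #G ^ s)`. -/
noncomputable def genSum (p : ℕ) [Fact p.Prime] (n s : ℕ) : ℝ≥0∞ :=
  ∑' G : X0 p, wt G * (genProb n G * (Nat.card G.grp : ℝ≥0∞)⁻¹ ^ s)

theorem genSum_zero (s : ℕ) : genSum p 0 s = 1 := by
  have h1 : Nat.card (isoClass p PUnit).grp = 1 := by rw [card_isoClass_grp]; simp
  rw [genSum, tsum_eq_single (isoClass p PUnit)]
  · have h2 : wt (isoClass p PUnit) = 1 := by
      rw [wt, cardAut_isoClass]
      simp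
    rw [genProb, if_pos h1, h1, h2]
    simp
  · intro G hG
    rw [genProb, if_neg, zero_mul, mul_zero]
    intro h
    have := (Nat.card_eq_one_iff_unique.1 h).1
    refine hG ?_
    rw [← isoClass_grp G, isoClass_eq_iff]
    exact ⟨LinearEquiv.ofSubsingleton _ _⟩

/-- The recursion for `genSum`: the first of the `n + 1` elements generates a subgroup of order
`p ^ m`, with weights as in `tsum_wt_mul_card_elements`. -/
theorem genSum_succ (n s : ℕ) :
    genSum p (n + 1) s = genSum p n (s + 1) * (1 - (p : ℝ≥0∞)⁻¹ ^ (s + 1))⁻¹ := by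
  have hp := (Fact.out : p.Prime)
  let h : X0 p × ℕ → ℝ≥0∞ := fun x =>
    genProb n x.1 * ((Nat.card x.1.grp : ℝ≥0∞)⁻¹ ^ (s + 1) * ((p : ℝ≥0∞)⁻¹ ^ (s + 1)) ^ x.2)
  let f : ∀ G : X0 p, G.grp → X0 p × ℕ := fun G x =>
    (isoClass p (G.grp ⧸ Submodule.span ℤ_[p] {x}),
      Nat.log p (Nat.card (Submodule.span ℤ_[p] {x})))
  have hterm : ∀ G : X0 p, genProb (n + 1) G * (Nat.card G.grp : ℝ≥0∞)⁻¹ ^ s =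
      ∑' x : X0 p × ℕ, (Nat.card {y // f G y = x} : ℝ≥0∞) * h x := by
    intro G
    rw [← tsum_comp_eq_tsum_card_fiber_mul, genProb, mul_comm, ← mul_assoc, ← pow_succ,
      ← ENNReal.tsum_mul_left]
    refine tsum_congr fun y => ?_
    obtain ⟨m, hm⟩ := exists_card_span_eq (p := p) y
    have hc : (Nat.card G.grp : ℝ≥0∞) =
        Nat.card (G.grp ⧸ Submodule.span ℤ_[p] {y}) * (p : ℝ≥0∞) ^ m := by
      rw [card_eq_card_quotient_mul_card (Submodule.span ℤ_[p] {y}), hm]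
      push_cast
      rfl
    simp only [h, f, hm, card_isoClass_grp, Nat.log_pow hp.one_lt]
    rw [hc, ENNReal.mul_inv (Or.inr (by finiteness)) (Or.inl (by finiteness)), mul_pow,
      ENNReal.inv_pow, ← pow_mul, ← pow_mul, mul_comm m, mul_comm]
  have hfib : ∀ (G Q : X0 p) (m : ℕ), Nat.card {y // f G y = (Q, m)} =
      Nat.card {x : G.grp // Nat.card (Submodule.span ℤ_[p] {x}) = p ^ m ∧
        isoClass p (G.grp ⧸ Submodule.span ℤ_[p] {x}) = Q} := by
    intro G Q m
    refine Nat.card_congr (Equiv.subtypeEquivRight fun y => ?_)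
    obtain ⟨k, hk⟩ := exists_card_span_eq (p := p) y
    simp only [f, Prod.mk.injEq, hk, Nat.log_pow hp.one_lt,
      (Nat.pow_right_injective hp.two_le).eq_iff, and_comm]
  calc genSum p (n + 1) s
      = ∑' (G : X0 p) (x : X0 p × ℕ), wt G * (Nat.card {y // f G y = x} : ℝ≥0∞) * h x := by
        refine tsum_congr fun G => ?_
        rw [hterm, ← ENNReal.tsum_mul_left]
        simp_rw [mul_assoc]
    _ = ∑' (x : X0 p × ℕ), wt x.1 * h x := by
        rw [ENNReal.tsum_comm]
        refine tsum_congr fun x => ?_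
        rw [ENNReal.tsum_mul_right, ← tsum_wt_mul_card_elements x.2 x.1]
        simp_rw [← hfib]
    _ = ∑' (Q : X0 p) (m : ℕ), wt Q * (genProb n Q * (Nat.card Q.grp : ℝ≥0∞)⁻¹ ^ (s + 1)) *
          ((p : ℝ≥0∞)⁻¹ ^ (s + 1)) ^ m := by
        rw [ENNReal.tsum_prod']
        simp only [h, mul_assoc]
    _ = _ := by
        simp_rw [ENNReal.tsum_mul_left, ENNReal.tsum_geometric]
        rw [ENNReal.tsum_mul_right]
        rfl

theorem genSum_eq_prod (n s : ℕ) :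
    genSum p n s = ∏ i ∈ Finset.range n, (1 - (p : ℝ≥0∞)⁻¹ ^ (s + i + 1))⁻¹ := by
  induction n generalizing s with
  | zero => rw [genSum_zero, Finset.prod_range_zero]
  | succ n ih =>
    rw [genSum_succ, ih, Finset.prod_range_succ']
    simp only [add_zero]
    congr 1
    refine Finset.prod_congr rfl fun i _ => ?_
    rw [show s + 1 + i + 1 = s + (i + 1) + 1 by ring]

variable (p) in
theorem tendsto_prod_c0 :
    Tendsto (fun n => ∏ i ∈ Finset.range n, (1 - 1 / (p : ℝ) ^ (i + 1))) atTop (𝓝 (c0 p)) := by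
  have hp1 : (1 : ℝ) < p := by exact_mod_cast (Fact.out : p.Prime).one_lt
  have hs : Summable (fun i : ℕ => ‖-(1 / (p : ℝ) ^ (i + 1))‖) := by
    have := (summable_geometric_of_lt_one (r := 1 / (p : ℝ)) (by positivity)
      (by rw [div_lt_one (by linarith)]; exact hp1))
    have h2 := (summable_nat_add_iff 1).2 this
    refine h2.congr fun i => ?_
    rw [norm_neg, Real.norm_of_nonneg (by positivity), one_div_pow]
  have := (multipliable_one_add_of_summable hs).hasProd.tendsto_prod_nat
  simp only [← sub_eq_add_neg] at this
  exact this

/-- The total mass of the weights `1 / #Aut(G)` is `1 / c₀`. -/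
theorem tsum_wt : ∑' G : X0 p, wt G = (ENNReal.ofReal (c0 p))⁻¹ := by
  have hp0 : (0 : ℝ) < p := by exact_mod_cast (Fact.out : p.Prime).pos
  have hsup : ∑' G : X0 p, wt G = ⨆ n, genSum p n 0 := by
    simp only [genSum, pow_zero, mul_one]
    simp_rw [ENNReal.tsum_eq_iSup_sum]
    rw [iSup_comm]
    refine iSup_congr fun t => ?_
    rw [← ENNReal.finsetSum_iSup_of_monotone]
    · refine Finset.sum_congr rfl fun G _ => ?_
      rw [← ENNReal.mul_iSup, iSup_genProb, mul_one]
    · intro G m n hmn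
      dsimp only
      gcongr
      exact genProb_mono G hmn
  have hmono : Monotone fun n => genSum p n 0 := by
    intro m n hmn
    simp only [genSum]
    refine ENNReal.tsum_le_tsum fun G => ?_
    gcongr
    exact genProb_mono G hmn
  have h1 : Tendsto (fun n => genSum p n 0) atTop (𝓝 (∑' G : X0 p, wt G)) := by
    rw [hsup]
    exact tendsto_atTop_iSup hmono
  have h2 : ∀ n, genSum p n 0 =
      (ENNReal.ofReal (∏ i ∈ Finset.range n, (1 - 1 / (p : ℝ) ^ (i + 1))))⁻¹ := by
    intro n
    have hnn : ∀ i, (0 : ℝ) ≤ 1 - 1 / (p : ℝ) ^ (i + 1) := fun i => by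
      have : 1 / (p : ℝ) ^ (i + 1) ≤ 1 := by
        rw [div_le_one (by positivity)]
        exact one_le_pow₀ (by exact_mod_cast (Fact.out : p.Prime).one_le)
      linarith
    rw [genSum_eq_prod, ENNReal.ofReal_prod_of_nonneg fun i _ => hnn i,
      ENNReal.prod_inv_distrib]
    · refine Finset.prod_congr rfl fun i _ => ?_
      rw [ENNReal.ofReal_sub _ (by positivity), ENNReal.ofReal_one, one_div,
        ENNReal.ofReal_inv_of_pos (by positivity), ENNReal.ofReal_pow hp0.le,
        ENNReal.ofReal_natCast, ENNReal.inv_pow, zero_add]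
    · intro i _ j _ _
      exact Or.inr (by finiteness)
  refine tendsto_nhds_unique h1 ?_
  simp_rw [h2]
  exact tendsto_inv_iff.2 (ENNReal.tendsto_ofReal (tendsto_prod_c0 p))

variable {F F' : Type} [AddCommGroup F] [Module ℤ_[p] F] [Finite F]
  [AddCommGroup F'] [Module ℤ_[p] F'] [Finite F']

/-- All surjection moments of the weights `1 / #Aut` are equal to their total mass: over a fixed
kernel, the extensions of `F` have the same total weight as the kernel. -/
theorem tsum_wt_mul_numSur :
    ∑' G : X0 p, wt G * (numSur p G.grp F : ℝ≥0∞) = (ENNReal.ofReal (c0 p))⁻¹ := by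
  rw [← tsum_wt, ← tsum_congr fun K => tsum_wt_mul_card_ker_eq p F K, ENNReal.tsum_comm]
  refine tsum_congr fun G => ?_
  rw [ENNReal.tsum_mul_left, numSur, natCard_eq_tsum_fiber
    (fun π : {f : G.grp →ₗ[ℤ_[p]] F // Function.Surjective f} => isoClass p (LinearMap.ker π.1))]
  congr 1
  refine tsum_congr fun K => ?_
  congr 1
  exact (Nat.card_congr (Equiv.subtypeSubtypeEquivSubtypeInter
    (fun π : G.grp →ₗ[ℤ_[p]] F => Function.Surjective π)
    (fun π => isoClass p (LinearMap.ker π) = K)))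

theorem card_range_eq {F : Type} [AddCommGroup F] [Module ℤ_[p] F] (G : Type) [AddCommGroup G]
    [Module ℤ_[p] G] (S : Submodule ℤ_[p] F) :
    Nat.card {θ : G →ₗ[ℤ_[p]] F // LinearMap.range θ = S} = numSur p G S := by
  refine Nat.card_congr
    { toFun := fun θ => ⟨θ.1.codRestrict S fun x =>
        θ.2.le (LinearMap.mem_range_self _ x), ?_⟩
      invFun := fun f => ⟨S.subtype ∘ₗ f.1, ?_⟩
      left_inv := fun θ => Subtype.ext rfl
      right_inv := fun f => Subtype.ext rfl }
  · rintro ⟨y, hy⟩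
    rw [← θ.2] at hy
    obtain ⟨x, hx⟩ := hy
    exact ⟨x, Subtype.ext hx⟩
  · rw [LinearMap.range_comp, LinearMap.range_eq_top.2 f.2, Submodule.map_top,
      Submodule.range_subtype]

/-- All surjection moments of the weight `w` are equal to `m`. -/
def HasMoments (w : X0 p → ℝ≥0∞) (m : ℝ≥0∞) : Prop :=
  ∀ F : X0 p, ∑' G : X0 p, w G * (cardSur G F : ℝ≥0∞) = m

theorem HasMoments.tsum_mul_numSur {w : X0 p → ℝ≥0∞} {m : ℝ≥0∞} (hw : HasMoments w m) :
    ∑' G : X0 p, w G * (numSur p G.grp F : ℝ≥0∞) = m := by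
  obtain ⟨e⟩ := nonempty_isoClass_grp_equiv (p := p) F
  rw [← hw (isoClass p F)]
  refine tsum_congr fun G => ?_
  rw [cardSur_eq, numSur_congr (LinearEquiv.refl _ _) e]

variable (p) in
theorem hasMoments_wt : HasMoments (wt (p := p)) (ENNReal.ofReal (c0 p))⁻¹ := fun _ =>
  tsum_wt_mul_numSur

/-- Homomorphisms to `F` with a condition on the image are counted by the surjections to the
submodules of `F` that satisfy the condition. -/
theorem card_range_eq_tsum (G : Type) [AddCommGroup G] [Module ℤ_[p] G] [Module.Finite ℤ_[p] G]
    (P : Submodule ℤ_[p] F → Prop) :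
    (Nat.card {θ : G →ₗ[ℤ_[p]] F // P (LinearMap.range θ)} : ℝ≥0∞) =
      ∑' S : {S // P S}, (numSur p G S.1 : ℝ≥0∞) := by
  have := finite_linearMap ℤ_[p] G F
  rw [natCard_eq_tsum_fiber
    (fun θ : {θ : G →ₗ[ℤ_[p]] F // P (LinearMap.range θ)} =>
      (⟨LinearMap.range θ.1, θ.2⟩ : {S // P S}))]
  refine tsum_congr fun S => ?_
  rw [← card_range_eq]
  congr 1
  exact Nat.card_congr
    { toFun := fun θ => ⟨θ.1.1, congrArg Subtype.val θ.2⟩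
      invFun := fun θ => ⟨⟨θ.1, θ.2.symm ▸ S.2⟩, Subtype.ext θ.2⟩
      left_inv := fun _ => rfl
      right_inv := fun _ => rfl }

/-- If all surjection moments are equal to `m`, then the homomorphisms to `F` with a condition on the
image have `m` times as many expected elements as there are submodules of `F` with the condition. -/
theorem HasMoments.tsum_mul_card_range {w : X0 p → ℝ≥0∞} {m : ℝ≥0∞} (hw : HasMoments w m)
    (P : Submodule ℤ_[p] F → Prop) :
    ∑' G : X0 p, w G * (Nat.card {θ : G.grp →ₗ[ℤ_[p]] F // P (LinearMap.range θ)} : ℝ≥0∞) =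
      Nat.card {S // P S} * m := by
  simp_rw [card_range_eq_tsum, ← ENNReal.tsum_mul_left]
  rw [ENNReal.tsum_comm]
  simp_rw [hw.tsum_mul_numSur]
  have := Fintype.ofFinite {S : Submodule ℤ_[p] F // P S}
  rw [tsum_fintype, Finset.sum_const, Finset.card_univ, nsmul_eq_mul, Nat.card_eq_fintype_card]

/-- The submodules of `F × F'` that project onto both factors. -/
abbrev Subdirect (p : ℕ) [Fact p.Prime] (F F' : Type) [AddCommGroup F] [Module ℤ_[p] F]
    [AddCommGroup F'] [Module ℤ_[p] F'] : Type :=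
  {S : Submodule ℤ_[p] (F × F') // S.map (LinearMap.fst ℤ_[p] F F') = ⊤ ∧
    S.map (LinearMap.snd ℤ_[p] F F') = ⊤}

theorem tsum_wt_mul_numSur_mul_numSur :
    ∑' G : X0 p, wt G * (numSur p G.grp F * numSur p G.grp F' : ℝ≥0∞) =
      Nat.card (Subdirect p F F') * (ENNReal.ofReal (c0 p))⁻¹ := by
  rw [← (hasMoments_wt p).tsum_mul_card_range]
  refine tsum_congr fun G => ?_
  congr 1
  rw [← Nat.cast_mul, numSur, numSur, ← Nat.card_prod]
  congr 1
  refine Nat.card_congr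
    { toFun := fun x => ⟨x.1.1.prod x.2.1, ?_⟩
      invFun := fun θ => (⟨LinearMap.fst _ _ _ ∘ₗ θ.1, ?_⟩, ⟨LinearMap.snd _ _ _ ∘ₗ θ.1, ?_⟩)
      left_inv := fun _ => rfl
      right_inv := fun _ => rfl }
  · rw [← LinearMap.range_comp, ← LinearMap.range_comp]
    exact ⟨LinearMap.range_eq_top.2 x.1.2, LinearMap.range_eq_top.2 x.2.2⟩
  · rw [← LinearMap.range_eq_top, LinearMap.range_comp]; exact θ.2.1
  · rw [← LinearMap.range_eq_top, LinearMap.range_comp]; exact θ.2.2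

/-- Goursat's lemma as a count: a subdirect product of `F` and `F'` is the fibre product of a pair
of surjections to a common quotient `G`, unique up to `Aut(G)`. -/
theorem tsum_wt_mul_numSur_from :
    ∑' G : X0 p, wt G * (numSur p F G.grp * numSur p F' G.grp : ℝ≥0∞) =
      Nat.card (Subdirect p F F') := by
  classical
  let fib : ∀ G : X0 p, {f : F →ₗ[ℤ_[p]] G.grp // Function.Surjective f} ×
      {f : F' →ₗ[ℤ_[p]] G.grp // Function.Surjective f} → Subdirect p F F' := fun G x =>
    ⟨LinearMap.ker (x.1.1 ∘ₗ LinearMap.fst _ _ _ - x.2.1 ∘ₗ LinearMap.snd _ _ _), by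
      constructor
      · rw [eq_top_iff]
        intro a _
        obtain ⟨b, hb⟩ := x.2.2 (x.1.1 a)
        exact ⟨(a, b), by simp [hb], rfl⟩
      · rw [eq_top_iff]
        intro b _
        obtain ⟨a, ha⟩ := x.1.2 (x.2.1 b)
        exact ⟨(a, b), by simp [ha], rfl⟩⟩
  have hmem : ∀ G x a b, (a, b) ∈ (fib G x).1 ↔ x.1.1 a = x.2.1 b := by
    intro G x a b
    simp [fib, sub_eq_zero]
  let quot : Subdirect p F F' → X0 p := fun S => isoClass p ((F × F') ⧸ S.1)
  have hfib : ∀ (G : X0 p) (S : Subdirect p F F'),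
      Nat.card {x // fib G x = S} = if G = quot S then cardAut G else 0 := by
    intro G S
    have hS1 : ∀ a, ∃ b, (a, b) ∈ S.1 := fun a => by
      obtain ⟨⟨a', b⟩, h, rfl⟩ := (S.2.1.ge (Submodule.mem_top : a ∈ ⊤))
      exact ⟨b, h⟩
    have hS2 : ∀ b, ∃ a, (a, b) ∈ S.1 := fun b => by
      obtain ⟨⟨a, b'⟩, h, rfl⟩ := (S.2.2.ge (Submodule.mem_top : b ∈ ⊤))
      exact ⟨a, h⟩
    let q1 : F →ₗ[ℤ_[p]] (F × F') ⧸ S.1 := S.1.mkQ ∘ₗ LinearMap.inl _ _ _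
    let q2 : F' →ₗ[ℤ_[p]] (F × F') ⧸ S.1 := -(S.1.mkQ ∘ₗ LinearMap.inr _ _ _)
    have hq : ∀ a b, q1 a = q2 b ↔ (a, b) ∈ S.1 := fun a b => by
      rw [← Submodule.Quotient.mk_eq_zero, ← sub_eq_zero]
      simp only [q1, q2, LinearMap.neg_apply, sub_neg_eq_add, LinearMap.comp_apply, ← map_add]
      simp
    have hq1 : Function.Surjective q1 := by
      intro z
      obtain ⟨⟨a, b⟩, rfl⟩ := S.1.mkQ_surjective z
      obtain ⟨a', ha'⟩ := hS2 b
      refine ⟨a - a', ?_⟩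
      rw [← sub_eq_zero]
      simp only [q1, LinearMap.comp_apply, ← map_sub]
      rw [Submodule.mkQ_apply, Submodule.Quotient.mk_eq_zero]
      convert S.1.neg_mem ha' using 1
      simp
    have hq2 : Function.Surjective q2 := by
      intro z
      obtain ⟨a, rfl⟩ := hq1 z
      obtain ⟨b, hb⟩ := hS1 a
      exact ⟨b, ((hq a b).2 hb).symm⟩
    have key : Nat.card {x // fib G x = S} =
        Nat.card (((F × F') ⧸ S.1) ≃ₗ[ℤ_[p]] G.grp) := by
      have hf : ∀ f : ((F × F') ⧸ S.1) ≃ₗ[ℤ_[p]] G.grp,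
          fib G (⟨f.toLinearMap ∘ₗ q1, f.surjective.comp hq1⟩,
            ⟨f.toLinearMap ∘ₗ q2, f.surjective.comp hq2⟩) = S := by
        intro f
        refine Subtype.ext (Submodule.ext fun ⟨a, b⟩ => ?_)
        rw [hmem, ← hq]
        exact f.injective.eq_iff
      refine (Nat.card_congr (Equiv.ofBijective (fun f => ⟨_, hf f⟩) ⟨?_, ?_⟩)).symm
      · intro f g hfg
        have h1 := congrArg (fun x => x.1.1.1) hfg
        exact LinearEquiv.toLinearMap_injective ((LinearMap.cancel_right hq1).1 h1)
      · rintro ⟨x, hx⟩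
        have hxS : ∀ a b, (a, b) ∈ S.1 ↔ x.1.1 a = x.2.1 b := fun a b => by
          rw [← hx]; exact hmem G x a b
        let g : ((F × F') ⧸ S.1) →ₗ[ℤ_[p]] G.grp :=
          S.1.liftQ (x.1.1 ∘ₗ LinearMap.fst _ _ _ - x.2.1 ∘ₗ LinearMap.snd _ _ _) (by
            rintro ⟨a, b⟩ h
            have := (hxS a b).1 h
            simp [this])
        have hg1 : g ∘ₗ q1 = x.1.1 := by
          refine LinearMap.ext fun a => ?_
          change x.1.1 a - x.2.1 0 = _
          simp
        have hg2 : g ∘ₗ q2 = x.2.1 := by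
          refine LinearMap.ext fun b => ?_
          change g (-(S.1.mkQ (0, b))) = _
          rw [map_neg]
          change -(x.1.1 0 - x.2.1 b) = _
          simp
        have hgb : Function.Bijective g := by
          constructor
          · rw [injective_iff_map_eq_zero]
            intro z hz
            obtain ⟨⟨a, b⟩, rfl⟩ := S.1.mkQ_surjective z
            rw [Submodule.mkQ_apply, Submodule.Quotient.mk_eq_zero, hxS]
            exact sub_eq_zero.1 hz
          · intro y
            obtain ⟨a, rfl⟩ := x.1.2 y
            exact ⟨q1 a, LinearMap.congr_fun hg1 a⟩
        refine ⟨LinearEquiv.ofBijective g hgb, Subtype.ext (Prod.ext (Subtype.ext ?_)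
          (Subtype.ext ?_))⟩
        · exact hg1
        · exact hg2
    rw [key]
    split_ifs with hG
    · subst hG
      obtain ⟨e⟩ := nonempty_isoClass_grp_equiv (p := p) ((F × F') ⧸ S.1)
      exact card_equiv_congr e.symm (LinearEquiv.refl _ _)
    · have : IsEmpty (((F × F') ⧸ S.1) ≃ₗ[ℤ_[p]] G.grp) := ⟨fun e => hG (by
        rw [← isoClass_grp G]
        exact (isoClass_eq_iff.2 ⟨e⟩).symm)⟩
      exact Nat.card_of_isEmpty
  have h1 : ∀ G : X0 p, wt G * (numSur p F G.grp * numSur p F' G.grp : ℝ≥0∞) =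
      ∑' S : Subdirect p F F', if G = quot S then 1 else 0 := by
    intro G
    rw [← Nat.cast_mul, numSur, numSur, ← Nat.card_prod, natCard_eq_tsum_fiber (fib G),
      ← ENNReal.tsum_mul_left]
    refine tsum_congr fun S => ?_
    rw [hfib]
    split_ifs with h
    · exact wt_mul_cardAut G
    · simp
  simp_rw [h1]
  rw [ENNReal.tsum_comm]
  simp_rw [tsum_ite_eq]
  have := Fintype.ofFinite (Subdirect p F F')
  rw [tsum_fintype, Finset.sum_const, Finset.card_univ, nsmul_one, Nat.card_eq_fintype_card]

end Mass

/-! ### The Hilbert space and the Fourier operator -/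

section FourierOperator

variable {p : ℕ} [Fact p.Prime]

theorem inner_def (ν η : L2 p) : ⟪ν, η⟫_ℝ = ∑' G : X0 p, ν G * η G / mu0 G := rfl

theorem summable_inner (ν η : L2 p) : Summable fun G : X0 p => ν G * η G / mu0 G :=
  summable_mul_div ν.2 η.2

theorem norm_sq_def (ν : L2 p) : ‖ν‖ ^ 2 = ∑' G : X0 p, ν G ^ 2 / mu0 G := by
  rw [← real_inner_self_eq_norm_sq, inner_def]
  simp_rw [sq]

@[ext]
theorem L2.ext {ν η : L2 p} (h : ∀ G : X0 p, ν G = η G) : ν = η := Subtype.ext (funext h)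

@[simp] theorem L2.add_apply (ν η : L2 p) (G : X0 p) : (ν + η) G = ν G + η G := rfl
@[simp] theorem L2.smul_apply (c : ℝ) (ν : L2 p) (G : X0 p) : (c • ν) G = c * ν G := rfl
@[simp] theorem L2.zero_apply (G : X0 p) : (0 : L2 p) G = 0 := rfl

variable (p) in
/-- Dividing by `√μ₀` identifies `L²(X₀, μ₀)*` with the Hilbert space of square-summable
sequences. -/
noncomputable def L2.toLp : L2 p ≃ₗᵢ[ℝ] lp (fun _ : X0 p => ℝ) 2 where
  toFun ν := ⟨fun G => ν G / √(mu0 G), by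
    refine memℓp_gen ?_
    refine ν.2.congr fun G => ?_
    simp [div_pow, Real.sq_sqrt (mu0_pos G).le]⟩
  invFun f := ⟨fun G => f G * √(mu0 G), by
    have := (lp.memℓp f).summable (by simp)
    refine this.congr fun G => ?_
    have h := (mu0_pos G).ne'
    simp [mul_pow, Real.sq_sqrt (mu0_pos G).le, h]⟩
  map_add' ν η := by
    ext G
    change (ν G + η G) / _ = ν G / _ + η G / _
    ring
  map_smul' c ν := by
    ext G
    change (c * ν G) / _ = c * (ν G / _)
    ring
  left_inv ν := by
    ext G
    exact div_mul_cancel₀ _ (Real.sqrt_pos.2 (mu0_pos G)).ne'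
  right_inv f := by
    ext G
    exact mul_div_cancel_right₀ _ (Real.sqrt_pos.2 (mu0_pos G)).ne'
  norm_map' ν := by
    rw [← sq_eq_sq₀ (norm_nonneg _) (norm_nonneg _), norm_sq_def]
    have := lp.norm_rpow_eq_tsum (p := 2) (by simp) (⟨fun G => ν G / √(mu0 G), by
      refine memℓp_gen ?_
      refine ν.2.congr fun G => ?_
      simp [div_pow, Real.sq_sqrt (mu0_pos G).le]⟩ : lp (fun _ : X0 p => ℝ) 2)
    simp only [ENNReal.toReal_ofNat, Real.rpow_two] at this
    refine this.trans (tsum_congr fun G => ?_)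
    simp [div_pow, Real.sq_sqrt (mu0_pos G).le]

instance : CompleteSpace (L2 p) :=
  (L2.toLp p).toIsometryEquiv.completeSpace_iff.2 inferInstance

theorem wt_toReal (G : X0 p) : (wt G).toReal = (cardAut G : ℝ)⁻¹ := by
  rw [wt, ENNReal.toReal_inv, ENNReal.toReal_natCast]

theorem summable_toReal_wt_mul {f : X0 p → ℝ≥0∞} (h : ∑' G, wt G * f G ≠ ∞) :
    Summable fun G => (cardAut G : ℝ)⁻¹ * (f G).toReal := by
  have := ENNReal.summable_toReal h
  simpa only [ENNReal.toReal_mul, wt_toReal] using this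

theorem mass_ne_top : (ENNReal.ofReal (c0 p))⁻¹ ≠ ∞ :=
  ENNReal.inv_ne_top.2 (ENNReal.ofReal_pos.2 (c0_pos p)).ne'

theorem summable_cardSur_mul_cardSur (F F' : X0 p) :
    Summable fun G : X0 p => (cardAut G : ℝ)⁻¹ * (cardSur G F * cardSur G F') := by
  have h := summable_toReal_wt_mul (p := p)
    (f := fun G => (numSur p G.grp F.grp * numSur p G.grp F'.grp : ℝ≥0∞))
    (by rw [tsum_wt_mul_numSur_mul_numSur]; exact ENNReal.mul_ne_top (by finiteness) mass_ne_top)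
  simpa [cardSur_eq] using h

theorem tsum_cardSur_mul_cardSur (F F' : X0 p) :
    ∑' G : X0 p, (cardAut G : ℝ)⁻¹ * (cardSur G F * cardSur G F') =
      Nat.card (Subdirect p F.grp F'.grp) * (c0 p)⁻¹ := by
  have h := congrArg ENNReal.toReal
    (tsum_wt_mul_numSur_mul_numSur (p := p) (F := F.grp) (F' := F'.grp))
  rw [ENNReal.tsum_toReal_eq fun G => ENNReal.mul_ne_top (wt_ne_top G) (by finiteness)] at h
  simpa [wt_toReal, cardSur_eq, (c0_pos p).le] using h

theorem tsum_cardSur_from_mul (F F' : X0 p) :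
    ∑' G : X0 p, (cardAut G : ℝ)⁻¹ * (cardSur F G * cardSur F' G) =
      Nat.card (Subdirect p F.grp F'.grp) := by
  have h := congrArg ENNReal.toReal
    (tsum_wt_mul_numSur_from (p := p) (F := F.grp) (F' := F'.grp))
  rw [ENNReal.tsum_toReal_eq fun G => ENNReal.mul_ne_top (wt_ne_top G) (by finiteness)] at h
  simpa [wt_toReal, cardSur_eq] using h

theorem cardAut_ne_zero (G : X0 p) : (cardAut G : ℝ) ≠ 0 := Nat.cast_ne_zero.2 (cardAut_pos G).ne'

/-- The measure `√c₀ #Sur(·, F) / #Aut(·)`. -/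
noncomputable def surTo (F : X0 p) : L2 p :=
  ⟨fun G => √(c0 p) * ((cardSur G F : ℝ) / cardAut G), by
    refine (summable_cardSur_mul_cardSur F F).congr fun G => ?_
    have h1 := cardAut_ne_zero G
    have h2 := (c0_pos p).ne'
    rw [mul_pow, Real.sq_sqrt (c0_pos p).le, mu0]
    field_simp⟩

theorem surTo_apply (F G : X0 p) : surTo F G = √(c0 p) * ((cardSur G F : ℝ) / cardAut G) := rfl

theorem surFrom_apply (F G : X0 p) : surFrom F G = (cardSur F G : ℝ) / cardAut G := rfl

/-- The Gram matrices of the two families agree: both count subdirect products of `F` and `F'`. -/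
theorem inner_surTo_eq_inner_surFrom (F F' : X0 p) :
    ⟪surTo F, surTo F'⟫_ℝ = ⟪surFrom F, surFrom F'⟫_ℝ := by
  have h2 := (c0_pos p).ne'
  have e1 : ⟪surTo F, surTo F'⟫_ℝ = Nat.card (Subdirect p F.grp F'.grp) * (c0 p)⁻¹ := by
    rw [inner_def, ← tsum_cardSur_mul_cardSur]
    refine tsum_congr fun G => ?_
    have h1 := cardAut_ne_zero G
    rw [surTo_apply, surTo_apply, mu0]
    field_simp
    rw [Real.sq_sqrt (c0_pos p).le]
    ring
  have e2 : ⟪surFrom F, surFrom F'⟫_ℝ = Nat.card (Subdirect p F.grp F'.grp) * (c0 p)⁻¹ := by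
    rw [inner_def, ← tsum_cardSur_from_mul, ← tsum_mul_right]
    refine tsum_congr fun G => ?_
    have h1 := cardAut_ne_zero G
    rw [surFrom_apply, surFrom_apply, mu0]
    field_simp
  rw [e1, e2]

theorem cardSur_self (F : X0 p) : cardSur F F = cardAut F := by
  refine (Nat.card_congr (Equiv.ofBijective
    (fun e : F.grp ≃ₗ[ℤ_[p]] F.grp => ⟨e.toLinearMap, e.surjective⟩) ⟨?_, ?_⟩)).symm
  · intro e e' h
    exact LinearEquiv.toLinearMap_injective (congrArg Subtype.val h)
  · rintro ⟨f, hf⟩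
    exact ⟨LinearEquiv.ofBijective f ⟨Finite.injective_iff_surjective.2 hf, hf⟩, Subtype.ext rfl⟩

theorem card_grp_lt_of_cardSur_ne_zero {F G : X0 p} (h : cardSur F G ≠ 0) (hne : G ≠ F) :
    Nat.card G.grp < Nat.card F.grp := by
  obtain ⟨⟨f, hf⟩⟩ := (Nat.card_ne_zero.1 h).1
  refine lt_of_le_of_ne (Nat.card_le_card_of_surjective f hf) fun hc => hne ?_
  have hb : Function.Bijective f := (Nat.bijective_iff_surjective_and_card f).2 ⟨hf, hc.symm⟩
  rw [← isoClass_grp G, ← isoClass_grp F]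
  exact (isoClass_eq_iff.2 ⟨LinearEquiv.ofBijective f hb⟩).symm

theorem inner_surFrom (ν : L2 p) (F : X0 p) :
    ⟪ν, surFrom F⟫_ℝ = (c0 p)⁻¹ * ∑' G : X0 p, ν G * cardSur F G := by
  rw [inner_def, ← tsum_mul_left]
  refine tsum_congr fun G => ?_
  have h1 := cardAut_ne_zero G
  have h2 := (c0_pos p).ne'
  rw [surFrom_apply, mu0]
  field_simp

/-- The family `surFrom` is total: it is unitriangular with respect to the order of the groups. -/
theorem eq_zero_of_inner_surFrom (ν : L2 p) (h : ∀ F : X0 p, ⟪ν, surFrom F⟫_ℝ = 0) : ν = 0 := by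
  ext F
  induction hN : Nat.card F.grp using Nat.strong_induction_on generalizing F with
  | _ N ih =>
  have h1 := h F
  rw [inner_surFrom, tsum_eq_single F, cardSur_self] at h1
  · simpa [(c0_pos p).ne', cardAut_ne_zero F] using h1
  · intro G hG
    by_cases hs : cardSur F G = 0
    · simp [hs]
    · have := ih _ (hN ▸ card_grp_lt_of_cardSur_ne_zero hs hG) G rfl
      simp [this]

variable (p) in
/-- Finite linear combinations of the measures `surFrom F`. -/
noncomputable def surFromMap : (X0 p →₀ ℝ) →ₗ[ℝ] L2 p := Finsupp.linearCombination ℝ surFrom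

variable (p) in
/-- Finite linear combinations of the measures `surTo F`. -/
noncomputable def surToMap : (X0 p →₀ ℝ) →ₗ[ℝ] L2 p := Finsupp.linearCombination ℝ surTo

variable (p) in
theorem denseRange_surFromMap : DenseRange (surFromMap p) := by
  have : (LinearMap.range (surFromMap p)).topologicalClosure = ⊤ := by
    rw [Submodule.topologicalClosure_eq_top_iff, Submodule.eq_bot_iff]
    intro ν hν
    refine eq_zero_of_inner_surFrom ν fun F => ?_
    rw [real_inner_comm]
    exact hν _ ⟨Finsupp.single F 1, by simp [surFromMap]⟩
  have h2 := congrArg (fun S : Submodule ℝ (L2 p) => (S : Set (L2 p))) this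
  intro x
  have hx : x ∈ ((LinearMap.range (surFromMap p)).topologicalClosure : Set (L2 p)) := by
    rw [this]; trivial
  exact hx

theorem norm_surToMap (v : X0 p →₀ ℝ) : ‖surToMap p v‖ = ‖surFromMap p v‖ := by
  rw [← sq_eq_sq₀ (norm_nonneg _) (norm_nonneg _), ← real_inner_self_eq_norm_sq,
    ← real_inner_self_eq_norm_sq]
  simp only [surToMap, surFromMap, Finsupp.linearCombination_apply, Finsupp.sum, sum_inner,
    inner_sum, real_inner_smul_left, real_inner_smul_right, inner_surTo_eq_inner_surFrom]

variable (p) in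
/-- The Fourier operator: the continuous extension of `surFrom F ↦ surTo F`. -/
noncomputable def fourier : L2 p →L[ℝ] L2 p := (surToMap p).extendOfNorm (surFromMap p)

theorem fourier_surFromMap (v : X0 p →₀ ℝ) : fourier p (surFromMap p v) = surToMap p v :=
  LinearMap.extendOfNorm_eq (denseRange_surFromMap p)
    ⟨1, fun x => by rw [one_mul, norm_surToMap]⟩ v

theorem fourier_surFrom (F : X0 p) : fourier p (surFrom F) = surTo F := by
  have := fourier_surFromMap (p := p) (Finsupp.single F 1)
  simpa [surFromMap, surToMap] using this

theorem norm_fourier (ν : L2 p) : ‖fourier p ν‖ = ‖ν‖ := by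
  refine (denseRange_surFromMap p).induction_on ν ?_ fun v => ?_
  · exact isClosed_eq (fourier p).continuous.norm continuous_norm
  · rw [fourier_surFromMap, norm_surToMap]

variable (p) in
theorem isFourier_fourier : IsFourier (fourier p) := fun F G => by
  rw [fourier_surFrom, surTo_apply]

theorem eq_fourier_of_isFourier {T : L2 p →L[ℝ] L2 p} (hT : IsFourier T) : T = fourier p := by
  have hF : ∀ F, T (surFrom F) = surTo F := fun F => L2.ext fun G => hT F G
  have h1 : T.toLinearMap ∘ₗ surFromMap p = (fourier p).toLinearMap ∘ₗ surFromMap p := by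
    refine Finsupp.lhom_ext' fun F => LinearMap.ext_ring ?_
    simp [surFromMap, hF, fourier_surFrom]
  ext ν : 1
  refine congrFun ((denseRange_surFromMap p).equalizer T.continuous (fourier p).continuous ?_) ν
  ext v : 1
  exact LinearMap.congr_fun h1 v

theorem inner_surTo (ν : L2 p) (F : X0 p) :
    ⟪ν, surTo F⟫_ℝ = (√(c0 p))⁻¹ * ∑' G : X0 p, ν G * cardSur G F := by
  rw [inner_def, ← tsum_mul_left]
  refine tsum_congr fun G => ?_
  have h1 := cardAut_ne_zero G
  have h2 := (c0_pos p).ne'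
  have h3 := (Real.sqrt_pos.2 (c0_pos p)).ne'
  have hs : √(c0 p) ^ 2 = c0 p := Real.sq_sqrt (c0_pos p).le
  rw [surTo_apply, mu0]
  field_simp
  rw [hs]
  ring

theorem summable_mul_cardSur (ν : L2 p) (F : X0 p) :
    Summable fun G : X0 p => ν G * cardSur G F := by
  refine ((summable_inner ν (surTo F)).mul_left (√(c0 p))).congr fun G => ?_
  have h1 := cardAut_ne_zero G
  have h2 := (c0_pos p).ne'
  have hs : √(c0 p) ^ 2 = c0 p := Real.sq_sqrt (c0_pos p).le
  rw [surTo_apply, mu0]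
  field_simp
  rw [hs]
  ring

end FourierOperator

/-! ### The `p`-rank -/

section Rank

variable {p : ℕ} [Fact p.Prime]

/-- The residue field `ℤ_[p] / p`. -/
abbrev Res (p : ℕ) [Fact p.Prime] : Type := ℤ_[p] ⧸ powIdeal p 1

instance : (powIdeal p 1).IsMaximal := by
  rw [powIdeal, pow_one, ← PadicInt.maximalIdeal_eq_span_p]
  infer_instance

noncomputable instance : Field (Res p) := Ideal.Quotient.field _

theorem card_res : Nat.card (Res p) = p := by rw [card_quot_powIdeal, pow_one]

/-- The reduction `M / p ^ n M`. -/
abbrev Reduct (p : ℕ) [Fact p.Prime] (n : ℕ) (M : Type) [AddCommGroup M] [Module ℤ_[p] M] : Type :=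
  M ⧸ (powIdeal p n • (⊤ : Submodule ℤ_[p] M))

/-- The `p`-rank of a module, the dimension of `M / p M`. -/
noncomputable def pRank (p : ℕ) [Fact p.Prime] (M : Type) [AddCommGroup M] [Module ℤ_[p] M] : ℕ :=
  Module.finrank (Res p) (Reduct p 1 M)

variable {M N : Type} [AddCommGroup M] [Module ℤ_[p] M] [AddCommGroup N] [Module ℤ_[p] N]

theorem powIdeal_smul_top_le_ker {n : ℕ} (f : M →ₗ[ℤ_[p]] N)
    (hN : powIdeal p n • (⊤ : Submodule ℤ_[p] N) = ⊥) :
    powIdeal p n • (⊤ : Submodule ℤ_[p] M) ≤ LinearMap.ker f := by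
  rw [Submodule.smul_le]
  intro r hr x _
  rw [LinearMap.mem_ker, map_smul, ← Submodule.mem_bot ℤ_[p], ← hN]
  exact Submodule.smul_mem_smul hr trivial

theorem reduct_smul_top (n : ℕ) : powIdeal p n • (⊤ : Submodule ℤ_[p] (Reduct p n M)) = ⊥ := by
  rw [eq_bot_iff, Submodule.smul_le]
  intro r hr x _
  obtain ⟨x, rfl⟩ := Submodule.mkQ_surjective _ x
  rw [← map_smul, Submodule.mem_bot, Submodule.mkQ_apply, Submodule.Quotient.mk_eq_zero]
  exact Submodule.smul_mem_smul hr trivial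

theorem res_smul_top (s : ℕ) : powIdeal p 1 • (⊤ : Submodule ℤ_[p] (Fin s → Res p)) = ⊥ := by
  rw [eq_bot_iff, Submodule.smul_le]
  intro r hr x _
  rw [Submodule.mem_bot]
  ext i
  obtain ⟨y, hy⟩ := (powIdeal p 1).mkQ_surjective (x i)
  rw [Pi.smul_apply, ← hy, ← map_smul, Pi.zero_apply, Submodule.mkQ_apply,
    Submodule.Quotient.mk_eq_zero, smul_eq_mul]
  exact Ideal.mul_mem_right _ _ hr

variable [Finite M] [Finite N]

instance : Module.Finite (Res p) (Reduct p 1 M) := Module.Finite.of_finite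

/-- The reduction of `M` modulo `p` is a vector space of dimension `pRank p M`. -/
theorem nonempty_reduct_equiv : Nonempty (Reduct p 1 M ≃ₗ[Res p] (Fin (pRank p M) → Res p)) :=
  ⟨LinearEquiv.ofFinrankEq _ _ (by rw [Module.finrank_fin_fun]; rfl)⟩

theorem card_reduct : Nat.card (Reduct p 1 M) = p ^ pRank p M := by
  obtain ⟨e⟩ := nonempty_reduct_equiv (p := p) (M := M)
  rw [Nat.card_congr e.toEquiv, Nat.card_fun, card_res, Nat.card_fin]

/-- Maps to a module killed by `p ^ n` factor through the reduction. -/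
noncomputable def homReductEquiv (n : ℕ) (hN : powIdeal p n • (⊤ : Submodule ℤ_[p] N) = ⊥) :
    (M →ₗ[ℤ_[p]] N) ≃ (Reduct p n M →ₗ[ℤ_[p]] N) where
  toFun f := Submodule.liftQ _ f (powIdeal_smul_top_le_ker f hN)
  invFun g := g ∘ₗ Submodule.mkQ _
  left_inv f := rfl
  right_inv g := by ext; rfl

omit [Finite M] [Finite N] in
theorem numSur_reduct (n : ℕ) (hN : powIdeal p n • (⊤ : Submodule ℤ_[p] N) = ⊥) :
    numSur p (Reduct p n M) N = numSur p M N := by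
  refine (Nat.card_congr ((homReductEquiv n hN).subtypeEquiv fun f => ?_)).symm
  constructor
  · intro h y
    obtain ⟨x, hx⟩ := h y
    exact ⟨Submodule.mkQ _ x, hx⟩
  · intro h
    exact h.comp (Submodule.mkQ_surjective _)

theorem card_hom_res : Nat.card (M →ₗ[ℤ_[p]] Res p) = p ^ pRank p M := by
  have h0 : powIdeal p 1 • (⊤ : Submodule ℤ_[p] (Res p)) = ⊥ := by
    have := res_smul_top (p := p) 1
    rw [eq_bot_iff, Submodule.smul_le] at this ⊢
    intro r hr x _
    exact congrFun ((Submodule.mem_bot _).1 (this r hr (fun _ => x) trivial)) 0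
  rw [Nat.card_congr (homReductEquiv 1 h0)]
  have e : (Reduct p 1 M →ₗ[ℤ_[p]] Res p) ≃ (Module.Dual (Res p) (Reduct p 1 M)) :=
    { toFun := fun f => LinearMap.extendScalarsOfSurjective (Ideal.Quotient.mk_surjective) f
      invFun := fun f => f.restrictScalars ℤ_[p]
      left_inv := fun f => rfl
      right_inv := fun f => rfl }
  rw [Nat.card_congr e]
  have : Fintype (Res p) := Fintype.ofFinite _
  have : Finite (Module.Dual (Res p) (Reduct p 1 M)) := Finite.of_injective _ DFunLike.coe_injective
  have : Fintype (Module.Dual (Res p) (Reduct p 1 M)) := Fintype.ofFinite _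
  rw [Nat.card_eq_fintype_card, Module.card_eq_pow_finrank (K := Res p), Subspace.dual_finrank_eq,
    ← Nat.card_eq_fintype_card, card_res]
  rfl

theorem card_hom_fin_res (i : ℕ) : Nat.card (M →ₗ[ℤ_[p]] (Fin i → Res p)) = (p ^ pRank p M) ^ i := by
  have e : (M →ₗ[ℤ_[p]] (Fin i → Res p)) ≃ (Fin i → (M →ₗ[ℤ_[p]] Res p)) :=
    { toFun := fun f j => LinearMap.proj j ∘ₗ f
      invFun := fun g => LinearMap.pi g
      left_inv := fun f => rfl
      right_inv := fun g => rfl }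
  rw [Nat.card_congr e, Nat.card_fun, Nat.card_fin, card_hom_res]

omit [Finite N] in
theorem card_reduct_le_of_surjective (f : M →ₗ[ℤ_[p]] N) (hf : Function.Surjective f) :
    Nat.card (Reduct p 1 N) ≤ Nat.card (Reduct p 1 M) := by
  have hle : powIdeal p 1 • (⊤ : Submodule ℤ_[p] M) ≤
      LinearMap.ker ((powIdeal p 1 • (⊤ : Submodule ℤ_[p] N)).mkQ ∘ₗ f) :=
    powIdeal_smul_top_le_ker _ (reduct_smul_top 1)
  refine Nat.card_le_card_of_surjective (Submodule.liftQ _ _ hle) ?_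
  intro y
  obtain ⟨y, rfl⟩ := Submodule.mkQ_surjective _ y
  obtain ⟨x, rfl⟩ := hf y
  exact ⟨Submodule.mkQ _ x, rfl⟩

theorem pRank_le_of_surjective (f : M →ₗ[ℤ_[p]] N) (hf : Function.Surjective f) :
    pRank p N ≤ pRank p M := by
  have := card_reduct_le_of_surjective f hf
  rw [card_reduct, card_reduct] at this
  exact (Nat.pow_le_pow_iff_right (Fact.out : p.Prime).one_lt).1 this

theorem pRank_congr (e : M ≃ₗ[ℤ_[p]] N) : pRank p M = pRank p N :=
  le_antisymm (pRank_le_of_surjective e.symm.toLinearMap e.symm.surjective)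
    (pRank_le_of_surjective e.toLinearMap e.surjective)

/-- The `p`-torsion and the reduction modulo `p` of a finite module have the same size. -/
theorem card_pTorsion : Nat.card {x : M // (p : ℤ_[p]) • x = 0} = p ^ pRank p M := by
  rw [← card_reduct]
  let f : M →ₗ[ℤ_[p]] M := LinearMap.lsmul ℤ_[p] M (p : ℤ_[p])
  have h1 := card_eq_card_quotient_mul_card (LinearMap.ker f)
  have h2 := card_eq_card_quotient_mul_card (LinearMap.range f)
  have h3 : Nat.card (M ⧸ LinearMap.ker f) = Nat.card (LinearMap.range f) :=
    Nat.card_congr f.quotKerEquivRange.toEquiv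
  have h4 : powIdeal p 1 • (⊤ : Submodule ℤ_[p] M) = LinearMap.range f := by
    rw [powIdeal, pow_one, Submodule.ideal_span_singleton_smul]
    ext x
    simp [f, Submodule.mem_smul_pointwise_iff_exists]
  rw [h1, h3, mul_comm] at h2
  have h5 := Nat.eq_of_mul_eq_mul_right Nat.card_pos h2
  change _ = Nat.card (M ⧸ (powIdeal p 1 • (⊤ : Submodule ℤ_[p] M)))
  rw [h4, ← h5]
  rfl

theorem pRank_prod : pRank p (M × N) = pRank p M + pRank p N := by
  have h : Nat.card (M × N →ₗ[ℤ_[p]] Res p) =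
      Nat.card (M →ₗ[ℤ_[p]] Res p) * Nat.card (N →ₗ[ℤ_[p]] Res p) := by
    rw [← Nat.card_prod]
    exact (Nat.card_congr (LinearMap.coprodEquiv ℤ_[p]).toEquiv).symm
  rw [card_hom_res, card_hom_res, card_hom_res, ← pow_add] at h
  exact Nat.pow_right_injective (Fact.out : p.Prime).two_le h

/-- The submodules of `M × 𝔽_p ^ s` that project onto the second factor: such a submodule is given
by its intersection with `M` and by lifts of the basis vectors. -/
theorem card_submodule_onto_le (s : ℕ) :
    Nat.card {S : Submodule ℤ_[p] (M × (Fin s → Res p)) //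
        S.map (LinearMap.snd ℤ_[p] M (Fin s → Res p)) = ⊤} ≤
      Nat.card (Submodule ℤ_[p] M) * (p ^ pRank p M) ^ s := by
  classical
  let e : Fin s → (Fin s → Res p) := fun i => Pi.single i 1
  have hlift : ∀ (S : {S : Submodule ℤ_[p] (M × (Fin s → Res p)) //
      S.map (LinearMap.snd ℤ_[p] M (Fin s → Res p)) = ⊤}) (i : Fin s), ∃ x, (x, e i) ∈ S.1 := by
    intro S i
    obtain ⟨⟨x, y⟩, h, hy⟩ := S.2.ge (Submodule.mem_top : e i ∈ ⊤)
    obtain rfl : y = e i := hy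
    exact ⟨x, h⟩
  choose x hx using hlift
  let T : Submodule ℤ_[p] M → Type := fun M₀ => Fin s → {y : M ⧸ M₀ // (p : ℤ_[p]) • y = 0}
  let F : {S : Submodule ℤ_[p] (M × (Fin s → Res p)) //
      S.map (LinearMap.snd ℤ_[p] M (Fin s → Res p)) = ⊤} → Σ M₀, T M₀ := fun S =>
    ⟨S.1.comap (LinearMap.inl _ _ _), fun i => ⟨Submodule.mkQ _ (x S i), by
      rw [← map_smul, Submodule.mkQ_apply, Submodule.Quotient.mk_eq_zero, Submodule.mem_comap]
      have h1 := S.1.smul_mem (p : ℤ_[p]) (hx S i)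
      have h2 : (p : ℤ_[p]) • e i = 0 := by
        have := res_smul_top (p := p) s
        rw [eq_bot_iff, Submodule.smul_le] at this
        exact (Submodule.mem_bot _).1 (this (p : ℤ_[p])
          (by rw [powIdeal, pow_one]; exact Ideal.mem_span_singleton_self _) (e i) trivial)
      rwa [Prod.smul_mk, h2] at h1⟩⟩
  have hmem : ∀ (S : {S : Submodule ℤ_[p] (M × (Fin s → Res p)) //
      S.map (LinearMap.snd ℤ_[p] M (Fin s → Res p)) = ⊤}) (z : M) (a : Fin s → ℤ_[p]),
      (z, ∑ i, a i • e i) ∈ S.1 ↔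
        z - ∑ i, a i • x S i ∈ S.1.comap (LinearMap.inl ℤ_[p] M (Fin s → Res p)) := by
    intro S z a
    have hs : (∑ i, a i • x S i, ∑ i, a i • e i) ∈ S.1 := by
      have := S.1.sum_mem fun i (_ : i ∈ Finset.univ) => S.1.smul_mem (a i) (hx S i)
      have h2 : (∑ i, a i • x S i, ∑ i, a i • e i) = ∑ i, a i • ((x S i, e i) : M × _) := by
        rw [Prod.ext_iff]
        simp [Prod.fst_sum, Prod.snd_sum]
      rwa [h2]
    rw [Submodule.mem_comap, ← S.1.sub_mem_iff_left hs]
    simp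
  have hF : Function.Injective F := by
    intro S S' h
    have h1 : S.1.comap (LinearMap.inl ℤ_[p] M (Fin s → Res p)) =
        S'.1.comap (LinearMap.inl ℤ_[p] M (Fin s → Res p)) := congrArg Sigma.fst h
    have h2 : ∀ i, x S i - x S' i ∈ S.1.comap (LinearMap.inl ℤ_[p] M (Fin s → Res p)) := by
      intro i
      have h3 : ∀ (A B : Submodule ℤ_[p] M) (t : T A) (t' : T B),
          (⟨A, t⟩ : Σ M₀, T M₀) = ⟨B, t'⟩ → ∀ a b : M, (t i).1 = A.mkQ a → (t' i).1 = B.mkQ b →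
            a - b ∈ A := by
        intro A B t t' hh a b ha hb
        cases hh
        rw [ha] at hb
        exact (Submodule.Quotient.eq A).1 hb
      exact h3 _ _ _ _ h _ _ rfl rfl
    refine Subtype.ext (Submodule.ext fun ⟨z, y⟩ => ?_)
    obtain ⟨a, rfl⟩ : ∃ a : Fin s → ℤ_[p], ∑ i, a i • e i = y := by
      choose a ha using fun i => (powIdeal p 1).mkQ_surjective (y i)
      refine ⟨a, ?_⟩
      ext j
      rw [Finset.sum_apply, ← ha j]
      simp only [e, Pi.smul_apply, Pi.single_apply, smul_ite, smul_zero]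
      rw [Finset.sum_ite_eq]
      simp only [Finset.mem_univ, if_true]
      change a j • (powIdeal p 1).mkQ 1 = _
      rw [← map_smul, smul_eq_mul, mul_one]
    rw [hmem, hmem, ← h1]
    have h3 : ∑ i, a i • x S i - ∑ i, a i • x S' i ∈
        S.1.comap (LinearMap.inl ℤ_[p] M (Fin s → Res p)) := by
      rw [← Finset.sum_sub_distrib]
      refine Submodule.sum_mem _ fun i _ => ?_
      rw [← smul_sub]
      exact Submodule.smul_mem _ _ (h2 i)
    rw [← Submodule.add_mem_iff_left _ h3]
    simp
  have hT : ∀ M₀ : Submodule ℤ_[p] M, Nat.card (T M₀) ≤ (p ^ pRank p M) ^ s := by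
    intro M₀
    rw [Nat.card_fun, Nat.card_fin, card_pTorsion]
    gcongr
    · exact (Fact.out : p.Prime).pos
    · exact pRank_le_of_surjective M₀.mkQ M₀.mkQ_surjective
  have : ∀ M₀, Finite (T M₀) := fun M₀ => inferInstanceAs (Finite (Fin s → _))
  refine (Nat.card_le_card_of_injective F hF).trans ?_
  have := Fintype.ofFinite (Submodule ℤ_[p] M)
  rw [Nat.card_sigma, Nat.card_eq_fintype_card, ← Finset.card_univ, ← smul_eq_mul,
    ← Finset.sum_const]
  exact Finset.sum_le_sum fun M₀ _ => hT M₀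

variable (p) in
theorem c0_le_prod (s : ℕ) : c0 p ≤ ∏ i ∈ Finset.range s, (1 - 1 / (p : ℝ) ^ (i + 1)) := by
  have hp1 : (1 : ℝ) < p := by exact_mod_cast (Fact.out : p.Prime).one_lt
  have h0 : ∀ i : ℕ, 1 / (p : ℝ) ^ (i + 1) ≤ 1 := fun i => by
    rw [div_le_one (by positivity)]
    exact one_le_pow₀ hp1.le
  refine Antitone.le_of_tendsto (antitone_nat_of_succ_le fun n => ?_) (tendsto_prod_c0 p) s
  rw [Finset.prod_range_succ]
  refine mul_le_of_le_one_right (Finset.prod_nonneg fun i _ => by linarith [h0 i]) ?_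
  have : 0 ≤ 1 / (p : ℝ) ^ (n + 1) := by positivity
  linarith

/-- A module of rank `s` has at least `c₀ p ^ (s ^ 2)` surjections to `𝔽_p ^ s`, because
`GL_s(𝔽_p)` acts freely on them. -/
theorem c0_mul_le_numSur (s : ℕ) (h : pRank p M = s) :
    c0 p * (p : ℝ) ^ (s * s) ≤ numSur p M (Fin s → Res p) := by
  classical
  subst h
  set s := pRank p M
  have hp1 : (1 : ℝ) < p := by exact_mod_cast (Fact.out : p.Prime).one_lt
  have : Fintype (Res p) := Fintype.ofFinite _
  obtain ⟨e⟩ := nonempty_reduct_equiv (p := p) (M := M)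
  have h1 : Nat.card (GL (Fin s) (Res p)) ≤ numSur p M (Fin s → Res p) := by
    let q : M →ₗ[ℤ_[p]] (Fin s → Res p) := e.toLinearMap.restrictScalars ℤ_[p] ∘ₗ Submodule.mkQ _
    have hq : Function.Surjective q := e.surjective.comp (Submodule.mkQ_surjective _)
    refine Nat.card_le_card_of_injective (fun g : GL (Fin s) (Res p) =>
      (⟨(Matrix.toLin' g.1).restrictScalars ℤ_[p] ∘ₗ q, ?_⟩ :
        {f : M →ₗ[ℤ_[p]] (Fin s → Res p) // Function.Surjective f})) ?_
    · have hg : Function.Surjective (Matrix.toLin' g.1) := fun y => ⟨Matrix.toLin' g.2 y, by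
        rw [← Matrix.toLin'_mul_apply, g.3, Matrix.toLin'_one, LinearMap.id_apply]⟩
      exact hg.comp hq
    · intro g g' hg
      have h2 := (LinearMap.cancel_right hq).1 (congrArg Subtype.val hg)
      exact Units.ext (Matrix.toLin'.injective (LinearMap.restrictScalars_injective ℤ_[p] h2))
  refine le_trans ?_ (Nat.cast_le.2 h1)
  rw [Matrix.card_GL_field, ← Nat.card_eq_fintype_card, card_res, Nat.cast_prod]
  have h2 : ∀ i : Fin s, (((p ^ s - p ^ (i : ℕ) : ℕ)) : ℝ) =
      (p : ℝ) ^ s * (1 - 1 / (p : ℝ) ^ ((s - 1 - i : ℕ) + 1)) := by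
    intro i
    rw [Nat.cast_sub (Nat.pow_le_pow_right (Fact.out : p.Prime).pos i.2.le), mul_sub, mul_one]
    push_cast
    congr 1
    have : s = (i : ℕ) + ((s - 1 - i : ℕ) + 1) := by omega
    rw [mul_one_div, eq_div_iff (by positivity), ← pow_add, ← this]
  rw [Finset.prod_congr rfl fun i _ => h2 i, Finset.prod_mul_distrib, Finset.prod_const,
    Finset.card_univ, Fintype.card_fin, ← pow_mul, mul_comm]
  gcongr
  refine (c0_le_prod p s).trans (le_of_eq ?_)
  rw [Finset.prod_range fun i => 1 - 1 / (p : ℝ) ^ (i + 1)]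
  refine Fintype.prod_equiv Fin.revPerm _ _ fun i => ?_
  congr 4
  simp only [Fin.revPerm_apply, Fin.val_rev]
  omega

end Rank

/-! ### Measures of rapid decay are determined by their surjection moments -/

section Uniqueness

variable {p : ℕ} [Fact p.Prime]

theorem one_lt_sqrt_prime : 1 < √(p : ℝ) := by
  rw [Real.lt_sqrt (by norm_num)]
  exact_mod_cast (by simpa using (Fact.out : p.Prime).one_lt)

theorem hasSum_mul_eval {b : ℕ → ℝ} {x : ℕ → ℝ} (h : ∀ i : ℕ, HasSum (fun j => b j * x j ^ i) 0)
    (P : Polynomial ℝ) : HasSum (fun j => b j * P.eval (x j)) 0 := by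
  induction P using Polynomial.induction_on' with
  | add P Q hP hQ => simpa only [Polynomial.eval_add, mul_add, add_zero] using hP.add hQ
  | monomial n c =>
    have := (h n).mul_left c
    rw [mul_zero] at this
    refine this.congr_fun ?_
    intro j
    rw [Polynomial.eval_monomial]
    ring

theorem prod_pow_mul_pow (t : ℝ) (n k : ℕ) :
    (∏ i ∈ Finset.range n, (t ^ 2) ^ (k + i)) * t ^ (k * k + n) = t ^ ((n + k) * (n + k)) := by
  induction n with
  | zero => simp
  | succ n ih =>
    have h1 : t ^ (k * k + (n + 1)) = t ^ (k * k + n) * t := by rw [← add_assoc, pow_succ]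
    have h2 : t ^ ((n + 1 + k) * (n + 1 + k)) =
        t ^ ((n + k) * (n + k)) * t * (t ^ 2) ^ (k + n) := by
      rw [← pow_mul, ← pow_succ, ← pow_add]
      congr 1
      ring
    rw [Finset.prod_range_succ, h1, h2, ← ih]
    ring

/-- A sequence `b` of Gaussian decay is tested against the polynomials `∏ (1 - X / p ^ (i + 1))`,
which vanish at `p, …, p ^ n`. Their values at `1` stay above `c₀`, and the tail of the test sums
tends to `0`. -/
theorem eq_zero_of_hasSum_pow {b : ℕ → ℝ} {C : ℝ}
    (hb : ∀ j, |b j| ≤ C / √(p : ℝ) ^ (j * j))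
    (h : ∀ i : ℕ, HasSum (fun j => b j * ((p : ℝ) ^ j) ^ i) 0) : b 0 = 0 := by
  set t := √(p : ℝ) with ht
  have ht1 : 1 < t := one_lt_sqrt_prime
  have ht0 : 0 < t := by linarith
  have ht2 : t ^ 2 = p := Real.sq_sqrt (Nat.cast_nonneg _)
  have hC : 0 ≤ C := by simpa using (abs_nonneg _).trans (hb 0)
  have hp1 : (1 : ℝ) < p := by exact_mod_cast (Fact.out : p.Prime).one_lt
  have hp0 : (0 : ℝ) < p := by linarith
  let u : ℕ → Polynomial ℝ := fun n =>
    ∏ i ∈ Finset.range n, (1 - Polynomial.C (1 / (p : ℝ) ^ (i + 1)) * Polynomial.X)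
  have hu : ∀ n x, (u n).eval x = ∏ i ∈ Finset.range n, (1 - 1 / (p : ℝ) ^ (i + 1) * x) := by
    intro n x
    simp [u, Polynomial.eval_prod]
  have htail : ∀ n k, |b (k + n) * (u n).eval ((p : ℝ) ^ (k + n))| ≤ C * t⁻¹ ^ n * t⁻¹ ^ k := by
    intro n k
    have h1 : |(u n).eval ((p : ℝ) ^ (k + n))| ≤ ∏ i ∈ Finset.range n, (t ^ 2) ^ (k + i) := by
      rw [hu, Finset.abs_prod, ← Finset.prod_range_reflect (fun i => (t ^ 2) ^ (k + i))]
      refine Finset.prod_le_prod (fun _ _ => abs_nonneg _) fun i hi => ?_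
      rw [Finset.mem_range] at hi
      have h2 : 1 / (p : ℝ) ^ (i + 1) * (p : ℝ) ^ (k + n) = (p : ℝ) ^ (k + (n - 1 - i)) := by
        rw [one_div, inv_mul_eq_div, div_eq_iff (by positivity), ← pow_add]
        congr 1
        omega
      rw [h2, ht2, abs_sub_comm, abs_of_nonneg (sub_nonneg.2 (one_le_pow₀ hp1.le))]
      linarith
    have h3 : t⁻¹ ^ (k * k) ≤ t⁻¹ ^ k :=
      pow_le_pow_of_le_one (by positivity) (inv_le_one_of_one_le₀ ht1.le) (Nat.le_mul_self k)
    rw [abs_mul]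
    calc |b (k + n)| * |(u n).eval ((p : ℝ) ^ (k + n))|
        ≤ C / t ^ ((k + n) * (k + n)) * ∏ i ∈ Finset.range n, (t ^ 2) ^ (k + i) := by
          gcongr
          exact hb _
      _ = C * t⁻¹ ^ n * t⁻¹ ^ (k * k) := by
          rw [add_comm k n, ← prod_pow_mul_pow t n k, inv_pow, inv_pow, pow_add]
          have : ∏ i ∈ Finset.range n, (t ^ 2) ^ (k + i) ≠ 0 :=
            Finset.prod_ne_zero_iff.2 fun i _ => by positivity
          field_simp
      _ ≤ _ := by gcongr
  have hinv : t⁻¹ < 1 := inv_lt_one_of_one_lt₀ ht1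
  have hgeo := hasSum_geometric_of_lt_one (inv_nonneg.2 ht0.le) hinv
  have hmain : ∀ n, c0 p * |b 0| ≤ C * t⁻¹ ^ (n + 1) * (1 - t⁻¹)⁻¹ := by
    intro n
    have hs := hasSum_mul_eval h (u (n + 1))
    have h1 := hs.summable.sum_add_tsum_nat_add (n + 1)
    have h2 : ∀ j ∈ Finset.range (n + 1), j ≠ 0 → b j * (u (n + 1)).eval ((p : ℝ) ^ j) = 0 := by
      intro j hj hj0
      rw [hu, Finset.prod_eq_zero (i := j - 1), mul_zero]
      · rw [Finset.mem_range] at hj ⊢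
        omega
      · rw [Nat.sub_add_cancel (by omega), one_div_mul_cancel (by positivity), sub_self]
    rw [Finset.sum_eq_single_of_mem 0 (by simp) h2, hs.tsum_eq, pow_zero] at h1
    have h3 : ‖∑' k, b (k + (n + 1)) * (u (n + 1)).eval ((p : ℝ) ^ (k + (n + 1)))‖ ≤
        C * t⁻¹ ^ (n + 1) * (1 - t⁻¹)⁻¹ :=
      tsum_of_norm_bounded (hgeo.mul_left _) fun k => htail (n + 1) k
    rw [← neg_eq_of_add_eq_zero_right h1, norm_neg, norm_mul, Real.norm_eq_abs, Real.norm_eq_abs] at h3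
    refine le_trans ?_ h3
    rw [mul_comm]
    gcongr
    refine (c0_le_prod p (n + 1)).trans ?_
    rw [hu]
    simp only [mul_one]
    exact le_abs_self _
  have hlim : Tendsto (fun n => C * t⁻¹ ^ (n + 1) * (1 - t⁻¹)⁻¹) atTop (𝓝 (C * 0 * (1 - t⁻¹)⁻¹)) :=
    (((tendsto_pow_atTop_nhds_zero_of_lt_one (inv_nonneg.2 ht0.le) hinv).comp
      (tendsto_add_atTop_nat 1)).const_mul C).mul_const _
  have h0 := ge_of_tendsto' hlim hmain
  rw [mul_zero, zero_mul] at h0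
  have := nonpos_of_mul_nonpos_right h0 (c0_pos p)
  exact abs_eq_zero.1 (le_antisymm this (abs_nonneg _))

/-- The `p`-rank of an isomorphism class. -/
noncomputable def X0.rank (G : X0 p) : ℕ := pRank p G.grp

/-- All surjection moments of `η` converge absolutely and are zero. -/
def VanishingMoments (η : X0 p → ℝ) : Prop :=
  ∀ F : X0 p, HasSum (fun G : X0 p => η G * cardSur G F) 0

/-- The groups of rank `s` contribute at most about `p ^ (r s - s ^ 2 / 2)` to the surjection moment
of a group of rank `r`. -/
def RapidDecay (η : X0 p → ℝ) : Prop :=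
  ∀ B : X0 p, ∃ C : ℝ, ∀ s : ℕ, ∑' G : (X0.rank (p := p)) ⁻¹' {s}, |η G * cardSur G B| ≤
    C * (√(p : ℝ) ^ (2 * B.rank * s) / √(p : ℝ) ^ (s * s))

theorem card_hom_eq_sum (G F : Type) [AddCommGroup G] [Module ℤ_[p] G] [Module.Finite ℤ_[p] G]
    [AddCommGroup F] [Module ℤ_[p] F] [Finite F]
    (P : Submodule ℤ_[p] F → Prop) [Fintype {S // P S}] :
    Nat.card {θ : G →ₗ[ℤ_[p]] F // P (LinearMap.range θ)} =
      ∑ S : {S // P S}, numSur p G S.1 := by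
  have := card_range_eq_tsum (p := p) (F := F) G P
  rw [tsum_fintype] at this
  exact_mod_cast this

theorem VanishingMoments.hasSum_numSur {η : X0 p → ℝ} (h : VanishingMoments η) (F : Type)
    [AddCommGroup F] [Module ℤ_[p] F] [Finite F] :
    HasSum (fun G : X0 p => η G * numSur p G.grp F) 0 := by
  obtain ⟨e⟩ := nonempty_isoClass_grp_equiv (p := p) F
  refine (h (isoClass p F)).congr_fun ?_
  intro G
  rw [cardSur_eq, numSur_congr (LinearEquiv.refl _ _) e]

theorem VanishingMoments.hasSum_range {η : X0 p → ℝ} (h : VanishingMoments η) (F : Type)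
    [AddCommGroup F] [Module ℤ_[p] F] [Finite F] (P : Submodule ℤ_[p] F → Prop) :
    HasSum (fun G : X0 p => η G * Nat.card {θ : G.grp →ₗ[ℤ_[p]] F // P (LinearMap.range θ)}) 0 := by
  have := Fintype.ofFinite {S // P S}
  have h1 := hasSum_sum (s := Finset.univ) fun (S : {S // P S}) _ => h.hasSum_numSur S.1
  rw [Finset.sum_const_zero] at h1
  refine h1.congr_fun ?_
  intro G
  rw [card_hom_eq_sum, Nat.cast_sum, Finset.mul_sum]

/-- Pairs of a map to `M` and a map to `N`, one of them surjective, are maps to `M × N` with a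
condition on the range. -/
theorem card_hom_mul_numSur (G M N : Type) [AddCommGroup G] [Module ℤ_[p] G]
    [AddCommGroup M] [Module ℤ_[p] M] [AddCommGroup N] [Module ℤ_[p] N] :
    Nat.card {θ : G →ₗ[ℤ_[p]] M × N // (LinearMap.range θ).map (LinearMap.snd ℤ_[p] M N) = ⊤} =
      Nat.card (G →ₗ[ℤ_[p]] M) * numSur p G N := by
  rw [numSur, ← Nat.card_prod]
  refine Nat.card_congr
    { toFun := fun θ => (LinearMap.fst _ _ _ ∘ₗ θ.1, ⟨LinearMap.snd _ _ _ ∘ₗ θ.1, ?_⟩)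
      invFun := fun x => ⟨x.1.prod x.2.1, ?_⟩
      left_inv := fun θ => rfl
      right_inv := fun x => rfl }
  · rw [← LinearMap.range_eq_top, LinearMap.range_comp]
    exact θ.2
  · rw [← LinearMap.range_comp, LinearMap.snd_prod]
    exact LinearMap.range_eq_top.2 x.2.2

theorem VanishingMoments.hasSum_pow {η : X0 p → ℝ} (h : VanishingMoments η) (B : X0 p) (i : ℕ) :
    HasSum (fun G : X0 p => η G * cardSur G B * ((p : ℝ) ^ G.rank) ^ i) 0 := by
  refine (h.hasSum_range ((Fin i → Res p) × B.grp)
    (fun S => S.map (LinearMap.snd ℤ_[p] _ _) = ⊤)).congr_fun ?_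
  intro G
  rw [card_hom_mul_numSur, card_hom_fin_res, cardSur_eq, X0.rank]
  push_cast
  ring

theorem cardSur_eq_zero_of_rank_lt {G B : X0 p} (h : G.rank < B.rank) : cardSur G B = 0 := by
  rw [cardSur, Nat.card_eq_zero]
  exact Or.inl ⟨fun f => absurd (pRank_le_of_surjective f.1 f.2) (not_le.2 h)⟩

/-- The groups of the same rank as `B` have a vanishing `B`-moment by themselves. -/
theorem VanishingMoments.tsum_rank_eq {η : X0 p → ℝ} (h : VanishingMoments η) (hd : RapidDecay η)
    (B : X0 p) : ∑' G : (X0.rank (p := p)) ⁻¹' {B.rank}, η G * cardSur (G : X0 p) B = 0 := by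
  let a : ℕ → ℝ := fun s => ∑' G : (X0.rank (p := p)) ⁻¹' {s}, η G * cardSur (G : X0 p) B
  obtain ⟨C, hC⟩ := hd B
  set r := B.rank with hr
  have ha0 : ∀ s < r, a s = 0 := by
    intro s hs
    refine (tsum_congr fun G => ?_).trans tsum_zero
    rw [cardSur_eq_zero_of_rank_lt (by rw [show X0.rank G.1 = s from G.2]; exact hs), Nat.cast_zero,
      mul_zero]
  have ha : ∀ i : ℕ, HasSum (fun s => a s * ((p : ℝ) ^ s) ^ i) 0 := by
    intro i
    refine ((h.hasSum_pow B i).tsum_fiberwise X0.rank).congr_fun ?_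
    intro s
    rw [← tsum_mul_right]
    refine tsum_congr fun G => ?_
    rw [show X0.rank G.1 = s from G.2]
  have ht0 : 0 < √(p : ℝ) := by linarith [one_lt_sqrt_prime (p := p)]
  have hp0 : (p : ℝ) ≠ 0 := Nat.cast_ne_zero.2 (Fact.out : p.Prime).ne_zero
  have hb := eq_zero_of_hasSum_pow (p := p) (b := fun j => a (j + r))
    (C := C * √(p : ℝ) ^ (r * r)) (fun j => ?_) (fun i => ?_)
  · simpa using hb
  · have h1 : |a (j + r)| ≤ _ := norm_tsum_le_tsum_norm
      ((h B).summable.norm.subtype (X0.rank ⁻¹' {j + r})) |>.trans (hC (j + r))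
    refine h1.trans (le_of_eq ?_)
    rw [mul_div_assoc]
    congr 1
    rw [div_eq_div_iff (by positivity) (by positivity), ← pow_add, ← pow_add]
    congr 1
    ring
  · have h1 := (hasSum_nat_add_iff' r).2 (ha i)
    rw [Finset.sum_eq_zero fun s hs => by rw [ha0 s (Finset.mem_range.1 hs), zero_mul],
      sub_zero] at h1
    have h2 := h1.mul_right ((((p : ℝ) ^ r) ^ i)⁻¹)
    rw [zero_mul] at h2
    refine h2.congr_fun ?_
    intro j
    rw [pow_add (p : ℝ), mul_pow]
    field_simp

end Uniqueness

/-! ### Separating groups of the same rank by their reductions -/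

section Separation

variable {p : ℕ} [Fact p.Prime]

variable {M N : Type} [AddCommGroup M] [Module ℤ_[p] M] [AddCommGroup N] [Module ℤ_[p] N]

theorem powIdeal_smul_le_range {n : ℕ} (f : M →ₗ[ℤ_[p]] N) (hf : Function.Surjective f)
    (h : powIdeal p n • (⊤ : Submodule ℤ_[p] M) = ⊥) :
    powIdeal p n • (⊤ : Submodule ℤ_[p] N) = ⊥ := by
  rw [← LinearMap.range_eq_top.2 hf, LinearMap.range_eq_map, ← Submodule.map_smul'', h,
    Submodule.map_bot]

theorem powIdeal_add (m n : ℕ) : powIdeal p (m + n) = powIdeal p m * powIdeal p n := by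
  rw [powIdeal, powIdeal, powIdeal, Ideal.span_singleton_mul_span_singleton, pow_add]

theorem card_le_of_powIdeal_smul_eq_bot (n : ℕ) :
    ∀ (M : Type) [AddCommGroup M] [Module ℤ_[p] M] [Finite M],
      powIdeal p n • (⊤ : Submodule ℤ_[p] M) = ⊥ → Nat.card M ≤ p ^ (n * pRank p M) := by
  induction n with
  | zero =>
    intro M _ _ _ h
    rw [powIdeal, pow_zero, Ideal.span_singleton_one, Submodule.top_smul] at h
    have : Subsingleton M := Submodule.subsingleton_iff ℤ_[p] |>.1 (subsingleton_of_bot_eq_top h.symm)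
    rw [Nat.card_unique, zero_mul, pow_zero]
  | succ n ih =>
    intro M _ _ _ h
    set N : Submodule ℤ_[p] M := powIdeal p 1 • ⊤ with hN
    let f : M →ₗ[ℤ_[p]] N := (LinearMap.lsmul ℤ_[p] M (p : ℤ_[p])).codRestrict N fun x =>
      Submodule.smul_mem_smul (by rw [powIdeal, pow_one]; exact Ideal.mem_span_singleton_self _)
        trivial
    have hf : Function.Surjective f := by
      rintro ⟨y, hy⟩
      rw [hN, powIdeal, pow_one, Submodule.ideal_span_singleton_smul,
        Submodule.mem_smul_pointwise_iff_exists] at hy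
      obtain ⟨x, -, hx⟩ := hy
      exact ⟨x, Subtype.ext hx⟩
    have h1 : powIdeal p n • (⊤ : Submodule ℤ_[p] N) = ⊥ := by
      apply Submodule.map_injective_of_injective N.injective_subtype
      rw [Submodule.map_smul'', Submodule.map_top, Submodule.range_subtype, Submodule.map_bot, hN,
        ← Submodule.mul_smul, ← powIdeal_add, h]
    have h2 := ih N h1
    rw [card_eq_card_quotient_mul_card N]
    have h3 : Nat.card (M ⧸ N) = p ^ pRank p M := card_reduct
    rw [h3, add_mul, one_mul, add_comm, pow_add]
    gcongr
    refine h2.trans ?_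
    gcongr
    · exact (Fact.out : p.Prime).pos
    · exact pRank_le_of_surjective f hf

theorem powIdeal_smul_of_le {m n : ℕ} (hmn : m ≤ n)
    (h : powIdeal p m • (⊤ : Submodule ℤ_[p] M) = ⊥) :
    powIdeal p n • (⊤ : Submodule ℤ_[p] M) = ⊥ := by
  obtain ⟨k, rfl⟩ := Nat.exists_eq_add_of_le hmn
  rw [add_comm, powIdeal_add, Submodule.mul_smul, h, Submodule.smul_bot]

theorem powIdeal_anti {m n : ℕ} (hmn : m ≤ n) : powIdeal p n ≤ powIdeal p m :=
  Ideal.span_singleton_le_span_singleton.2 (pow_dvd_pow _ hmn)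

theorem exists_powIdeal_smul_eq_bot (M : Type) [AddCommGroup M] [Module ℤ_[p] M] [Finite M] :
    ∃ n : ℕ, powIdeal p n • (⊤ : Submodule ℤ_[p] M) = ⊥ := by
  refine ⟨Nat.card M, ?_⟩
  rw [eq_bot_iff, Submodule.smul_le]
  intro r hr x _
  obtain ⟨n, hn⟩ := exists_ker_toSpanSingleton_eq (p := p) x
  have h3 : Nat.card (Submodule.span ℤ_[p] {x}) ≤ Nat.card M :=
    Nat.card_le_card_of_injective _ Subtype.val_injective
  rw [card_span_of_ker_eq hn] at h3
  have h4 := powIdeal_anti ((Nat.lt_pow_self (Fact.out : p.Prime).one_lt).le.trans h3) hr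
  rw [← hn, LinearMap.mem_ker, LinearMap.toSpanSingleton_apply] at h4
  exact (Submodule.mem_bot _).2 h4

variable [Finite M] [Finite N]

theorem pRank_reduct {n : ℕ} (hn : n ≠ 0) : pRank p (Reduct p n M) = pRank p M := by
  have h0 : powIdeal p 1 • (⊤ : Submodule ℤ_[p] (Fin 1 → Res p)) = ⊥ := res_smul_top 1
  have h := Nat.card_congr (homReductEquiv (M := M) n
    (powIdeal_smul_of_le (Nat.one_le_iff_ne_zero.2 hn) h0))
  rw [card_hom_fin_res, card_hom_fin_res, pow_one, pow_one] at h
  exact (Nat.pow_right_injective (Fact.out : p.Prime).two_le h).symm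

theorem smul_eq_bot_of_reduct {n : ℕ}
    (h : powIdeal p n • (⊤ : Submodule ℤ_[p] (Reduct p (n + 1) M)) = ⊥) :
    powIdeal p n • (⊤ : Submodule ℤ_[p] M) = ⊥ := by
  have h1 : powIdeal p n • (⊤ : Submodule ℤ_[p] M) ≤ powIdeal p (n + 1) • ⊤ := by
    have h2 := powIdeal_smul_top_le_ker
      ((powIdeal p n • (⊤ : Submodule ℤ_[p] (Reduct p (n + 1) M))).mkQ ∘ₗ
        (powIdeal p (n + 1) • (⊤ : Submodule ℤ_[p] M)).mkQ) (reduct_smul_top n)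
    rw [h] at h2
    intro x hx
    have h3 := h2 hx
    rw [LinearMap.mem_ker, LinearMap.comp_apply, Submodule.mkQ_apply,
      Submodule.Quotient.mk_eq_zero, Submodule.mem_bot, Submodule.mkQ_apply,
      Submodule.Quotient.mk_eq_zero] at h3
    exact h3
  refine Submodule.eq_bot_of_le_smul_of_le_jacobson_bot (powIdeal p 1) _ (IsNoetherian.noetherian _) ?_ ?_
  · rw [← Submodule.mul_smul, ← powIdeal_add, add_comm]
    exact h1
  · rw [powIdeal, pow_one, ← PadicInt.maximalIdeal_eq_span_p]
    exact IsLocalRing.maximalIdeal_le_jacobson _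

omit [Finite N] in
theorem nonempty_equiv_of_reduct {n : ℕ} (hN : powIdeal p n • (⊤ : Submodule ℤ_[p] N) = ⊥)
    (e : Reduct p (n + 1) M ≃ₗ[ℤ_[p]] N) : Nonempty (M ≃ₗ[ℤ_[p]] N) := by
  have h1 := smul_eq_bot_of_reduct (powIdeal_smul_le_range e.symm.toLinearMap e.symm.surjective hN)
  have h2 := powIdeal_smul_of_le n.le_succ h1
  exact ⟨(Submodule.quotEquivOfEqBot _ h2).symm ≪≫ₗ e⟩

/-- The groups of rank `r` with given reduction modulo `p ^ n` have total mass zero, by downward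
induction on the order of the reduction. -/
theorem VanishingMoments.tsum_reduct_eq {η : X0 p → ℝ} (h : VanishingMoments η) (hd : RapidDecay η)
    {r n : ℕ} (hn : n ≠ 0) (Y : X0 p) :
    ∑' G : (fun G : (X0.rank (p := p)) ⁻¹' {r} => isoClass p (Reduct p n G.1.grp)) ⁻¹' {Y},
      η G.1 = 0 := by
  set c : (X0.rank (p := p)) ⁻¹' {r} → X0 p := fun G => isoClass p (Reduct p n G.1.grp) with hc
  induction hk : p ^ (n * r) - Nat.card Y.grp using Nat.strong_induction_on generalizing Y with
  | _ k ih =>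
  have hY : ∀ Y', c ⁻¹' {Y'} = ∅ → ∑' G : c ⁻¹' {Y'}, η G.1 = 0 := by
    intro Y' hY'
    have : IsEmpty (c ⁻¹' {Y'}) := Set.isEmpty_coe_sort.2 hY'
    exact tsum_empty
  have hprop : ∀ Y', (c ⁻¹' {Y'}).Nonempty → Y'.rank = r ∧
      powIdeal p n • (⊤ : Submodule ℤ_[p] Y'.grp) = ⊥ := by
    rintro Y' ⟨G, hG⟩
    obtain ⟨e⟩ : Nonempty (Reduct p n G.1.grp ≃ₗ[ℤ_[p]] Y'.grp) :=
      isoClass_eq_iff.1 (hG.trans (isoClass_grp Y').symm)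
    refine ⟨?_, powIdeal_smul_le_range e.toLinearMap e.surjective (reduct_smul_top n)⟩
    rw [X0.rank, ← pRank_congr e, pRank_reduct hn]
    exact G.2
  have hcard : ∀ Y', (c ⁻¹' {Y'}).Nonempty → Nat.card Y'.grp ≤ p ^ (n * r) := fun Y' hY' => by
    rw [← (hprop Y' hY').1]
    exact card_le_of_powIdeal_smul_eq_bot n _ (hprop Y' hY').2
  rcases (c ⁻¹' {Y}).eq_empty_or_nonempty with hYe | hYn
  · exact hY Y hYe
  have h0 := (((h Y).summable.subtype ((X0.rank (p := p)) ⁻¹' {r})).hasSum.tsum_fiberwise c).tsum_eq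
  have h1 : ∑' G : (X0.rank (p := p)) ⁻¹' {r}, η G * cardSur (G : X0 p) Y = 0 := by
    rw [← (hprop Y hYn).1]
    exact h.tsum_rank_eq hd Y
  have h2 : ∀ Y', ∑' G : c ⁻¹' {Y'}, η G.1 * cardSur (G.1 : X0 p) Y =
      (∑' G : c ⁻¹' {Y'}, η G.1) * cardSur Y' Y := by
    intro Y'
    rw [← tsum_mul_right]
    refine tsum_congr fun G => ?_
    have h3 : cardSur (G.1 : X0 p) Y = cardSur Y' Y := by
      have h5 : c G.1 = Y' := G.2
      have h6 := cardSur_isoClass (p := p) (Reduct p n G.1.1.grp) Y.grp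
      rw [isoClass_grp, numSur_reduct n (hprop Y hYn).2] at h6
      exact h6.symm.trans (congrArg (cardSur · Y) h5)
    rw [h3]
  have h4 : ∑' Y', (∑' G : c ⁻¹' {Y'}, η G.1) * cardSur Y' Y = 0 := by
    exact (tsum_congr h2).symm.trans (h0.trans h1)
  rw [tsum_eq_single Y] at h4
  · refine (mul_eq_zero.1 h4).resolve_right ?_
    rw [cardSur_self]
    exact cardAut_ne_zero Y
  · intro Y' hne
    rcases (c ⁻¹' {Y'}).eq_empty_or_nonempty with hYe | hYn'
    · rw [hY Y' hYe, zero_mul]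
    by_cases hs : cardSur Y' Y = 0
    · rw [hs, Nat.cast_zero, mul_zero]
    have h5 := card_grp_lt_of_cardSur_ne_zero hs hne.symm
    have h6 := hcard Y' hYn'
    rw [ih _ (by omega) Y' rfl, zero_mul]

/-- A signed measure of rapid decay with vanishing surjection moments is zero. -/
theorem VanishingMoments.eq_zero {η : X0 p → ℝ} (h : VanishingMoments η) (hd : RapidDecay η)
    (A : X0 p) : η A = 0 := by
  obtain ⟨n, hn⟩ := exists_powIdeal_smul_eq_bot (p := p) A.grp
  have h1 := h.tsum_reduct_eq hd (r := A.rank) (Nat.succ_ne_zero n) A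
  have hA : powIdeal p (n + 1) • (⊤ : Submodule ℤ_[p] A.grp) = ⊥ :=
    powIdeal_smul_of_le n.le_succ hn
  have hA' : isoClass p (Reduct p (n + 1) A.grp) = A := by
    conv_rhs => rw [← isoClass_grp A]
    exact isoClass_eq_iff.2 ⟨Submodule.quotEquivOfEqBot _ hA⟩
  rw [tsum_eq_single ⟨⟨A, rfl⟩, hA'⟩] at h1
  · exact h1
  · rintro ⟨⟨G, hG⟩, hG'⟩ hne
    refine absurd ?_ hne
    obtain ⟨e⟩ : Nonempty (Reduct p (n + 1) G.grp ≃ₗ[ℤ_[p]] A.grp) :=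
      isoClass_eq_iff.1 (Eq.trans hG' (isoClass_grp A).symm)
    have h2 := isoClass_eq_iff.2 (nonempty_equiv_of_reduct hn e)
    rw [isoClass_grp, isoClass_grp] at h2
    subst h2
    rfl

end Separation

/-! ### Uniqueness of moments for weights and for square-summable measures -/

section Decay

variable {p : ℕ} [Fact p.Prime]

/-- A group of rank `s` has about `p ^ (s ^ 2)` surjections to `𝔽_p ^ s`, so its maps to `M` are
counted by its maps to `M × 𝔽_p ^ s` that are surjective in the second factor. -/
theorem HasMoments.tsum_rank_mul_le {w : X0 p → ℝ≥0∞} {m : ℝ≥0∞} (hw : HasMoments w m) (M : Type)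
    [AddCommGroup M] [Module ℤ_[p] M] [Finite M] (s : ℕ) :
    (∑' G : (X0.rank (p := p)) ⁻¹' {s}, w G * (Nat.card (X0.grp G.1 →ₗ[ℤ_[p]] M) : ℝ≥0∞)) *
      ENNReal.ofReal (c0 p * (p : ℝ) ^ (s * s)) ≤
    (Nat.card (Submodule ℤ_[p] M) * (p ^ pRank p M) ^ s : ℕ) * m := by
  have h1 := hw.tsum_mul_card_range (F := M × (Fin s → Res p))
    (fun S => S.map (LinearMap.snd ℤ_[p] _ _) = ⊤)
  have h2 : (Nat.card {S : Submodule ℤ_[p] (M × (Fin s → Res p)) //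
        S.map (LinearMap.snd ℤ_[p] M (Fin s → Res p)) = ⊤} : ℝ≥0∞) * m ≤
      (Nat.card (Submodule ℤ_[p] M) * (p ^ pRank p M) ^ s : ℕ) * m := by
    gcongr
    exact card_submodule_onto_le s
  refine le_trans ?_ (h1.trans_le h2)
  rw [← ENNReal.tsum_mul_right]
  refine le_trans (ENNReal.tsum_le_tsum fun G => ?_)
    (ENNReal.tsum_comp_le_tsum_of_injective Subtype.val_injective _)
  rw [mul_assoc, card_hom_mul_numSur]
  push_cast
  gcongr
  rw [← ENNReal.ofReal_natCast]
  exact ENNReal.ofReal_le_ofReal (c0_mul_le_numSur s G.2)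

theorem HasMoments.exists_tsum_rank_le {w : X0 p → ℝ≥0∞} {m : ℝ≥0∞} (hw : HasMoments w m)
    (hm : m ≠ ∞) (M : Type) [AddCommGroup M] [Module ℤ_[p] M] [Finite M] :
    ∃ C : ℝ, 0 ≤ C ∧ ∀ s : ℕ,
      Summable (fun G : (X0.rank (p := p)) ⁻¹' {s} =>
        (w G).toReal * Nat.card (X0.grp G.1 →ₗ[ℤ_[p]] M)) ∧
      ∑' G : (X0.rank (p := p)) ⁻¹' {s}, (w G).toReal * Nat.card (X0.grp G.1 →ₗ[ℤ_[p]] M) ≤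
        C * ((p : ℝ) ^ (pRank p M * s) / (p : ℝ) ^ (s * s)) := by
  have hc := c0_pos p
  have hp : (0 : ℝ) < p := Nat.cast_pos.2 (Fact.out : p.Prime).pos
  refine ⟨Nat.card (Submodule ℤ_[p] M) * m.toReal / c0 p, by positivity, fun s => ?_⟩
  have h1 := hw.tsum_rank_mul_le M s
  set S := ∑' G : (X0.rank (p := p)) ⁻¹' {s}, w G * (Nat.card (X0.grp G.1 →ₗ[ℤ_[p]] M) : ℝ≥0∞)
    with hS
  have hpos : 0 < c0 p * (p : ℝ) ^ (s * s) := by positivity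
  have htop : (Nat.card (Submodule ℤ_[p] M) * (p ^ pRank p M) ^ s : ℕ) * m ≠ ∞ :=
    ENNReal.mul_ne_top (ENNReal.natCast_ne_top _) hm
  have hStop : S ≠ ∞ := by
    intro h
    rw [h, ENNReal.top_mul (ENNReal.ofReal_pos.2 hpos).ne'] at h1
    exact htop (top_le_iff.1 h1)
  have hsum := ENNReal.summable_toReal hStop
  have hval := ENNReal.tsum_toReal_eq fun G => ENNReal.ne_top_of_tsum_ne_top hStop G
  simp only [ENNReal.toReal_mul, ENNReal.toReal_natCast] at hsum hval
  refine ⟨hsum, ?_⟩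
  rw [← hval, ← hS]
  have h2 := ENNReal.toReal_mono htop h1
  rw [ENNReal.toReal_mul, ENNReal.toReal_ofReal hpos.le, ENNReal.toReal_mul,
    ENNReal.toReal_natCast] at h2
  rw [← le_div_iff₀ hpos] at h2
  refine h2.trans (le_of_eq ?_)
  push_cast
  rw [← pow_mul]
  field_simp

theorem cardSur_le (G B : X0 p) : cardSur G B ≤ Nat.card (G.grp →ₗ[ℤ_[p]] B.grp) :=
  Nat.card_le_card_of_injective _ Subtype.val_injective

theorem HasMoments.hasSum {w : X0 p → ℝ≥0∞} {m : ℝ≥0∞} (hw : HasMoments w m) (hm : m ≠ ∞)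
    (F : X0 p) : HasSum (fun G : X0 p => (w G).toReal * cardSur G F) m.toReal := by
  have h := hw F
  have h1 := ENNReal.hasSum_toReal (h.trans_ne hm)
  rw [← ENNReal.tsum_toReal_eq fun G => ENNReal.ne_top_of_tsum_ne_top (h.trans_ne hm) G, h] at h1
  simpa only [ENNReal.toReal_mul, ENNReal.toReal_natCast] using h1

theorem HasMoments.ne_top {w : X0 p → ℝ≥0∞} {m : ℝ≥0∞} (hw : HasMoments w m) (hm : m ≠ ∞)
    (G : X0 p) : w G ≠ ∞ := by
  intro h
  have h1 := ENNReal.ne_top_of_tsum_ne_top ((hw G).trans_ne hm) G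
  rw [h, ENNReal.top_mul] at h1
  · exact h1 rfl
  · rw [cardSur_self]
    exact_mod_cast (cardAut_pos G).ne'

/-- Constant surjection moments determine a weight. -/
theorem HasMoments.unique {w w' : X0 p → ℝ≥0∞} {m : ℝ≥0∞} (hw : HasMoments w m)
    (hw' : HasMoments w' m) (hm : m ≠ ∞) (A : X0 p) : w A = w' A := by
  have ht1 := one_lt_sqrt_prime (p := p)
  have hv : VanishingMoments fun G => (w G).toReal - (w' G).toReal := fun F => by
    have := (hw.hasSum hm F).sub (hw'.hasSum hm F)
    rw [sub_self] at this
    exact this.congr_fun fun G => by ring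
  have hd : RapidDecay fun G => (w G).toReal - (w' G).toReal := by
    intro B
    obtain ⟨C, hC, h⟩ := hw.exists_tsum_rank_le hm B.grp
    obtain ⟨C', hC', h'⟩ := hw'.exists_tsum_rank_le hm B.grp
    refine ⟨C + C', fun s => ?_⟩
    refine ((hv B).summable.norm.subtype _).tsum_le_tsum (fun G => ?_) ((h s).1.add (h' s).1) |>.trans ?_
    · have h1 : (cardSur G.1 B : ℝ) ≤ Nat.card (X0.grp G.1 →ₗ[ℤ_[p]] B.grp) :=
        Nat.cast_le.2 (cardSur_le _ _)
      have h2 : |(w G).toReal - (w' G).toReal| ≤ (w G).toReal + (w' G).toReal :=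
        (abs_sub _ _).trans_eq (by rw [abs_of_nonneg ENNReal.toReal_nonneg,
          abs_of_nonneg ENNReal.toReal_nonneg])
      change |((w G).toReal - (w' G).toReal) * cardSur G.1 B| ≤ _
      rw [abs_mul, Nat.abs_cast, ← add_mul]
      gcongr
    · rw [(h s).1.tsum_add (h' s).1, add_mul]
      have h3 : (p : ℝ) ^ (pRank p B.grp * s) / (p : ℝ) ^ (s * s) ≤
          √(p : ℝ) ^ (2 * B.rank * s) / √(p : ℝ) ^ (s * s) := by
        have h4 : (p : ℝ) ^ (pRank p B.grp * s) = √(p : ℝ) ^ (2 * B.rank * s) := by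
          rw [mul_assoc 2, pow_mul √(p : ℝ), Real.sq_sqrt (Nat.cast_nonneg _), X0.rank]
        rw [h4]
        gcongr
        exact Real.sqrt_le_iff.2 ⟨Nat.cast_nonneg _, le_self_pow₀
          (by exact_mod_cast (Fact.out : p.Prime).one_lt.le) two_ne_zero⟩
      exact add_le_add ((h s).2.trans (by gcongr)) ((h' s).2.trans (by gcongr))
  have h := hv.eq_zero hd A
  exact (ENNReal.toReal_eq_toReal_iff' (hw.ne_top hm A) (hw'.ne_top hm A)).1 (sub_eq_zero.1 h)

theorem card_hom_to_prod (G M N : Type) [AddCommGroup G] [Module ℤ_[p] G]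
    [AddCommGroup M] [Module ℤ_[p] M] [AddCommGroup N] [Module ℤ_[p] N] :
    Nat.card (G →ₗ[ℤ_[p]] M × N) = Nat.card (G →ₗ[ℤ_[p]] M) * Nat.card (G →ₗ[ℤ_[p]] N) := by
  rw [← Nat.card_prod]
  exact (Nat.card_congr (LinearMap.prodEquiv ℤ_[p]).toEquiv).symm

/-- The inequality of arithmetic and geometric means with weight `D`. -/
theorem abs_mul_cardSur_le (v D : ℝ) (hD : 0 < D) (G B : X0 p) :
    |v * cardSur G B| ≤ D / 2 * (v ^ 2 / mu0 G) +
      c0 p / (2 * D) * ((wt G).toReal * Nat.card (G.grp →ₗ[ℤ_[p]] B.grp × B.grp)) := by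
  have h1 : (cardSur G B : ℝ) ≤ Nat.card (G.grp →ₗ[ℤ_[p]] B.grp) :=
    Nat.cast_le.2 (cardSur_le _ _)
  have hm := mu0_pos G
  have h2 : c0 p * (wt G).toReal = mu0 G := by rw [wt_toReal, mu0, div_eq_mul_inv]
  rw [abs_mul, Nat.abs_cast, card_hom_to_prod]
  push_cast
  refine (mul_le_mul_of_nonneg_left h1 (abs_nonneg _)).trans ?_
  generalize (Nat.card (G.grp →ₗ[ℤ_[p]] B.grp) : ℝ) = x
  have h3 : D / 2 * (v ^ 2 / mu0 G) + c0 p / (2 * D) * ((wt G).toReal * (x * x)) - |v| * x =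
      (D * |v| - mu0 G * x) ^ 2 / (2 * D * mu0 G) := by
    rw [← h2] at hm ⊢
    rw [← sq_abs v]
    have h4 : c0 p ≠ 0 := (c0_pos p).ne'
    have h5 : (wt G).toReal ≠ 0 := right_ne_zero_of_mul hm.ne'
    field_simp
    ring
  have h6 : 0 ≤ (D * |v| - mu0 G * x) ^ 2 / (2 * D * mu0 G) := by positivity
  linarith

theorem pow_rank_prod_eq (B : X0 p) (s : ℕ) :
    (p : ℝ) ^ (pRank p (B.grp × B.grp) * s) / (p : ℝ) ^ (s * s) =
      (√(p : ℝ) ^ (2 * B.rank * s) / √(p : ℝ) ^ (s * s)) ^ 2 := by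
  have h1 : √(p : ℝ) ^ 2 = p := Real.sq_sqrt (Nat.cast_nonneg _)
  rw [div_pow, pRank_prod, ← pow_mul, ← pow_mul, mul_comm (s * s), pow_mul _ 2 (s * s), h1,
    show 2 * B.rank * s * 2 = 2 * ((B.rank + B.rank) * s) by ring, pow_mul _ 2, h1, X0.rank]

theorem rapidDecay_L2 (ν : L2 p) : RapidDecay (ν : X0 p → ℝ) := by
  intro B
  have ht0 : 0 < √(p : ℝ) := by linarith [one_lt_sqrt_prime (p := p)]
  obtain ⟨C, hC, h⟩ := (hasMoments_wt p).exists_tsum_rank_le mass_ne_top (B.grp × B.grp)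
  refine ⟨(‖ν‖ ^ 2 + c0 p * C) / 2, fun s => ?_⟩
  have h2 := (h s).2
  rw [pow_rank_prod_eq] at h2
  have hD0 : 0 < √(p : ℝ) ^ (2 * B.rank * s) / √(p : ℝ) ^ (s * s) := by positivity
  generalize √(p : ℝ) ^ (2 * B.rank * s) / √(p : ℝ) ^ (s * s) = D at h2 hD0
  have hν : Summable fun G : X0 p => ν G ^ 2 / mu0 G := ν.2
  have hν' : Summable fun G : (X0.rank (p := p)) ⁻¹' {s} => ν G.1 ^ 2 / mu0 G.1 := hν.subtype _
  have hs1 := (hν'.mul_left (D / 2)).add ((h s).1.mul_left (c0 p / (2 * D)))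
  have hs0 : Summable fun G : (X0.rank (p := p)) ⁻¹' {s} => |ν G.1 * cardSur G.1 B| :=
    (summable_mul_cardSur ν B).norm.subtype _
  have hle : ∀ G : (X0.rank (p := p)) ⁻¹' {s}, |ν G.1 * cardSur G.1 B| ≤
      D / 2 * (ν G.1 ^ 2 / mu0 G.1) + c0 p / (2 * D) *
        ((wt G.1).toReal * Nat.card (X0.grp G.1 →ₗ[ℤ_[p]] B.grp × B.grp)) :=
    fun G => abs_mul_cardSur_le (ν G.1) D hD0 G.1 B
  have h0 := hs0.tsum_le_tsum hle hs1
  refine h0.trans ?_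
  rw [(hν'.mul_left (D / 2)).tsum_add ((h s).1.mul_left (c0 p / (2 * D))), tsum_mul_left,
    tsum_mul_left]
  have h1 : ∑' G : (X0.rank (p := p)) ⁻¹' {s}, ν G.1 ^ 2 / mu0 G.1 ≤ ‖ν‖ ^ 2 := by
    rw [norm_sq_def]
    exact hν.tsum_subtype_le (fun G : X0 p => ν G ^ 2 / mu0 G) _
      fun G => div_nonneg (sq_nonneg _) (mu0_pos G).le
  have hc := c0_pos p
  calc _ ≤ D / 2 * ‖ν‖ ^ 2 + c0 p / (2 * D) * (C * D ^ 2) :=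
        add_le_add (mul_le_mul_of_nonneg_left h1 (by positivity))
          (mul_le_mul_of_nonneg_left h2 (by positivity))
    _ = _ := by
        field_simp

/-- A square-summable measure is determined by its surjection moments. -/
theorem eq_zero_of_tsum_mul_cardSur (ν : L2 p) (h : ∀ F : X0 p, ∑' G : X0 p, ν G * cardSur G F = 0) :
    ν = 0 := by
  have hv : VanishingMoments (ν : X0 p → ℝ) := fun F => h F ▸ (summable_mul_cardSur ν F).hasSum
  exact L2.ext fun G => hv.eq_zero (rapidDecay_L2 ν) G

end Decay

/-! ### The random extension `d*` -/

section DStar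

variable {p : ℕ} [Fact p.Prime]

/-- The isomorphism class of a finitely generated `ℤ_[p]`-module of rank one. -/
def rankOneClass (M : Type) [AddCommGroup M] [Module ℤ_[p] M] [Module.Finite ℤ_[p] M]
    (h : Module.finrank ℤ_[p] M = 1) : X1 p :=
  Quotient.mk (RankOneMod.setoid p) { carrier := M, finrank_eq := h }

variable {H Q : Type} [AddCommGroup H] [Module ℤ_[p] H] [AddCommGroup Q] [Module ℤ_[p] Q] [Finite Q]

theorem IsExtension.finite {i : ℤ_[p] →ₗ[ℤ_[p]] H} {π : H →ₗ[ℤ_[p]] Q} (h : IsExtension i π) :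
    Module.Finite ℤ_[p] H := by
  have : Module.Finite ℤ_[p] (LinearMap.ker π) := by
    rw [h.ker_eq_range]
    infer_instance
  have : Module.Finite ℤ_[p] (H ⧸ LinearMap.ker π) :=
    Module.Finite.equiv (π.quotKerEquivOfSurjective h.surj).symm
  exact Module.Finite.of_submodule_quotient (LinearMap.ker π)

theorem IsExtension.finrank_eq {i : ℤ_[p] →ₗ[ℤ_[p]] H} {π : H →ₗ[ℤ_[p]] Q} (h : IsExtension i π) :
    Module.finrank ℤ_[p] H = 1 := by
  have := h.finite
  rw [← Submodule.finrank_quotient_add_finrank (LinearMap.ker π),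
    (π.quotKerEquivOfSurjective h.surj).finrank_eq, finrank_eq_zero_of_finite, h.ker_eq_range,
    ← (LinearEquiv.ofInjective i h.inj).finrank_eq, Module.finrank_self]

/-- For every class `e` there is a unique `H` that is the middle term of an extension in the
class `e`. -/
theorem existsUnique_middle (e : ExtOne ℤ_[p] Q ℤ_[p]) :
    ∃ H : X1 p, (∃ (i : ℤ_[p] →ₗ[ℤ_[p]] H.mod) (π : H.mod →ₗ[ℤ_[p]] Q) (h : IsExtension i π),
        h.extClass = e) ∧
      ∀ H' : X1 p, (∃ (i : ℤ_[p] →ₗ[ℤ_[p]] H'.mod) (π : H'.mod →ₗ[ℤ_[p]] Q) (h : IsExtension i π),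
        h.extClass = e) → H = H' := by
  obtain ⟨H, _, _, i, π, h, he⟩ := exists_extension e
  have := h.finite
  have hH : (rankOneClass H h.finrank_eq).out ≈ ({ carrier := H, finrank_eq := h.finrank_eq } :
    RankOneMod p) := Quotient.mk_out _
  obtain ⟨f⟩ := hH
  let f : (rankOneClass H h.finrank_eq).mod ≃ₗ[ℤ_[p]] H := f
  have h' : IsExtension (f.symm.toLinearMap ∘ₗ i) (π ∘ₗ f.toLinearMap) :=
    ⟨f.symm.injective.comp h.inj, fun x => by
      constructor
      · intro hx
        obtain ⟨k, hk⟩ := (h.exact _).1 hx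
        exact ⟨k, by simp [hk]⟩
      · rintro ⟨k, rfl⟩
        simpa using h.exact.apply_apply_eq_zero k, h.surj.comp f.surjective⟩
  refine ⟨rankOneClass H h.finrank_eq, ⟨_, _, h', ?_⟩, ?_⟩
  · rw [← he]
    refine h'.extClass_eq_of_comp_eq h f.toLinearMap ?_ rfl
    ext
    simp
  · rintro H' ⟨i', π', h'', he'⟩
    obtain ⟨g, -⟩ := h.exists_equiv_of_extClass_eq h'' (he.trans he'.symm)
    refine Eq.trans (Quotient.sound ?_) (Quotient.out_eq H')
    exact ⟨g⟩

/-- The middle term of the extensions of `G` by `ℤ_[p]` in a given class. -/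
noncomputable def middle (G : X0 p) (e : ExtOne ℤ_[p] G.grp ℤ_[p]) : X1 p :=
  (existsUnique_middle e).choose

theorem exists_extension_middle (G : X0 p) (e : ExtOne ℤ_[p] G.grp ℤ_[p]) :
    ∃ (i : ℤ_[p] →ₗ[ℤ_[p]] (middle G e).mod) (π : (middle G e).mod →ₗ[ℤ_[p]] G.grp)
      (h : IsExtension i π), h.extClass = e :=
  (existsUnique_middle e).choose_spec.1

theorem dStarProb_eq (G : X0 p) (H : X1 p) :
    dStarProb G H = (Nat.card {e // middle G e = H} : ℝ) / Nat.card (ExtOne ℤ_[p] G.grp ℤ_[p]) := by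
  unfold dStarProb
  congr 2
  refine Nat.card_congr (Equiv.subtypeEquivRight fun e => ?_)
  constructor
  · rintro ⟨f, g, w, h, rfl⟩
    have h' : IsExtension f.hom g.hom :=
      ⟨(ModuleCat.mono_iff_injective f).1 h.mono_f,
        (ShortComplex.ShortExact.moduleCat_exact_iff_function_exact _).1 h.exact,
        (ModuleCat.epi_iff_surjective g).1 h.epi_g⟩
    exact (existsUnique_middle _).choose_spec.2 H ⟨f.hom, g.hom, h', rfl⟩
  · rintro rfl
    obtain ⟨i, π, h, he⟩ := exists_extension_middle G e
    exact ⟨ModuleCat.ofHom i, ModuleCat.ofHom π, h.ofHom_comp, h.shortExact, he⟩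

theorem tsum_card_fiber_mul {A : Type*} {X : Type*} [Fintype A] (g : A → X) (f : X → ℝ) :
    ∑' x, (Nat.card {a // g a = x} : ℝ) * f x = ∑ a, f (g a) := by
  classical
  have h1 : ∀ x, (Nat.card {a // g a = x} : ℝ) * f x = ∑ a, if g a = x then f x else 0 := by
    intro x
    rw [← Finset.sum_filter, Finset.sum_const, nsmul_eq_mul, Nat.card_eq_fintype_card,
      Fintype.card_subtype]
  have h2 : ∀ a, HasSum (fun x => if g a = x then f x else 0) (f (g a)) := by
    intro a
    convert hasSum_single (f := fun x => if g a = x then f x else 0) (g a) ?_ using 1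
    · rw [if_pos rfl]
    · intro x hx
      rw [if_neg hx.symm]
  simp_rw [h1]
  exact (hasSum_sum fun a _ => h2 a).tsum_eq

theorem tsum_dStarProb_mul (G : X0 p) (f : X1 p → ℝ) [Fintype (ExtOne ℤ_[p] G.grp ℤ_[p])] :
    ∑' H : X1 p, dStarProb G H * f H =
      (∑ e : ExtOne ℤ_[p] G.grp ℤ_[p], f (middle G e)) / Nat.card (ExtOne ℤ_[p] G.grp ℤ_[p]) := by
  simp_rw [dStarProb_eq, div_mul_eq_mul_div]
  rw [tsum_div_const, tsum_card_fiber_mul]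

variable {F : Type} [AddCommGroup F] [Module ℤ_[p] F] [Finite F]

/-- The maps from the middle term of an extension by `ℤ_[p]`, classified by the image `x` of the
generator of `ℤ_[p]`: they exist if and only if the class is killed by `x`, and then two of them
differ by a map from the quotient. -/
theorem IsExtension.card_hom {i : ℤ_[p] →ₗ[ℤ_[p]] H} {π : H →ₗ[ℤ_[p]] Q} (h : IsExtension i π)
    [Fintype F] [DecidablePred fun x : F =>
      ExtOne.map Q (LinearMap.toSpanSingleton ℤ_[p] F x) h.extClass = 0] :
    Nat.card (H →ₗ[ℤ_[p]] F) = ∑ x : F,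
      if ExtOne.map Q (LinearMap.toSpanSingleton ℤ_[p] F x) h.extClass = 0 then
        Nat.card (Q →ₗ[ℤ_[p]] F) else 0 := by
  have := h.finite
  have := finite_linearMap ℤ_[p] H F
  have h1 := natCard_eq_tsum_fiber (fun f : H →ₗ[ℤ_[p]] F => f (i 1))
  rw [tsum_fintype, ← Nat.cast_sum, Nat.cast_inj] at h1
  rw [h1]
  refine Finset.sum_congr rfl fun x _ => ?_
  have h2 : ∀ f : H →ₗ[ℤ_[p]] F, f (i 1) = x ↔ f ∘ₗ i = LinearMap.toSpanSingleton ℤ_[p] F x := by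
    intro f
    constructor
    · intro hf
      ext
      simpa using hf
    · intro hf
      simpa using LinearMap.congr_fun hf 1
  rw [Nat.card_congr (Equiv.subtypeEquivRight h2)]
  split_ifs with hx
  · obtain ⟨f₀, hf₀⟩ := (h.exists_extend_iff _).2 hx
    refine Nat.card_congr (Equiv.ofBijective (fun g : Q →ₗ[ℤ_[p]] F =>
      (⟨f₀ + g ∘ₗ π, ?_⟩ : {f : H →ₗ[ℤ_[p]] F // f ∘ₗ i = _})) ⟨?_, ?_⟩).symm
    · rw [LinearMap.add_comp, LinearMap.comp_assoc, h.comp_eq_zero, LinearMap.comp_zero, add_zero,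
        hf₀]
    · intro g g' hg
      exact (LinearMap.cancel_right h.surj).1 (add_left_cancel (congrArg Subtype.val hg))
    · rintro ⟨f, hf⟩
      obtain ⟨g, hg⟩ := h.exists_descend (f - f₀) (by rw [LinearMap.sub_comp, hf, hf₀, sub_self])
      refine ⟨g, Subtype.ext ?_⟩
      change f₀ + g ∘ₗ π = f
      rw [hg, add_sub_cancel]
  · have : IsEmpty {f : H →ₗ[ℤ_[p]] F // f ∘ₗ i = LinearMap.toSpanSingleton ℤ_[p] F x} :=
      ⟨fun f => hx ((h.exists_extend_iff _).1 ⟨f.1, f.2⟩)⟩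
    exact Nat.card_of_isEmpty

theorem sum_card_hom_middle (G : X0 p) [Fintype (ExtOne ℤ_[p] G.grp ℤ_[p])] [Fintype F] :
    ∑ e : ExtOne ℤ_[p] G.grp ℤ_[p], Nat.card ((middle G e).mod →ₗ[ℤ_[p]] F) =
      (∑ x : F, Nat.card (G.grp →ₗ[ℤ_[p]] F ⧸ Submodule.span ℤ_[p] {x})) *
        Nat.card (ExtOne ℤ_[p] G.grp ℤ_[p]) := by
  classical
  have h1 : ∀ e : ExtOne ℤ_[p] G.grp ℤ_[p], Nat.card ((middle G e).mod →ₗ[ℤ_[p]] F) = ∑ x : F,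
      if ExtOne.map G.grp (LinearMap.toSpanSingleton ℤ_[p] F x) e = 0 then
        Nat.card (G.grp →ₗ[ℤ_[p]] F) else 0 := by
    intro e
    obtain ⟨i, π, h, he⟩ := exists_extension_middle G e
    have h2 := h.card_hom (F := F)
    rwa [he] at h2
  simp_rw [h1]
  rw [Finset.sum_comm, Finset.sum_mul]
  refine Finset.sum_congr rfl fun x _ => ?_
  rw [← ExtOne.card_ker_map_toSpanSingleton (finrank_eq_zero_of_finite G.grp), ← Finset.sum_filter,
    Finset.sum_const, smul_eq_mul, mul_comm]
  congr 1
  rw [← Fintype.card_subtype, ← Nat.card_eq_fintype_card]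
  rfl

end DStar

/-! ### The random quotient `d` -/

section Haar

variable {p : ℕ} [Fact p.Prime]

instance : Countable (X0 p) := by
  have h : ∑' G : X0 p, wt G ≠ ∞ := by
    rw [tsum_wt]
    exact mass_ne_top
  have h1 := Summable.countable_support_ennreal h
  rw [show Function.support (wt (p := p)) = Set.univ from
    Set.eq_univ_of_forall fun G => wt_ne_zero G] at h1
  exact Set.countable_univ_iff.1 h1

variable {M : Type} [AddCommGroup M] [Module ℤ_[p] M] [Module.Finite ℤ_[p] M]

theorem finite_of_smul_eq_zero (r : ℤ_[p]) (hr : r ≠ 0) (h : ∀ x : M, r • x = 0) : Finite M := by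
  obtain ⟨n, hn⟩ := PadicInt.ideal_eq_span_pow_p (p := p) (s := Ideal.span {r})
    (by rwa [Ne, Ideal.span_singleton_eq_bot])
  have hM : Module.IsTorsionBySet ℤ_[p] M (powIdeal p n : Set ℤ_[p]) := by
    have h1 : Module.IsTorsionBySet ℤ_[p] M (Ideal.span {r} : Set ℤ_[p]) :=
      (Module.isTorsionBySet_span_singleton_iff r).2 fun x => h x
    rwa [hn] at h1
  let _ : Module (ℤ_[p] ⧸ powIdeal p n) M := hM.module
  have : IsScalarTower ℤ_[p] (ℤ_[p] ⧸ powIdeal p n) M := hM.isScalarTower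
  have : Module.Finite (ℤ_[p] ⧸ powIdeal p n) M := Module.Finite.of_restrictScalars_finite ℤ_[p] _ _
  exact Module.finite_of_finite (ℤ_[p] ⧸ powIdeal p n)

theorem finite_of_finrank_eq_zero (h : Module.finrank ℤ_[p] M = 0) : Finite M := by
  obtain ⟨r, hr, hr0⟩ := Submodule.annihilator_top_inter_nonZeroDivisors
    (Module.finrank_eq_zero_iff_isTorsion.1 h)
  exact finite_of_smul_eq_zero r (nonZeroDivisors.ne_zero hr0)
    fun x => Submodule.mem_annihilator.1 hr x trivial

instance finite_reduct (n : ℕ) : Finite (Reduct p n M) := by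
  refine finite_of_smul_eq_zero ((p : ℤ_[p]) ^ n)
    (pow_ne_zero _ (Nat.cast_ne_zero.2 (Fact.out : p.Prime).ne_zero)) fun x => ?_
  have h := reduct_smul_top (p := p) (M := M) n
  rw [eq_bot_iff, Submodule.smul_le] at h
  exact (Submodule.mem_bot _).1 (h _ (Ideal.mem_span_singleton_self _) x trivial)

/-- A module of rank one maps onto `ℤ_[p]`. -/
theorem exists_surjective_of_finrank_eq_one (h : Module.finrank ℤ_[p] M = 1) :
    ∃ ψ : M →ₗ[ℤ_[p]] ℤ_[p], Function.Surjective ψ := by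
  let T := Submodule.torsion ℤ_[p] M
  have : Module.Free ℤ_[p] (M ⧸ T) := Module.free_of_finite_type_torsion_free'
  have hT : Module.finrank ℤ_[p] T = 0 :=
    Module.finrank_eq_zero_iff_isTorsion.2 (Submodule.torsion_isTorsion)
  have h1 := Submodule.finrank_quotient_add_finrank T
  rw [hT, add_zero, h] at h1
  have e : (M ⧸ T) ≃ₗ[ℤ_[p]] ℤ_[p] :=
    LinearEquiv.ofFinrankEq _ _ (by rw [h1, Module.finrank_self])
  exact ⟨e.toLinearMap ∘ₗ T.mkQ, e.surjective.comp T.mkQ_surjective⟩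

theorem finite_quotient_span (h : Module.finrank ℤ_[p] M = 1) (ψ : M →ₗ[ℤ_[p]] ℤ_[p]) {x : M}
    (hx : ψ x ≠ 0) : Finite (M ⧸ Submodule.span ℤ_[p] {x}) := by
  refine finite_of_finrank_eq_zero (p := p) ?_
  have h1 := Submodule.finrank_quotient_add_finrank (Submodule.span ℤ_[p] {x})
  have h2 : Module.finrank ℤ_[p] (Submodule.span ℤ_[p] {x}) ≠ 0 := by
    intro h0
    obtain ⟨r, hr⟩ := (Module.finrank_eq_zero_iff_isTorsion.1 h0)
      (x := ⟨x, Submodule.mem_span_singleton_self x⟩)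
    have h3 : (r : ℤ_[p]) • x = 0 := congrArg Subtype.val hr
    have h4 := congrArg ψ h3
    rw [map_smul, map_zero, smul_eq_mul] at h4
    exact (mul_eq_zero.1 h4).elim (nonZeroDivisors.ne_zero r.2) hx
  omega

omit [Module.Finite ℤ_[p] M] in
/-- If `M / x` is finite, then `x` may be changed slightly without changing its span, by
Nakayama's lemma. -/
theorem span_eq_of_sub_mem {n : ℕ} {x y : M}
    (hx : powIdeal p n • (⊤ : Submodule ℤ_[p] M) ≤ Submodule.span ℤ_[p] {x})
    (hxy : x - y ∈ powIdeal p (n + 1) • (⊤ : Submodule ℤ_[p] M)) :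
    Submodule.span ℤ_[p] {x} = Submodule.span ℤ_[p] {y} := by
  have h1 : powIdeal p (n + 1) • (⊤ : Submodule ℤ_[p] M) ≤
      powIdeal p 1 • Submodule.span ℤ_[p] {x} := by
    rw [add_comm, powIdeal_add, Submodule.mul_smul]
    exact Submodule.smul_mono le_rfl hx
  apply le_antisymm
  · refine Submodule.le_of_le_smul_of_le_jacobson_bot (I := powIdeal p 1)
      (Submodule.fg_span_singleton x) ?_ ?_
    · rw [powIdeal, pow_one, ← PadicInt.maximalIdeal_eq_span_p]
      exact IsLocalRing.maximalIdeal_le_jacobson _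
    · rw [Submodule.span_singleton_le_iff_mem]
      have := Submodule.add_mem_sup (Submodule.mem_span_singleton_self (R := ℤ_[p]) y) (h1 hxy)
      rwa [add_sub_cancel] at this
  · rw [Submodule.span_singleton_le_iff_mem]
    have h2 : x - y ∈ Submodule.span ℤ_[p] {x} := Submodule.smul_le_right (h1 hxy)
    have := Submodule.sub_mem _ (Submodule.mem_span_singleton_self x) h2
    rwa [sub_sub_cancel] at this

variable {F : Type} [AddCommGroup F] [Module ℤ_[p] F] [Finite F]

/-- The elements of `M` with quotient isomorphic to `G`. -/
def quotientSet (M : Type) [AddCommGroup M] [Module ℤ_[p] M] (G : X0 p) : Set M :=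
  {h | Nonempty ((M ⧸ Submodule.span ℤ_[p] {h}) ≃ₗ[ℤ_[p]] G.grp)}

omit [Module.Finite ℤ_[p] M] in
theorem disjoint_quotientSet {G G' : X0 p} (h : G ≠ G') :
    Disjoint (quotientSet M G) (quotientSet M G') := by
  rw [Set.disjoint_left]
  rintro x ⟨e⟩ ⟨e'⟩
  refine h ?_
  have := isoClass_eq_iff.2 ⟨e.symm.trans e'⟩
  rwa [isoClass_grp, isoClass_grp] at this

omit [Module.Finite ℤ_[p] M] in
theorem mem_iUnion_quotientSet {x : M} (h : Finite (M ⧸ Submodule.span ℤ_[p] {x})) :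
    x ∈ ⋃ G : X0 p, quotientSet M G := by
  obtain ⟨e⟩ := nonempty_isoClass_grp_equiv (p := p) (M ⧸ Submodule.span ℤ_[p] {x})
  exact Set.mem_iUnion.2 ⟨_, ⟨e.symm⟩⟩

omit [Module.Finite ℤ_[p] M] [Finite F] in
theorem card_surjective_vanishing (G : X0 p) {x : M} (hx : x ∈ quotientSet M G) :
    Nat.card {φ : {φ : M →ₗ[ℤ_[p]] F // Function.Surjective φ} // φ.1 x = 0} = numSur p G.grp F := by
  obtain ⟨e⟩ := hx
  rw [← numSur_congr e (LinearEquiv.refl ℤ_[p] F), numSur]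
  have h0 : ∀ g : (M ⧸ Submodule.span ℤ_[p] {x}) →ₗ[ℤ_[p]] F, (g ∘ₗ Submodule.mkQ _) x = 0 := by
    intro g
    rw [LinearMap.comp_apply, Submodule.mkQ_apply, (Submodule.Quotient.mk_eq_zero _).2
      (Submodule.mem_span_singleton_self x), map_zero]
  have h1 : ∀ φ : {φ : {φ : M →ₗ[ℤ_[p]] F // Function.Surjective φ} // φ.1 x = 0},
      Function.Surjective (Submodule.liftQSpanSingleton x φ.1.1 φ.2) := by
    intro φ y
    obtain ⟨z, hz⟩ := φ.1.2 y
    exact ⟨Submodule.mkQ _ z, hz⟩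
  refine (Nat.card_congr
    { toFun := fun g => ⟨⟨g.1 ∘ₗ Submodule.mkQ _, g.2.comp (Submodule.mkQ_surjective _)⟩, h0 g.1⟩
      invFun := fun φ => ⟨Submodule.liftQSpanSingleton x φ.1.1 φ.2, h1 φ⟩
      left_inv := fun g => ?_
      right_inv := fun φ => rfl }).symm
  refine Subtype.ext (LinearMap.ext fun y => ?_)
  obtain ⟨z, rfl⟩ := Submodule.mkQ_surjective _ y
  rfl

section Topology

variable [TopologicalSpace M] [IsModuleTopology ℤ_[p] M]

omit [Module.Finite ℤ_[p] M] in
theorem isOpen_preimage_of_finite (φ : M →ₗ[ℤ_[p]] F) (S : Set F) : IsOpen (φ ⁻¹' S) := by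
  let _ : TopologicalSpace F := ⊥
  have : DiscreteTopology F := ⟨rfl⟩
  have : ContinuousAdd F := ⟨continuous_of_discreteTopology⟩
  have : ContinuousSMul ℤ_[p] F := by
    refine ⟨continuous_prod_of_discrete_right.2 fun x => ?_⟩
    let f : ℤ_[p] →+ F := (LinearMap.toSpanSingleton ℤ_[p] F x).toAddMonoidHom
    have hf : IsOpen (f.ker : Set ℤ_[p]) := by
      obtain ⟨n, hn⟩ := exists_ker_toSpanSingleton_eq (p := p) x
      have h1 : (f.ker : Set ℤ_[p]) = Metric.closedBall 0 ((p : ℝ) ^ (-(n : ℤ))) := by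
        ext r
        rw [mem_closedBall_zero_iff, PadicInt.norm_le_pow_iff_mem_span_pow]
        change r ∈ LinearMap.ker (LinearMap.toSpanSingleton ℤ_[p] F x) ↔ _
        rw [hn, powIdeal]
      rw [h1]
      refine IsUltrametricDist.isOpen_closedBall _ (zpow_pos ?_ _).ne'
      exact Nat.cast_pos.2 (Fact.out : p.Prime).pos
    refine continuous_of_continuousAt_zero f ?_
    rw [ContinuousAt, map_zero, nhds_discrete F, tendsto_pure]
    exact hf.mem_nhds f.ker.zero_mem
  exact (isOpen_discrete S).preimage (IsModuleTopology.continuous_of_linearMap φ)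

theorem isOpen_quotientSet (G : X0 p) : IsOpen (quotientSet M G) := by
  obtain ⟨n, hn⟩ := exists_powIdeal_smul_eq_bot (p := p) G.grp
  let φ := (powIdeal p (n + 1) • (⊤ : Submodule ℤ_[p] M)).mkQ
  have h1 : quotientSet M G = φ ⁻¹' (φ '' quotientSet M G) := by
    refine (Set.subset_preimage_image _ _).antisymm ?_
    rintro y ⟨x, ⟨e⟩, hxy⟩
    have h2 : powIdeal p n • (⊤ : Submodule ℤ_[p] M) ≤ Submodule.span ℤ_[p] {x} := by
      have := powIdeal_smul_top_le_ker (Submodule.span ℤ_[p] {x}).mkQ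
        (powIdeal_smul_le_range e.symm.toLinearMap e.symm.surjective hn)
      rwa [Submodule.ker_mkQ] at this
    have h3 := span_eq_of_sub_mem h2 ((Submodule.Quotient.eq _).1 hxy)
    exact ⟨(Submodule.quotEquivOfEq _ _ h3.symm).trans e⟩
  rw [h1]
  exact isOpen_preimage_of_finite φ _

variable [MeasurableSpace M] [BorelSpace M] (μ : Measure M) [IsProbabilityMeasure μ]
  [μ.IsAddLeftInvariant]

omit [Module.Finite ℤ_[p] M] in
theorem measure_ker (φ : M →ₗ[ℤ_[p]] F) (hφ : Function.Surjective φ) :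
    μ (LinearMap.ker φ : Set M) = (Nat.card F : ℝ≥0∞)⁻¹ := by
  have : IsTopologicalAddGroup M := IsModuleTopology.topologicalAddGroup ℤ_[p] M
  have e : (M ⧸ (LinearMap.ker φ).toAddSubgroup) ≃ F := (φ.quotKerEquivOfSurjective hφ).toEquiv
  have hi : (LinearMap.ker φ).toAddSubgroup.index = Nat.card F := Nat.card_congr e
  have : (LinearMap.ker φ).toAddSubgroup.FiniteIndex := ⟨by rw [hi]; exact Nat.card_pos.ne'⟩
  have h := (LinearMap.ker φ).toAddSubgroup.index_mul_measure
    ((isOpen_preimage_of_finite φ {0}).measurableSet) μ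
  rw [hi, measure_univ] at h
  exact ENNReal.eq_inv_of_mul_eq_one_left (by rw [mul_comm]; exact h)

/-- The quotient by a Haar-random element is almost surely finite: the exceptional elements lie in
the kernel of a surjection to `ℤ_[p]`. -/
theorem measure_compl_iUnion (h : Module.finrank ℤ_[p] M = 1) :
    μ (⋃ G : X0 p, quotientSet M G)ᶜ = 0 := by
  obtain ⟨ψ, hψ⟩ := exists_surjective_of_finrank_eq_one h
  have hle : ∀ n : ℕ, μ (⋃ G : X0 p, quotientSet M G)ᶜ ≤ ((p : ℝ≥0∞)⁻¹) ^ n := by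
    intro n
    have h1 := measure_ker μ ((powIdeal p n).mkQ ∘ₗ ψ) ((powIdeal p n).mkQ_surjective.comp hψ)
    rw [card_quot_powIdeal, Nat.cast_pow, ENNReal.inv_pow] at h1
    rw [← h1]
    refine measure_mono fun x hx => ?_
    have h2 : ψ x = 0 := by
      by_contra h3
      exact hx (mem_iUnion_quotientSet (finite_quotient_span h ψ h3))
    change ((powIdeal p n).mkQ ∘ₗ ψ) x = 0
    rw [LinearMap.comp_apply, h2, map_zero]
  have hlim := ENNReal.tendsto_pow_atTop_nhds_zero_of_lt_one (r := (p : ℝ≥0∞)⁻¹)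
    (ENNReal.inv_lt_one.2 (by exact_mod_cast (Fact.out : p.Prime).one_lt))
  exact le_antisymm (ge_of_tendsto' hlim hle) zero_le

/-- A surjection from `M` to `F` descends to the quotient by a random element with probability
`1 / #F`. -/
theorem tsum_measure_quotientSet_mul (h : Module.finrank ℤ_[p] M = 1) :
    ∑' G : X0 p, μ (quotientSet M G) * numSur p G.grp F = numSur p M F * (Nat.card F : ℝ≥0∞)⁻¹ := by
  have := finite_linearMap ℤ_[p] M F
  have := Fintype.ofFinite {φ : M →ₗ[ℤ_[p]] F // Function.Surjective φ}
  have hA : ∀ G : X0 p, MeasurableSet (quotientSet M G) := fun G =>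
    (isOpen_quotientSet G).measurableSet
  have hK : ∀ φ : M →ₗ[ℤ_[p]] F, MeasurableSet (LinearMap.ker φ : Set M) := fun φ =>
    (isOpen_preimage_of_finite φ {0}).measurableSet
  have h1 : ∀ G : X0 p, μ (quotientSet M G) * numSur p G.grp F =
      ∑ φ : {φ : M →ₗ[ℤ_[p]] F // Function.Surjective φ},
        μ (quotientSet M G ∩ (LinearMap.ker φ.1 : Set M)) := by
    intro G
    classical
    have h2 : ∀ φ : {φ : M →ₗ[ℤ_[p]] F // Function.Surjective φ},
        μ (quotientSet M G ∩ (LinearMap.ker φ.1 : Set M)) =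
          ∫⁻ x in quotientSet M G, (LinearMap.ker φ.1 : Set M).indicator 1 x ∂μ := by
      intro φ
      rw [lintegral_indicator_one (hK φ.1), Measure.restrict_apply (hK φ.1), Set.inter_comm]
    simp_rw [h2]
    rw [← lintegral_finsetSum _ fun φ _ => measurable_one.indicator (hK φ.1), mul_comm,
      ← setLIntegral_const]
    refine setLIntegral_congr_fun (hA G) fun x hx => ?_
    rw [← card_surjective_vanishing G hx, Nat.card_eq_fintype_card, Fintype.card_subtype]
    simp [Set.indicator_apply]
  simp_rw [h1]
  rw [Summable.tsum_finsetSum fun _ _ => ENNReal.summable]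
  have h3 : ∀ φ : {φ : M →ₗ[ℤ_[p]] F // Function.Surjective φ},
      ∑' G : X0 p, μ (quotientSet M G ∩ (LinearMap.ker φ.1 : Set M)) =
        (Nat.card F : ℝ≥0∞)⁻¹ := by
    intro φ
    rw [← measure_ker μ φ.1 φ.2, ← measure_iUnion, ← Set.iUnion_inter]
    · rw [Set.inter_comm]
      exact measure_inter_conull (measure_compl_iUnion μ h)
    · intro G G' hne
      exact (disjoint_quotientSet hne).mono Set.inter_subset_left Set.inter_subset_left
    · exact fun G => (hA G).inter (hK φ.1)
  simp_rw [h3]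
  rw [Finset.sum_const, Finset.card_univ, nsmul_eq_mul, numSur,
    Nat.card_eq_fintype_card (α := {φ : M →ₗ[ℤ_[p]] F // Function.Surjective φ})]

end Topology

theorem hasSum_dProb (H : X1 p) (F : X0 p) :
    HasSum (fun G : X0 p => dProb H G * cardSur G F) (numSur p H.mod F.grp / Nat.card F.grp) := by
  let _ : TopologicalSpace H.mod := moduleTopology ℤ_[p] H.mod
  have _ : IsModuleTopology ℤ_[p] H.mod := ⟨rfl⟩
  have _ : IsTopologicalAddGroup H.mod := IsModuleTopology.topologicalAddGroup ℤ_[p] H.mod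
  have _ : CompactSpace H.mod := compactSpace_moduleTopology H.mod
  let _ : MeasurableSpace H.mod := borel H.mod
  have _ : BorelSpace H.mod := ⟨rfl⟩
  let μ : Measure H.mod := Measure.addHaarMeasure (⊤ : TopologicalSpace.PositiveCompacts H.mod)
  have hμ : IsProbabilityMeasure μ := ⟨Measure.addHaarMeasure_self⟩
  have h := tsum_measure_quotientSet_mul (F := F.grp) μ (Quotient.out H).finrank_eq
  have htop : (numSur p H.mod F.grp * (Nat.card F.grp : ℝ≥0∞)⁻¹ : ℝ≥0∞) ≠ ∞ :=
    ENNReal.mul_ne_top (ENNReal.natCast_ne_top _)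
      (ENNReal.inv_ne_top.2 (Nat.cast_ne_zero.2 Nat.card_pos.ne'))
  have h1 := ENNReal.hasSum_toReal (h.trans_ne htop)
  rw [← ENNReal.tsum_toReal_eq fun G => ENNReal.ne_top_of_tsum_ne_top (h.trans_ne htop) G, h] at h1
  simp only [ENNReal.toReal_mul, ENNReal.toReal_natCast, ENNReal.toReal_inv] at h1
  rw [div_eq_mul_inv]
  exact h1.congr_fun fun G => rfl

end Haar

/-! ### Surjection moments and homomorphism moments -/

section Moments

variable {p : ℕ} [Fact p.Prime]

noncomputable instance fintypeSubmodule (M : Type) [AddCommGroup M] [Module ℤ_[p] M] [Finite M] :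
    Fintype (Submodule ℤ_[p] M) := Fintype.ofFinite _

noncomputable instance fintypeGrp (G : X0 p) : Fintype G.grp := Fintype.ofFinite _

noncomputable instance fintypeExtOne (G : X0 p) : Fintype (ExtOne ℤ_[p] G.grp ℤ_[p]) :=
  Fintype.ofFinite _

theorem card_hom_eq_sum_numSur (M F : Type) [AddCommGroup M] [Module ℤ_[p] M]
    [Module.Finite ℤ_[p] M] [AddCommGroup F] [Module ℤ_[p] F] [Finite F] :
    Nat.card (M →ₗ[ℤ_[p]] F) = ∑ S : Submodule ℤ_[p] F, numSur p M S := by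
  have := Fintype.ofFinite {S : Submodule ℤ_[p] F // True}
  have h := card_hom_eq_sum (p := p) M F fun _ => True
  rw [Nat.card_congr (Equiv.subtypeUnivEquiv fun _ => trivial)] at h
  rw [h]
  exact Fintype.sum_equiv (Equiv.subtypeUnivEquiv fun _ => trivial) _ _ fun _ => rfl

/-- A function of finite modules whose sums over the submodules vanish is zero. -/
theorem eq_zero_of_sum_submodule {a : X0 p → ℝ}
    (h : ∀ F : X0 p, ∑ S : Submodule ℤ_[p] F.grp, a (isoClass p S) = 0) (F : X0 p) : a F = 0 := by
  induction hk : Nat.card F.grp using Nat.strong_induction_on generalizing F with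
  | _ k ih =>
  have h1 := h F
  rw [Fintype.sum_eq_single ⊤] at h1
  · have h2 := isoClass_eq_iff.2 ⟨(Submodule.topEquiv : (⊤ : Submodule ℤ_[p] F.grp) ≃ₗ[ℤ_[p]] F.grp)⟩
    rwa [h2, isoClass_grp] at h1
  · intro S hS
    refine ih _ ?_ (isoClass p S) rfl
    rw [card_isoClass_grp, ← hk]
    have h2 : (S : Set F.grp).ncard < Nat.card F.grp :=
      Set.ncard_lt_card fun h => hS (SetLike.coe_injective h)
    exact h2

/-- The same for sums over the quotients by cyclic submodules. -/
theorem eq_zero_of_sum_quotient {a : X0 p → ℝ}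
    (h : ∀ F : X0 p, ∑ x : F.grp, a (isoClass p (F.grp ⧸ Submodule.span ℤ_[p] {x})) = 0)
    (F : X0 p) : a F = 0 := by
  induction hk : Nat.card F.grp using Nat.strong_induction_on generalizing F with
  | _ k ih =>
  have h1 := h F
  rw [Fintype.sum_eq_single 0] at h1
  · have h2 := isoClass_eq_iff.2 ⟨Submodule.quotEquivOfEqBot (Submodule.span ℤ_[p] {(0 : F.grp)})
      (Submodule.span_zero_singleton _)⟩
    rwa [h2, isoClass_grp] at h1
  · intro x hx
    refine ih _ ?_ _ rfl
    rw [card_isoClass_grp, ← hk]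
    rw [card_eq_card_quotient_mul_card (Submodule.span ℤ_[p] {x})]
    refine lt_mul_of_one_lt_right Nat.card_pos ?_
    have : Nontrivial (Submodule.span ℤ_[p] {x}) := by
      rw [Submodule.nontrivial_iff_ne_bot, Ne, Submodule.span_singleton_eq_bot]
      exact hx
    exact Finite.one_lt_card

theorem sum_card_submodule_quotient (F : Type) [AddCommGroup F] [Module ℤ_[p] F] [Fintype F] :
    ∑ x : F, Nat.card (Submodule ℤ_[p] (F ⧸ Submodule.span ℤ_[p] {x})) =
      ∑ S : Submodule ℤ_[p] F, Nat.card S := by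
  classical
  have h1 : ∀ x : F, Nat.card (Submodule ℤ_[p] (F ⧸ Submodule.span ℤ_[p] {x})) =
      ∑ S : Submodule ℤ_[p] F, if x ∈ S then 1 else 0 := by
    intro x
    rw [Nat.card_congr (Submodule.comapMkQRelIso (Submodule.span ℤ_[p] {x})).toEquiv,
      Finset.sum_boole, Nat.cast_id, ← Fintype.card_subtype, ← Nat.card_eq_fintype_card]
    exact Nat.card_congr (Equiv.subtypeEquivRight fun S => Submodule.span_singleton_le_iff_mem x S)
  have h2 : ∀ S : Submodule ℤ_[p] F, Nat.card S = ∑ x : F, if x ∈ S then 1 else 0 := by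
    intro S
    rw [Finset.sum_boole, Nat.cast_id, ← Fintype.card_subtype, ← Nat.card_eq_fintype_card]
  simp_rw [h1, h2]
  exact Finset.sum_comm

theorem cardSur_isoClass_right (G : X0 p) (F : Type) [AddCommGroup F] [Module ℤ_[p] F] [Finite F] :
    cardSur G (isoClass p F) = numSur p G.grp F := by
  rw [← cardSur_isoClass, isoClass_grp]

/-- Homomorphism moments are sums of surjection moments over the possible images. -/
theorem summable_mul_card_hom {ν : X0 p → ℝ}
    (h : ∀ F : X0 p, Summable fun G : X0 p => ν G * cardSur G F) (F : Type) [AddCommGroup F]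
    [Module ℤ_[p] F] [Finite F] :
    Summable (fun G : X0 p => ν G * Nat.card (G.grp →ₗ[ℤ_[p]] F)) ∧
    ∑' G : X0 p, ν G * Nat.card (G.grp →ₗ[ℤ_[p]] F) =
      ∑ S : Submodule ℤ_[p] F, ∑' G : X0 p, ν G * cardSur G (isoClass p S) := by
  have h1 : HasSum (fun G : X0 p => ν G * Nat.card (G.grp →ₗ[ℤ_[p]] F))
      (∑ S : Submodule ℤ_[p] F, ∑' G : X0 p, ν G * cardSur G (isoClass p S)) := by
    refine (hasSum_sum fun (S : Submodule ℤ_[p] F) _ => (h (isoClass p S)).hasSum).congr_fun fun G => ?_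
    rw [card_hom_eq_sum_numSur, Nat.cast_sum, Finset.mul_sum]
    simp_rw [cardSur_isoClass_right]
  exact ⟨h1.summable, h1.tsum_eq⟩

/-- The expected number of surjections from `d* G` to `F`. -/
noncomputable def dStarMoment (G F : X0 p) : ℝ :=
  ∑' H : X1 p, dStarProb G H * numSur p H.mod F.grp

theorem dStarProb_nonneg (G : X0 p) (H : X1 p) : 0 ≤ dStarProb G H := by
  rw [dStarProb_eq]
  positivity

theorem dStarMoment_nonneg (G F : X0 p) : 0 ≤ dStarMoment G F :=
  tsum_nonneg fun H => mul_nonneg (dStarProb_nonneg G H) (Nat.cast_nonneg _)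

/-- The expected number of homomorphisms from `d* G` to `F`, sorted by their images on the left and
by the image `x` of the generator of `ℤ_[p]` on the right. -/
theorem sum_dStarMoment (G F : X0 p) :
    ∑ S : Submodule ℤ_[p] F.grp, dStarMoment G (isoClass p S) =
      ∑ x : F.grp, (Nat.card (G.grp →ₗ[ℤ_[p]] F.grp ⧸ Submodule.span ℤ_[p] {x}) : ℝ) := by
  have h0 : (Nat.card (ExtOne ℤ_[p] G.grp ℤ_[p]) : ℝ) ≠ 0 := Nat.cast_ne_zero.2 Nat.card_pos.ne'
  have h1 : ∀ S : Submodule ℤ_[p] F.grp, dStarMoment G (isoClass p S) =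
      (∑ e : ExtOne ℤ_[p] G.grp ℤ_[p], (numSur p (middle G e).mod S : ℝ)) /
        Nat.card (ExtOne ℤ_[p] G.grp ℤ_[p]) := by
    intro S
    rw [dStarMoment, tsum_dStarProb_mul G fun H => (numSur p H.mod (isoClass p S).grp : ℝ)]
    obtain ⟨e'⟩ := nonempty_isoClass_grp_equiv (p := p) S
    simp_rw [numSur_congr (LinearEquiv.refl _ _) e']
  simp_rw [h1]
  rw [← Finset.sum_div, Finset.sum_comm, div_eq_iff h0]
  have h2 := sum_card_hom_middle (F := F.grp) G
  simp_rw [card_hom_eq_sum_numSur (middle G _).mod] at h2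
  exact_mod_cast h2

theorem dStarMoment_le (G F : X0 p) : dStarMoment G F ≤
    ∑ x : F.grp, (Nat.card (G.grp →ₗ[ℤ_[p]] F.grp ⧸ Submodule.span ℤ_[p] {x}) : ℝ) := by
  rw [← sum_dStarMoment]
  have h2 := isoClass_eq_iff.2 ⟨(Submodule.topEquiv : (⊤ : Submodule ℤ_[p] F.grp) ≃ₗ[ℤ_[p]] F.grp)⟩
  rw [isoClass_grp] at h2
  have := Finset.single_le_sum (f := fun S : Submodule ℤ_[p] F.grp => dStarMoment G (isoClass p S))
    (fun S _ => dStarMoment_nonneg G _) (Finset.mem_univ ⊤)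
  rwa [h2] at this

/-- The step `d` divides the expected number of surjections to `F` by `#F`. -/
theorem hasSum_deltaProb_mul (G F : X0 p) :
    HasSum (fun G' : X0 p => deltaProb G G' * cardSur G' F) (dStarMoment G F / Nat.card F.grp) := by
  have h1 := (hasSum_sum fun (e : ExtOne ℤ_[p] G.grp ℤ_[p]) (_ : e ∈ Finset.univ) =>
    hasSum_dProb (middle G e) F).div_const (Nat.card (ExtOne ℤ_[p] G.grp ℤ_[p]) : ℝ)
  have h2 : dStarMoment G F / Nat.card F.grp =
      (∑ e : ExtOne ℤ_[p] G.grp ℤ_[p], (numSur p (middle G e).mod F.grp : ℝ) / Nat.card F.grp) /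
        Nat.card (ExtOne ℤ_[p] G.grp ℤ_[p]) := by
    rw [dStarMoment, tsum_dStarProb_mul G fun H => (numSur p H.mod F.grp : ℝ), ← Finset.sum_div,
      div_right_comm]
  rw [h2]
  refine h1.congr_fun fun G' => ?_
  rw [deltaProb, tsum_dStarProb_mul G fun H => dProb H G', ← Finset.sum_mul, div_mul_eq_mul_div]

theorem deltaProb_nonneg (G G' : X0 p) : 0 ≤ deltaProb G G' :=
  tsum_nonneg fun H => mul_nonneg (dStarProb_nonneg G H) ENNReal.toReal_nonneg

theorem hasSum_deltaProb (G : X0 p) : HasSum (fun G' : X0 p => deltaProb G G') 1 := by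
  -- The total mass is the moment of the trivial group.
  let Z : X0 p := isoClass p (Fin 0 → ℤ_[p])
  have hZ : Nat.card Z.grp = 1 := by rw [card_isoClass_grp, Nat.card_unique]
  have : Subsingleton Z.grp := (Nat.card_eq_one_iff_unique.1 hZ).1
  have h0 : ∀ (M : Type) [AddCommGroup M] [Module ℤ_[p] M] , numSur p M Z.grp = 1 := by
    intro M _ _
    rw [numSur, Nat.card_eq_one_iff_unique]
    exact ⟨⟨fun f g => Subtype.ext (LinearMap.ext fun x => Subsingleton.elim _ _)⟩,
      ⟨0, fun y => ⟨0, Subsingleton.elim _ _⟩⟩⟩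
  have h1 : dStarMoment G Z = 1 := by
    rw [dStarMoment, tsum_dStarProb_mul G fun H => (numSur p H.mod Z.grp : ℝ)]
    simp_rw [h0]
    rw [Finset.sum_const, Finset.card_univ, ← Nat.card_eq_fintype_card, nsmul_eq_mul, Nat.cast_one,
      mul_one, div_self (Nat.cast_ne_zero.2 Nat.card_pos.ne')]
  have h2 := hasSum_deltaProb_mul G Z
  rw [h1, hZ, Nat.cast_one, div_one] at h2
  refine h2.congr_fun fun G' => ?_
  rw [cardSur_eq, h0, Nat.cast_one, mul_one]

theorem summable_mul_dStarMoment {ν : X0 p → ℝ}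
    (h : ∀ F : X0 p, Summable fun G : X0 p => ν G * cardSur G F) (F : X0 p) :
    Summable fun G : X0 p => ν G * dStarMoment G F := by
  have h1 := summable_sum fun (x : F.grp) (_ : x ∈ Finset.univ) =>
    (summable_mul_card_hom h (F.grp ⧸ Submodule.span ℤ_[p] {x})).1.norm
  refine Summable.of_norm_bounded h1 fun G => ?_
  have h2 : ‖ν G * dStarMoment G F‖ = ‖ν G‖ * dStarMoment G F := by
    rw [norm_mul, Real.norm_of_nonneg (dStarMoment_nonneg G F)]
  rw [h2]
  simp_rw [norm_mul, Real.norm_natCast]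
  rw [← Finset.mul_sum]
  exact mul_le_mul_of_nonneg_left (dStarMoment_le G F) (norm_nonneg _)

theorem sum_tsum_mul_dStarMoment {ν : X0 p → ℝ}
    (h : ∀ F : X0 p, Summable fun G : X0 p => ν G * cardSur G F) (F : X0 p) :
    ∑ S : Submodule ℤ_[p] F.grp, ∑' G : X0 p, ν G * dStarMoment G (isoClass p S) =
      ∑ x : F.grp, ∑' G : X0 p,
        ν G * Nat.card (G.grp →ₗ[ℤ_[p]] F.grp ⧸ Submodule.span ℤ_[p] {x}) := by
  rw [← Summable.tsum_finsetSum fun (S : Submodule ℤ_[p] F.grp) _ => summable_mul_dStarMoment h (isoClass p S),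
    ← Summable.tsum_finsetSum fun x _ =>
      (summable_mul_card_hom h (F.grp ⧸ Submodule.span ℤ_[p] {x})).1]
  refine tsum_congr fun G => ?_
  rw [← Finset.mul_sum, ← Finset.mul_sum, sum_dStarMoment]

/-- If the image of `ν` under `d*` has vanishing moments, then so has `ν`: the term `x = 0` of
`sum_dStarMoment` is the homomorphism moment of `ν` for `F`, the others belong to smaller groups. -/
theorem tsum_mul_cardSur_eq_zero {ν : X0 p → ℝ}
    (h : ∀ F : X0 p, Summable fun G : X0 p => ν G * cardSur G F)
    (h0 : ∀ F : X0 p, ∑' G : X0 p, ν G * dStarMoment G F = 0) (F : X0 p) :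
    ∑' G : X0 p, ν G * cardSur G F = 0 := by
  have hcongr : ∀ (A : Type) [AddCommGroup A] [Module ℤ_[p] A] [Finite A],
      ∑' G : X0 p, ν G * Nat.card (G.grp →ₗ[ℤ_[p]] A) =
        ∑' G : X0 p, ν G * Nat.card (G.grp →ₗ[ℤ_[p]] (isoClass p A).grp) := by
    intro A _ _ _
    obtain ⟨e⟩ := nonempty_isoClass_grp_equiv (p := p) A
    simp_rw [card_homs_congr (LinearEquiv.refl _ _) e]
  have h1 : ∀ F : X0 p, ∑' G : X0 p, ν G * Nat.card (G.grp →ₗ[ℤ_[p]] F.grp) = 0 := by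
    refine eq_zero_of_sum_quotient (a := fun F => ∑' G : X0 p,
      ν G * Nat.card (G.grp →ₗ[ℤ_[p]] F.grp)) fun F => ?_
    have h2 := sum_tsum_mul_dStarMoment h F
    simp_rw [h0, Finset.sum_const_zero] at h2
    exact (h2.trans (Finset.sum_congr rfl fun x _ => hcongr _)).symm
  refine eq_zero_of_sum_submodule (a := fun F => ∑' G : X0 p, ν G * cardSur G F) (fun F => ?_) F
  rw [← (summable_mul_card_hom h F.grp).2, h1]

theorem ofReal_mu0 (G : X0 p) : ENNReal.ofReal (mu0 G) = ENNReal.ofReal (c0 p) * wt G := by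
  rw [mu0, div_eq_mul_inv, ENNReal.ofReal_mul (c0_pos p).le, ← wt_toReal,
    ENNReal.ofReal_toReal (wt_ne_top G)]

theorem hasMoments_mu0 : HasMoments (fun G : X0 p => ENNReal.ofReal (mu0 G)) 1 := by
  intro F
  simp_rw [ofReal_mu0, mul_assoc]
  rw [ENNReal.tsum_mul_left, hasMoments_wt p F,
    ENNReal.mul_inv_cancel (ENNReal.ofReal_pos.2 (c0_pos p)).ne' ENNReal.ofReal_ne_top]

theorem hasSum_mu0_mul_cardSur (F : X0 p) : HasSum (fun G : X0 p => mu0 G * cardSur G F) 1 := by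
  have h := hasMoments_mu0.hasSum ENNReal.one_ne_top F
  simpa only [ENNReal.toReal_ofReal (mu0_pos _).le, ENNReal.toReal_one] using h

/-- For `G` distributed according to `μ₀`, the expected number of surjections from `d* G` to `F`
is `#F`. -/
theorem hasSum_mu0_mul_dStarMoment (F : X0 p) :
    HasSum (fun G : X0 p => mu0 G * dStarMoment G F) (Nat.card F.grp) := by
  have h : ∀ F : X0 p, Summable fun G : X0 p => mu0 G * cardSur G F := fun F =>
    (hasSum_mu0_mul_cardSur F).summable
  have h1 := eq_zero_of_sum_submodule
    (a := fun F => ∑' G : X0 p, mu0 G * dStarMoment G F - Nat.card F.grp) (fun F => ?_) F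
  · rw [← sub_eq_zero.1 h1]
    exact (summable_mul_dStarMoment h F).hasSum
  · rw [Finset.sum_sub_distrib, sum_tsum_mul_dStarMoment h F, sub_eq_zero]
    have h2 : ∀ (A : Type) [AddCommGroup A] [Module ℤ_[p] A] [Finite A],
        ∑' G : X0 p, mu0 G * Nat.card (G.grp →ₗ[ℤ_[p]] A) = Nat.card (Submodule ℤ_[p] A) := by
      intro A _ _ _
      rw [(summable_mul_card_hom h A).2]
      simp_rw [(hasSum_mu0_mul_cardSur _).tsum_eq]
      rw [Finset.sum_const, Finset.card_univ, nsmul_eq_mul, mul_one, Nat.card_eq_fintype_card]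
    simp_rw [h2, card_isoClass_grp]
    exact_mod_cast sum_card_submodule_quotient (p := p) F.grp

/-- The Cohen-Lenstra measure is stationary: its image under `Δ₀` has the same moments. -/
theorem hasSum_mu0_mul_deltaProb (G' : X0 p) :
    HasSum (fun G : X0 p => mu0 G * deltaProb G G') (mu0 G') := by
  have hw : HasMoments (fun G' : X0 p => ∑' G : X0 p, ENNReal.ofReal (mu0 G * deltaProb G G')) 1 := by
    intro F
    have h1 : ∀ G : X0 p, ∑' G' : X0 p, ENNReal.ofReal (mu0 G * deltaProb G G') * cardSur G' F =
        ENNReal.ofReal (mu0 G * dStarMoment G F) * (Nat.card F.grp : ℝ≥0∞)⁻¹ := by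
      intro G
      have h2 := (hasSum_deltaProb_mul G F).mul_left (mu0 G)
      have h3 : ∀ G' : X0 p, 0 ≤ mu0 G * (deltaProb G G' * cardSur G' F) := fun G' =>
        mul_nonneg (mu0_pos G).le (mul_nonneg (deltaProb_nonneg G G') (Nat.cast_nonneg _))
      rw [← ENNReal.ofReal_natCast, ← ENNReal.ofReal_inv_of_pos (Nat.cast_pos.2 Nat.card_pos),
        ← ENNReal.ofReal_mul (mul_nonneg (mu0_pos G).le (dStarMoment_nonneg G F)), mul_assoc,
        ← div_eq_mul_inv, ← h2.tsum_eq, ENNReal.ofReal_tsum_of_nonneg h3 h2.summable]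
      refine tsum_congr fun G' => ?_
      rw [← mul_assoc, ENNReal.ofReal_mul (mul_nonneg (mu0_pos G).le (deltaProb_nonneg G G')),
        ENNReal.ofReal_natCast]
    simp_rw [← ENNReal.tsum_mul_right]
    rw [ENNReal.tsum_comm]
    simp_rw [h1]
    have h4 := hasSum_mu0_mul_dStarMoment F
    rw [ENNReal.tsum_mul_right, ← ENNReal.ofReal_tsum_of_nonneg
      (fun G => mul_nonneg (mu0_pos G).le (dStarMoment_nonneg G F)) h4.summable, h4.tsum_eq,
      ENNReal.ofReal_natCast, ENNReal.mul_inv_cancel (Nat.cast_ne_zero.2 Nat.card_pos.ne')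
        (ENNReal.natCast_ne_top _)]
  have h := hw.unique hasMoments_mu0 ENNReal.one_ne_top G'
  have htop : ∑' G : X0 p, ENNReal.ofReal (mu0 G * deltaProb G G') ≠ ∞ :=
    h.trans_ne ENNReal.ofReal_ne_top
  have h1 := ENNReal.hasSum_toReal htop
  rw [← ENNReal.tsum_toReal_eq fun G => ENNReal.ofReal_ne_top, h,
    ENNReal.toReal_ofReal (mu0_pos G').le] at h1
  refine h1.congr_fun fun G => ?_
  rw [ENNReal.toReal_ofReal (mul_nonneg (mu0_pos G).le (deltaProb_nonneg G G'))]

end Moments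

/-! ### The operator `Δ₀` -/

section Delta

variable {p : ℕ} [Fact p.Prime]

theorem deltaProb_le_one (G G' : X0 p) : deltaProb G G' ≤ 1 :=
  le_hasSum (hasSum_deltaProb G) G' fun _ _ => deltaProb_nonneg G _

theorem summable_sq_mul_deltaProb (ν : L2 p) (G' : X0 p) :
    Summable fun G : X0 p => ν G ^ 2 / mu0 G * deltaProb G G' := by
  have hν : Summable fun G : X0 p => ν G ^ 2 / mu0 G := ν.2
  have h0 : ∀ G : X0 p, 0 ≤ ν G ^ 2 / mu0 G := fun G => div_nonneg (sq_nonneg _) (mu0_pos G).le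
  exact Summable.of_nonneg_of_le (fun G => mul_nonneg (h0 G) (deltaProb_nonneg G G'))
    (fun G => mul_le_of_le_one_right (h0 G) (deltaProb_le_one G G')) hν

theorem summable_mul_deltaProb (ν : L2 p) (G' : X0 p) :
    Summable fun G : X0 p => ν G * deltaProb G G' := by
  refine Summable.of_norm_bounded
    ((summable_sq_mul_deltaProb ν G').add (hasSum_mu0_mul_deltaProb G').summable) fun G => ?_
  have hm := mu0_pos G
  rw [norm_mul, Real.norm_of_nonneg (deltaProb_nonneg G G'), ← add_mul, Real.norm_eq_abs]
  refine mul_le_mul_of_nonneg_right ?_ (deltaProb_nonneg G G')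
  rw [div_add' _ _ _ hm.ne', le_div_iff₀ hm, ← sq_abs]
  nlinarith [sq_nonneg (|ν G| - mu0 G), abs_nonneg (ν G), mul_nonneg (abs_nonneg (ν G)) hm.le]

/-- Jensen's inequality for the density of `ν` with respect to the stationary measure `μ₀`. -/
theorem sq_tsum_mul_deltaProb_le (ν : L2 p) (G' : X0 p) :
    (∑' G : X0 p, ν G * deltaProb G G') ^ 2 / mu0 G' ≤
      ∑' G : X0 p, ν G ^ 2 / mu0 G * deltaProb G G' := by
  have hm := mu0_pos G'
  have h1 := (summable_sq_mul_deltaProb ν G').hasSum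
  have h2 := (summable_mul_deltaProb ν G').hasSum
  have h3 := hasSum_mu0_mul_deltaProb G'
  set A := ∑' G : X0 p, ν G ^ 2 / mu0 G * deltaProb G G'
  set B := ∑' G : X0 p, ν G * deltaProb G G'
  -- Expand the weighted sum of the squares `(ν G / mu0 G - B / mu0 G') ^ 2`.
  have h4 := (h1.sub (h2.mul_left (2 * (B / mu0 G')))).add (h3.mul_left ((B / mu0 G') ^ 2))
  have h5 := h4.nonneg fun G => ?_
  · have h6 : A - 2 * (B / mu0 G') * B + (B / mu0 G') ^ 2 * mu0 G' = A - B ^ 2 / mu0 G' := by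
      field_simp
      ring
    rw [h6] at h5
    linarith
  · have hG := mu0_pos G
    have h7 : ν G ^ 2 / mu0 G * deltaProb G G' - 2 * (B / mu0 G') * (ν G * deltaProb G G') +
        (B / mu0 G') ^ 2 * (mu0 G * deltaProb G G') =
        deltaProb G G' * mu0 G * (ν G / mu0 G - B / mu0 G') ^ 2 := by
      field_simp
      ring
    change 0 ≤ ν G ^ 2 / mu0 G * deltaProb G G' - 2 * (B / mu0 G') * (ν G * deltaProb G G') +
        (B / mu0 G') ^ 2 * (mu0 G * deltaProb G G')
    rw [h7]
    exact mul_nonneg (mul_nonneg (deltaProb_nonneg G G') hG.le) (sq_nonneg _)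

theorem summable_prod_mul_deltaProb {a : X0 p → ℝ} (h0 : ∀ G, 0 ≤ a G) (ha : Summable a) :
    Summable fun x : X0 p × X0 p => a x.1 * deltaProb x.1 x.2 := by
  have h1 : ∀ x : X0 p × X0 p, 0 ≤ a x.1 * deltaProb x.1 x.2 := fun x =>
    mul_nonneg (h0 x.1) (deltaProb_nonneg x.1 x.2)
  refine (summable_prod_of_nonneg h1).2
    ⟨fun G => ((hasSum_deltaProb G).mul_left (a G)).summable, ha.congr fun G => ?_⟩
  exact (((hasSum_deltaProb G).mul_left (a G)).tsum_eq.trans (mul_one _)).symm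

theorem hasSum_tsum_mul_deltaProb {a : X0 p → ℝ} (h0 : ∀ G, 0 ≤ a G) (ha : Summable a) :
    HasSum (fun G' : X0 p => ∑' G : X0 p, a G * deltaProb G G') (∑' G, a G) := by
  have h := summable_prod_mul_deltaProb h0 ha
  have h1 : ∑' G' : X0 p, ∑' G : X0 p, a G * deltaProb G G' = ∑' G, a G :=
    (Summable.tsum_comm h).trans (tsum_congr fun G =>
      ((hasSum_deltaProb G).mul_left (a G)).tsum_eq.trans (mul_one _))
  rw [← h1]
  exact h.prod_symm.prod.hasSum

theorem hasSum_tsum_sq_mul_deltaProb (ν : L2 p) :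
    HasSum (fun G' : X0 p => ∑' G : X0 p, ν G ^ 2 / mu0 G * deltaProb G G') (‖ν‖ ^ 2) := by
  rw [norm_sq_def]
  exact hasSum_tsum_mul_deltaProb (fun G => div_nonneg (sq_nonneg _) (mu0_pos G).le) ν.2

theorem summable_sq_tsum_mul_deltaProb (ν : L2 p) :
    Summable fun G' : X0 p => (∑' G : X0 p, ν G * deltaProb G G') ^ 2 / mu0 G' :=
  Summable.of_nonneg_of_le (fun G' => div_nonneg (sq_nonneg _) (mu0_pos G').le)
    (sq_tsum_mul_deltaProb_le ν) (hasSum_tsum_sq_mul_deltaProb ν).summable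

variable (p) in
/-- The operator `Δ₀` as a linear map. -/
noncomputable def deltaLinear : L2 p →ₗ[ℝ] L2 p where
  toFun ν := ⟨fun G' => ∑' G : X0 p, ν G * deltaProb G G', summable_sq_tsum_mul_deltaProb ν⟩
  map_add' ν η := L2.ext fun G' => by
    change ∑' G : X0 p, (ν + η) G * deltaProb G G' =
      ∑' G : X0 p, ν G * deltaProb G G' + ∑' G : X0 p, η G * deltaProb G G'
    rw [← (summable_mul_deltaProb ν G').tsum_add (summable_mul_deltaProb η G')]
    refine tsum_congr fun G => ?_
    rw [L2.add_apply, add_mul]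
  map_smul' c ν := L2.ext fun G' => by
    change ∑' G : X0 p, (c • ν) G * deltaProb G G' = c * ∑' G : X0 p, ν G * deltaProb G G'
    rw [← tsum_mul_left]
    refine tsum_congr fun G => ?_
    rw [L2.smul_apply, mul_assoc]

variable (p) in
/-- The operator `Δ₀`. -/
noncomputable def delta : L2 p →L[ℝ] L2 p :=
  (deltaLinear p).mkContinuous 1 fun ν => by
    rw [one_mul]
    refine le_of_sq_le_sq ?_ (norm_nonneg _)
    rw [norm_sq_def, ← (hasSum_tsum_sq_mul_deltaProb ν).tsum_eq]
    exact (summable_sq_tsum_mul_deltaProb ν).tsum_le_tsum (sq_tsum_mul_deltaProb_le ν)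
      (hasSum_tsum_sq_mul_deltaProb ν).summable

theorem isDelta0_delta : IsDelta0 (delta p) := fun ν G' => (summable_mul_deltaProb ν G').hasSum

theorem summable_abs_mul_cardSur (ν : L2 p) (F : X0 p) :
    Summable fun G : X0 p => |ν G| * cardSur G F :=
  (summable_mul_cardSur ν F).norm.congr fun G => by
    rw [norm_mul, Real.norm_natCast, Real.norm_eq_abs]

/-- The moments of `Δ₀ ν` are those of `d* ν`, divided by the order of the test group. -/
theorem tsum_delta_mul_cardSur (ν : L2 p) (F : X0 p) :
    ∑' G' : X0 p, delta p ν G' * cardSur G' F =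
      (∑' G : X0 p, ν G * dStarMoment G F) / Nat.card F.grp := by
  have h1 : ∀ G : X0 p, HasSum (fun G' : X0 p => ν G * deltaProb G G' * cardSur G' F)
      (ν G * dStarMoment G F / Nat.card F.grp) := fun G => by
    rw [mul_div_assoc]
    exact ((hasSum_deltaProb_mul G F).mul_left (ν G)).congr_fun fun G' => by ring
  have h2 : ∀ G : X0 p, HasSum (fun G' : X0 p => ‖ν G * deltaProb G G' * cardSur G' F‖)
      (|ν G| * dStarMoment G F / Nat.card F.grp) := fun G => by
    rw [mul_div_assoc]
    refine ((hasSum_deltaProb_mul G F).mul_left |ν G|).congr_fun fun G' => ?_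
    rw [norm_mul, norm_mul, Real.norm_natCast, Real.norm_of_nonneg (deltaProb_nonneg G G'),
      Real.norm_eq_abs, mul_assoc]
  have h : Summable fun x : X0 p × X0 p => ν x.1 * deltaProb x.1 x.2 * cardSur x.2 F := by
    rw [← summable_norm_iff, summable_prod_of_nonneg fun x => norm_nonneg _]
    refine ⟨fun G => (h2 G).summable, ?_⟩
    refine ((summable_mul_dStarMoment (summable_abs_mul_cardSur ν) F).div_const
      (Nat.card F.grp : ℝ)).congr fun G => ?_
    rw [(h2 G).tsum_eq]
  calc ∑' G' : X0 p, delta p ν G' * cardSur G' F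
      = ∑' G' : X0 p, ∑' G : X0 p, ν G * deltaProb G G' * cardSur G' F := by
        refine tsum_congr fun G' => ?_
        rw [tsum_mul_right]
        rfl
    _ = ∑' G : X0 p, ∑' G' : X0 p, ν G * deltaProb G G' * cardSur G' F :=
        Summable.tsum_comm h
    _ = _ := by
        rw [← tsum_div_const]
        exact tsum_congr fun G => (h1 G).tsum_eq

theorem delta_injective (ν : L2 p) (h : delta p ν = 0) : ν = 0 := by
  refine eq_zero_of_tsum_mul_cardSur ν
    (tsum_mul_cardSur_eq_zero (summable_mul_cardSur ν) fun F => ?_)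
  have h1 := tsum_delta_mul_cardSur ν F
  rw [h] at h1
  simp only [L2.zero_apply, zero_mul, tsum_zero] at h1
  exact (div_eq_zero_iff.1 h1.symm).resolve_right (Nat.cast_ne_zero.2 Nat.card_pos.ne')

theorem ker_delta : (delta p).ker = ⊥ :=
  LinearMap.ker_eq_bot'.2 delta_injective

/-- The range of `𝔉` is closed, and a measure orthogonal to it has vanishing moments. -/
theorem range_fourier : (fourier p).range = ⊤ := by
  have hiso : Isometry (fourier p) := AddMonoidHomClass.isometry_of_norm _ norm_fourier
  have hclosed : IsClosed ((fourier p).range : Set (L2 p)) :=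
    hiso.isClosedEmbedding.isClosed_range
  rw [← hclosed.submodule_topologicalClosure_eq, Submodule.topologicalClosure_eq_top_iff,
    Submodule.eq_bot_iff]
  intro ν hν
  refine eq_zero_of_tsum_mul_cardSur ν fun F => ?_
  have h1 := Submodule.inner_left_of_mem_orthogonal
    (K := (fourier p).range) ⟨surFrom F, fourier_surFrom F⟩ hν
  rw [inner_surTo] at h1
  exact (mul_eq_zero.1 h1).resolve_left (inv_ne_zero (Real.sqrt_pos.2 (c0_pos p)).ne')

end Delta
end CohenLenstra

theorem mainTheorem2 (p : ℕ) [Fact p.Prime] :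
    ∃ Δ₀ 𝔉 : CohenLenstra.L2 p →L[ℝ] CohenLenstra.L2 p,
      CohenLenstra.IsDelta0 Δ₀ ∧
      CohenLenstra.IsFourier 𝔉 ∧
      (∀ 𝔉' : CohenLenstra.L2 p →L[ℝ] CohenLenstra.L2 p, CohenLenstra.IsFourier 𝔉' → 𝔉' = 𝔉) ∧
      (∀ ν : CohenLenstra.L2 p, ‖𝔉 ν‖ = ‖ν‖) ∧
      𝔉.rangeᗮ = Δ₀.ker ∧
      𝔉.range = Δ₀.kerᗮ ∧
      Δ₀.range ≤ 𝔉.range := by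
  refine ⟨CohenLenstra.delta p, CohenLenstra.fourier p, CohenLenstra.isDelta0_delta,
    CohenLenstra.isFourier_fourier p, fun _ => CohenLenstra.eq_fourier_of_isFourier,
    CohenLenstra.norm_fourier, ?_, ?_, ?_⟩
  · rw [CohenLenstra.range_fourier, CohenLenstra.ker_delta, Submodule.top_orthogonal_eq_bot]
  · rw [CohenLenstra.range_fourier, CohenLenstra.ker_delta, Submodule.bot_orthogonal_eq_top]
  · rw [CohenLenstra.range_fourier]
    exact le_top
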